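/- Let $h>0$ and let $X=(X_t)_{t\ge 0}$ be an upwards skip-free Lévy chain with step $h$, that is, a compound Poisson process with càdlàg paths and $X_0=0$ a.s., adapted to a filtration and with increments independent of the past, whose Lévy measure $\lambda$ is finite with $\operatorname{supp}\lambda\subset h\mathbb Z$, $\lambda(\{0\})=0$ and $\operatorname{supp}(\lambda|_{(0,\infty)})=\{h\}$; thus $\mathsf E[e^{izX_t}]=\exp\{t\int(e^{izx}-1)\lambda(dx)\}$ for $z\in\mathbb R$. Let $\psi(\beta)=\int(e^{\beta x}-1)\,\lambda(dx)$, $\beta\ge 0$, be its Laplace exponent. Then $\psi|_{[0,\infty)}$ has a largest root $\Phi(0)$, $\psi:[\Phi(0),\infty)\to[0,\infty)$ is a bijection, with inverse denoted $\Phi$, and the right derivative $\psi'(0+)=\lim_{\beta\downarrow 0}(\psi(\beta)-\psi(0))/\beta$ exists in $[-\infty,\infty)$. Write $\overline X_t=\sup_{0\le s\le t}X_s$, $\overline X_\infty=\sup_{s\ge 0}X_s$ and $T_x=\inf\{t\ge0:X_t\ge x\}$ (with $\inf\emptyset=\infty$). Call a random variable geometric with failure probability $a\in[0,1)$ if it takes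 the value $k$ with probability $(1-a)a^k$, $k=0,1,2,\dots$ **Theorem (Supremum process and long-term behaviour).** (i) For every $p>0$ and every exponentially distributed random time $e_p$ with parameter $p$ (mean $1/p$) that is independent of $X$, $\overline X_{e_p}/h$ is geometric with failure probability $e^{-\Phi(p)h}$. (ii) $X$ drifts to $+\infty$ ($X_t\to+\infty$ a.s.), oscillates ($\limsup_{t\to\infty} X_t=+\infty$ and $\liminf_{t\to\infty} X_t=-\infty$ a.s.) or drifts to $-\infty$ ($X_t\to-\infty$ a.s.) if and only if $\psi'(0+)$ is positive, zero or negative, respectively. In the last case $\overline X_\infty/h$ is geometric with failure probability $e^{-\Phi(0)h}$. (iii) Almost surely, $T_0=0$ and $(T_{nh})_{n\ge0}$ is strictly increasing as long as it is finite. Let $\zeta=\inf\{n\ge 0:T_{nh}=\infty\}$ be its explosion time. If $\Phi(0)>0$, then $\zeta-1$ is geometric with failure probability $e^{-\Phi(0)h}$; if $\Phi(0)=0$, then $\zeta=\infty$ a.s. There is a probability law $F$ on $(0,\infty)$ such that, for every $n$, conditionally on $\{n<\zeta\}$ the increments $T_{kh}-T_{(k-1)h}$, $1\le k\le n$, are independent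 with law $F$. Moreover $(T_{nh})_{n\ge0}$ is a killed random walk: it has the same law as the sequence $(S_n)_{n\ge0}$ with $S_n=\xi_1+\dots+\xi_n$ for $n<N$ and $S_n=\infty$ for $n\ge N$, where $\xi_1,\xi_2,\dots$ are independent with law $F$ and $N$ is independent of them and distributed as $\zeta$. -/

import Mathlib

open MeasureTheory ProbabilityTheory Filter Set
open scoped NNReal ENNReal Topology

noncomputable section

namespace SkipFree

/-- `X` is a real-valued Lévy process relative to the filtration `ℱ`: adapted, all paths are
càdlàg, started at `0` almost surely, with stationary increments that are independent of the
past. -/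
structure IsLevyProcess {Ω : Type*} {mΩ : MeasurableSpace Ω} (μ : Measure Ω)
    (ℱ : Filtration ℝ≥0 mΩ) (X : ℝ≥0 → Ω → ℝ) : Prop where
  adapted : Adapted ℱ X
  right_continuous : ∀ ω t, ContinuousWithinAt (fun s => X s ω) (Ici t) t
  left_limits : ∀ ω t, ∃ l : ℝ, Tendsto (fun s => X s ω) (𝓝[<] t) (𝓝 l)
  start : ∀ᵐ ω ∂μ, X 0 ω = 0
  indep_increments : ∀ s t, s ≤ t →
    Indep (ℱ s) (MeasurableSpace.comap (fun ω => X t ω - X s ω) inferInstance) μ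
  stationary_increments : ∀ s t, s ≤ t →
    IdentDistrib (fun ω => X t ω - X s ω) (X (t - s)) μ μ

/-- `X` is a compound Poisson process with Lévy measure `ν`: `ν` is a nonzero finite measure
without atom at `0`, and `X` is a Lévy process with
`E[exp(i z X_t)] = exp(t ∫ (exp(i z x) - 1) ν(dx))`. -/
structure IsCompoundPoisson {Ω : Type*} {mΩ : MeasurableSpace Ω} (μ : Measure Ω)
    (ℱ : Filtration ℝ≥0 mΩ) (X : ℝ≥0 → Ω → ℝ) (ν : Measure ℝ) : Prop where
  levy : IsLevyProcess μ ℱ X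
  finite : IsFiniteMeasure ν
  ne_zero : ν ≠ 0
  no_atom_zero : ν {0} = 0
  charFun_eq : ∀ (t : ℝ≥0) (z : ℝ), charFun (μ.map (X t)) z =
    Complex.exp ((t : ℂ) * ∫ x : ℝ, (Complex.exp (Complex.I * z * x) - 1) ∂ν)

/-- `X` is an upwards skip-free Lévy chain with step `h` and Lévy measure `ν`. -/
structure IsSkipFreeLevyChain {Ω : Type*} {mΩ : MeasurableSpace Ω} (μ : Measure Ω)
    (ℱ : Filtration ℝ≥0 mΩ) (X : ℝ≥0 → Ω → ℝ) (ν : Measure ℝ) (h : ℝ) : Prop where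
  compoundPoisson : IsCompoundPoisson μ ℱ X ν
  step_pos : 0 < h
  support_lattice : ν.support ⊆ range (fun k : ℤ => h * (k : ℝ))
  support_pos : (ν.restrict (Ioi 0)).support = {h}

/-- The Laplace exponent `ψ(β) = ∫ (e^{βx} - 1) ν(dx)`, used for `β ≥ 0` only. -/
def laplaceExponent (ν : Measure ℝ) (β : ℝ) : ℝ :=
  ∫ x, (Real.exp (β * x) - 1) ∂ν

/-- The largest root of `ψ` on `[0, ∞)`. -/
def largestRoot (ν : Measure ℝ) : ℝ :=
  sSup {β : ℝ | 0 ≤ β ∧ laplaceExponent ν β = 0}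

/-- `Φ`, the inverse of `ψ` restricted to `[largest root, ∞)`. -/
def laplaceInverse (ν : Measure ℝ) : ℝ → ℝ :=
  Function.invFunOn (laplaceExponent ν) (Ici (largestRoot ν))

/-- The running supremum `sup {X_s : 0 ≤ s ≤ t}`. -/
def runningSup {Ω : Type*} (X : ℝ≥0 → Ω → ℝ) (t : ℝ≥0) (ω : Ω) : EReal :=
  ⨆ s : ℝ≥0, ⨆ _ : s ≤ t, (X s ω : EReal)

/-- The overall supremum `sup {X_s : s ≥ 0}`. -/
def overallSup {Ω : Type*} (X : ℝ≥0 → Ω → ℝ) (ω : Ω) : EReal :=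
  ⨆ s : ℝ≥0, (X s ω : EReal)

/-- The first entrance time `T_x = inf {t ≥ 0 : X_t ≥ x}`, equal to `∞` if there is no such `t`. -/
def passageTime {Ω : Type*} (X : ℝ≥0 → Ω → ℝ) (x : ℝ) (ω : Ω) : ℝ≥0∞ :=
  ⨅ t : ℝ≥0, ⨅ _ : x ≤ X t ω, (t : ℝ≥0∞)

def DriftsToPosInfty {Ω : Type*} {mΩ : MeasurableSpace Ω} (μ : Measure Ω)
    (X : ℝ≥0 → Ω → ℝ) : Prop :=
  ∀ᵐ ω ∂μ, Tendsto (fun t => X t ω) atTop atTop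

def DriftsToNegInfty {Ω : Type*} {mΩ : MeasurableSpace Ω} (μ : Measure Ω)
    (X : ℝ≥0 → Ω → ℝ) : Prop :=
  ∀ᵐ ω ∂μ, Tendsto (fun t => X t ω) atTop atBot

def Oscillates {Ω : Type*} {mΩ : MeasurableSpace Ω} (μ : Measure Ω)
    (X : ℝ≥0 → Ω → ℝ) : Prop :=
  ∀ᵐ ω ∂μ, limsup (fun t => (X t ω : EReal)) atTop = ⊤ ∧
    liminf (fun t => (X t ω : EReal)) atTop = ⊥

/-- `Y` is geometrically distributed on `{0, 1, 2, …}` with failure probability `a`: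
`P(Y = k) = (1 - a) a ^ k`, where the success probability `1 - a` is in `(0, 1]`. -/
def HasGeometricLaw {Ω : Type*} {mΩ : MeasurableSpace Ω} (μ : Measure Ω)
    (Y : Ω → EReal) (a : ℝ) : Prop :=
  ∃ q : unitInterval, q ≠ 0 ∧ (q : ℝ) = 1 - a ∧
    HasLaw Y ((geometricMeasure q).map (fun n : ℕ => ((n : ℝ) : EReal))) μ

/-- `G` is the law of `1 + g` with `g` geometric on `{0, 1, 2, …}` with failure probability `a < 1`,
or, in the degenerate case `a = 1`, the point mass at `∞`. -/
def IsGeometricKillingLaw (G : Measure ℕ∞) (a : ℝ) : Prop :=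
  (∃ q : unitInterval, q ≠ 0 ∧ (q : ℝ) = 1 - a ∧
    G = (geometricMeasure q).map (fun n : ℕ => (n : ℕ∞) + 1)) ∨
  (a = 1 ∧ G = Measure.dirac ⊤)

/-- The explosion time `inf {n : S_n = ∞}` of a `[0, ∞]`-valued sequence. -/
def explosionTime (S : ℕ → ℝ≥0∞) : ℕ∞ :=
  ⨅ n : ℕ, ⨅ _ : S n = ⊤, (n : ℕ∞)

/-- The walk with steps `ξ 0, ξ 1, …`, started at `0` and sent to `∞` at time `N`. -/
def killedWalk (ξ : ℕ → ℝ≥0∞) (N : ℕ∞) (n : ℕ) : ℝ≥0∞ :=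
  if (n : ℕ∞) < N then ∑ i ∈ Finset.range n, ξ i else ⊤

/-- `S` is, in law, a random walk with independent steps of law `F`, killed at an independent time
of law `G`. -/
def IsKilledRandomWalk {Ω : Type*} {mΩ : MeasurableSpace Ω} (μ : Measure Ω)
    (S : ℕ → Ω → ℝ≥0∞) (F : Measure ℝ≥0∞) (G : Measure ℕ∞) : Prop :=
  HasLaw (fun ω n => S n ω)
    (((Measure.infinitePi (fun _ : ℕ => F)).prod G).map (fun z => killedWalk z.1 z.2)) μ

/-- Up to explosion, `S` has stationary independent increments of law `F`, independent of the
explosion time: for every `n`, given that explosion occurs after `n`, the first `n` increments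
are independent, each of law `F`. -/
def HasStationaryIndepIncrementsUpToExplosion {Ω : Type*} {mΩ : MeasurableSpace Ω} (μ : Measure Ω)
    (S : ℕ → Ω → ℝ≥0∞) (F : Measure ℝ≥0∞) : Prop :=
  ∀ n : ℕ, HasLaw (fun ω (k : Fin n) => S (k + 1) ω - S k ω)
    (Measure.pi (fun _ : Fin n => F))
    (μ[|{ω | (n : ℕ∞) < explosionTime (fun m => S m ω)}])

end SkipFree

end

/-! Two facts drive the proof. The chain climbs one level at a time, so at time T_{nh} it sits
exactly at nh; and exp(βX_t - tψ(β)) is a martingale for β ≥ 0. With β = Φ(p), so that ψ(β) = p,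
optional stopping at consecutive level times gives E[e^{-pT_{(n+1)h}}; B] = e^{-Φ(p)h}
E[e^{-pT_{nh}}; B] for every event B of the past of T_{nh} (`setLIntegral_expNeg_levelTime_succ`).
Dividing out e^{-pT_{nh}} and inverting the Laplace transform shows that a finite increment
T_{(n+1)h} - T_{nh} is independent of that past and distributed like T_h (`measure_inter_sub_mem`);
this is the only form of the strong Markov property that is needed. Letting p decrease to 0 gives
P(T_h < ∞) = e^{-Φ(0)h}. By induction the increments have a product law up to explosion
(`measure_incrementEvent`), and the killed random walk and the law of its explosion time follow. The
suprema are read off from the same times: level nh is reached by an independent exponential time e_p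
with probability E[e^{-pT_{nh}}] = e^{-nΦ(p)h}, and it is ever reached with probability e^{-nΦ(0)h}.

That paths are skip-free has to be extracted from the one-dimensional laws. A Chernoff bound makes
an increment of size at least 2h over a time δ an event of probability O(δ²); Borel-Cantelli along
refining grids then rules out jumping over a level (`ae_goodPath`). After that the process is
replaced by an indistinguishable one all of whose paths are good (`exists_regular`).

For the long-term behaviour the process is sampled at integer times, which gives a random walk with
mean ψ'(0+) when this is finite. A positive mean is handled by the strong law of large numbers. If
ψ'(0+) < 0, then ψ(β) < 0 for some β > 0 and the sum of the e^{βX_n} is integrable, which also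
covers ψ'(0+) = -∞. A centred nondegenerate walk is unbounded on both sides, because a stationary
solution of the Lindley recursion must be infinite (`eq_top_of_lindley`). Drift passes from integer
to real times since after each visit to a set the chain rests there until the next integer with
probability bounded below (`ae_eventually_notMem`). The three regimes exclude each other, so
implications suffice. -/

namespace SkipFree

/-! ### The Laplace exponent and its inverse. -/

/-- The properties of the Lévy measure of an upwards skip-free Lévy chain with step `h`. -/
structure SkipFreeJumps (ν : Measure ℝ) (h : ℝ) : Prop where
  step_pos : 0 < h
  finite : IsFiniteMeasure ν
  lattice : ∀ᵐ x ∂ν, ∃ k : ℤ, x = h * k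
  le_step : ∀ᵐ x ∂ν, x ≤ h
  atom_ne_zero : ν {h} ≠ 0

/-- A measure on the line is carried by its support, which turns the support conditions into almost
everywhere statements. The atom at `h` exists because the restriction to the positive half-line is
carried by `{h}` and has nonempty support. -/
lemma IsSkipFreeLevyChain.skipFreeJumps {Ω : Type*} {mΩ : MeasurableSpace Ω} {μ : Measure Ω}
    {ℱ : Filtration ℝ≥0 mΩ} {X : ℝ≥0 → Ω → ℝ} {ν : Measure ℝ} {h : ℝ}
    (hX : IsSkipFreeLevyChain μ ℱ X ν h) : SkipFreeJumps ν h := by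
  have := hX.compoundPoisson.finite
  have hpos : ∀ᵐ x ∂(ν.restrict (Ioi 0)), x = h := by
    have := Measure.support_mem_ae (μ := ν.restrict (Ioi 0))
    rw [hX.support_pos] at this
    exact this
  refine ⟨hX.step_pos, this, ?_, ?_, ?_⟩
  · filter_upwards [Measure.support_mem_ae (μ := ν)] with x hx
    obtain ⟨k, hk⟩ := hX.support_lattice hx
    exact ⟨k, hk.symm⟩
  · rw [ae_restrict_iff' measurableSet_Ioi] at hpos
    filter_upwards [hpos] with x hx
    rcases lt_or_ge 0 x with h0 | h0
    · exact (hx h0).le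
    · exact h0.trans hX.step_pos.le
  · intro h0
    have hne : ν.restrict (Ioi 0) ≠ 0 := by
      rw [← Measure.nonempty_support_iff, hX.support_pos]
      exact singleton_nonempty h
    apply hne
    have h1 : ∀ᵐ x ∂(ν.restrict (Ioi 0)), x ≠ h := by
      refine ae_restrict_of_ae ?_
      rw [ae_iff]
      simpa using h0
    have h2 : ∀ᵐ x ∂(ν.restrict (Ioi 0)), False := by
      filter_upwards [hpos, h1] with x hx hx' using hx' hx
    rw [← ae_eq_bot]
    exact eventually_false_iff_eq_bot.1 h2

namespace SkipFreeJumps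

variable {ν : Measure ℝ} {h : ℝ} (hν : SkipFreeJumps ν h)
include hν

lemma exp_le {β : ℝ} (hβ : 0 ≤ β) : ∀ᵐ x ∂ν, Real.exp (β * x) ≤ Real.exp (β * h) := by
  filter_upwards [hν.le_step] with x hx
  gcongr

lemma integrable_exp {β : ℝ} (hβ : 0 ≤ β) : Integrable (fun x => Real.exp (β * x)) ν := by
  have := hν.finite
  refine (integrable_const (Real.exp (β * h))).mono' (by fun_prop) ?_
  filter_upwards [hν.exp_le hβ] with x hx
  rwa [Real.norm_of_nonneg (Real.exp_pos _).le]

lemma integrable_exp_sub_one {β : ℝ} (hβ : 0 ≤ β) :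
    Integrable (fun x => Real.exp (β * x) - 1) ν := by
  have := hν.finite
  exact (hν.integrable_exp hβ).sub (integrable_const _)

lemma laplaceExponent_eq {β : ℝ} (hβ : 0 ≤ β) :
    laplaceExponent ν β = ∫ x, Real.exp (β * x) ∂ν - ν.real univ := by
  have := hν.finite
  rw [laplaceExponent, integral_sub (hν.integrable_exp hβ) (integrable_const _)]
  simp

lemma laplaceExponent_le {β : ℝ} (hβ : 0 ≤ β) :
    laplaceExponent ν β ≤ ν.real univ * Real.exp (β * h) := by
  have := hν.finite
  rw [hν.laplaceExponent_eq hβ]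
  have h1 : ∫ x, Real.exp (β * x) ∂ν ≤ ∫ _, Real.exp (β * h) ∂ν :=
    integral_mono_ae (hν.integrable_exp hβ) (integrable_const _) (hν.exp_le hβ)
  simp only [integral_const, smul_eq_mul] at h1
  linarith [measureReal_nonneg (μ := ν) (s := univ)]

/-- Keeping only the atom at `h` in the integral already forces exponential growth of ψ. -/
lemma le_laplaceExponent {β : ℝ} (hβ : 0 ≤ β) :
    ν.real {h} * Real.exp (β * h) - ν.real univ ≤ laplaceExponent ν β := by
  have := hν.finite
  rw [hν.laplaceExponent_eq hβ]
  have h1 : ∫ x in {h}, Real.exp (β * x) ∂ν ≤ ∫ x, Real.exp (β * x) ∂ν :=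
    setIntegral_le_integral (hν.integrable_exp hβ) (ae_of_all _ fun x => (Real.exp_pos _).le)
  rw [Measure.restrict_singleton, integral_smul_measure, integral_dirac] at h1
  simpa [Measure.real] using h1

lemma atom_real_pos : 0 < ν.real {h} := by
  have := hν.finite
  exact ENNReal.toReal_pos hν.atom_ne_zero (measure_ne_top _ _)

lemma tendsto_laplaceExponent : Tendsto (laplaceExponent ν) atTop atTop := by
  have h1 : Tendsto (fun β : ℝ => ν.real {h} * Real.exp (β * h) - ν.real univ) atTop atTop := by
    refine tendsto_atTop_add_const_right _ _ ?_
    refine Tendsto.const_mul_atTop hν.atom_real_pos ?_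
    exact Real.tendsto_exp_atTop.comp (tendsto_id.atTop_mul_const hν.step_pos)
  refine tendsto_atTop_mono' _ ?_ h1
  filter_upwards [eventually_ge_atTop 0] with β hβ using hν.le_laplaceExponent hβ

omit hν in
lemma laplaceExponent_zero (ν : Measure ℝ) : laplaceExponent ν 0 = 0 := by
  simp [laplaceExponent]

lemma convexOn_laplaceExponent : ConvexOn ℝ (Ici 0) (laplaceExponent ν) := by
  refine ⟨convex_Ici 0, fun x hx y hy a b ha hb hab => ?_⟩
  have hxy : 0 ≤ a • x + b • y := (convex_Ici (0 : ℝ)) hx hy ha hb hab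
  simp only [laplaceExponent, smul_eq_mul] at *
  rw [← integral_const_mul, ← integral_const_mul, ← integral_add
    ((hν.integrable_exp_sub_one hx).const_mul a) ((hν.integrable_exp_sub_one hy).const_mul b)]
  refine integral_mono (hν.integrable_exp_sub_one hxy) (((hν.integrable_exp_sub_one hx).const_mul a).add
    ((hν.integrable_exp_sub_one hy).const_mul b)) fun u => ?_
  have := convexOn_exp.2 (mem_univ (x * u)) (mem_univ (y * u)) ha hb hab
  simp only [smul_eq_mul] at this
  have e : (a * x + b * y) * u = a * (x * u) + b * (y * u) := by ring
  simp only [e]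
  nlinarith

lemma continuousOn_laplaceExponent : ContinuousOn (laplaceExponent ν) (Ici 0) := by
  have := hν.finite
  intro β hβ
  -- Since almost all `x` are at most `h`, the integrand is uniformly bounded for exponents up to `β
  -- + 1`.
  refine continuousWithinAt_of_dominated (bound := fun _ => Real.exp ((β + 1) * h) + 1) ?_ ?_ ?_ ?_
  · exact Eventually.of_forall fun x => by fun_prop
  · have h1 : ∀ᶠ b in 𝓝[Ici 0] β, b ≤ β + 1 :=
      nhdsWithin_le_nhds (eventually_le_nhds (by linarith))
    filter_upwards [h1, self_mem_nhdsWithin] with b hb hb0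
    filter_upwards [hν.exp_le hb0] with x hx
    have h2 : Real.exp (b * h) ≤ Real.exp ((β + 1) * h) := by
      have := hν.step_pos
      gcongr
    rw [Real.norm_eq_abs, abs_le]
    constructor <;> linarith [Real.exp_pos (b * x), Real.exp_pos ((β + 1) * h)]
  · exact integrable_const _
  · exact ae_of_all _ fun x => by fun_prop

lemma bddAbove_roots : BddAbove {β : ℝ | 0 ≤ β ∧ laplaceExponent ν β = 0} := by
  obtain ⟨B, hB⟩ := (hν.tendsto_laplaceExponent.eventually_gt_atTop 0).exists_forall_of_atTop
  refine ⟨B, fun β hβ => ?_⟩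
  by_contra! hlt
  exact (hB β hlt.le).ne' hβ.2

lemma isGreatest_largestRoot :
    IsGreatest {β : ℝ | 0 ≤ β ∧ laplaceExponent ν β = 0} (largestRoot ν) := by
  refine ⟨?_, fun β hβ => le_csSup hν.bddAbove_roots hβ⟩
  have hcl : IsClosed {β : ℝ | 0 ≤ β ∧ laplaceExponent ν β = 0} :=
    hν.continuousOn_laplaceExponent.preimage_isClosed_of_isClosed isClosed_Ici
      (isClosed_singleton (x := (0 : ℝ)))
  exact hcl.csSup_mem ⟨0, le_rfl, laplaceExponent_zero ν⟩ hν.bddAbove_roots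

lemma largestRoot_nonneg : 0 ≤ largestRoot ν := hν.isGreatest_largestRoot.1.1

lemma laplaceExponent_largestRoot : laplaceExponent ν (largestRoot ν) = 0 :=
  hν.isGreatest_largestRoot.1.2

/-- A nonpositive value of `ψ` at `β` forces a root at or to the right of `β`. -/
lemma le_largestRoot {β : ℝ} (hβ : 0 ≤ β) (hψ : laplaceExponent ν β ≤ 0) :
    β ≤ largestRoot ν := by
  obtain ⟨B, hB0, hB⟩ := ((hν.tendsto_laplaceExponent.eventually_ge_atTop 0).and
    (eventually_ge_atTop β)).exists
  obtain ⟨c, hc, hc0⟩ := intermediate_value_Icc hB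
    (hν.continuousOn_laplaceExponent.mono fun x hx => hβ.trans hx.1) ⟨hψ, hB0⟩
  exact hc.1.trans (hν.isGreatest_largestRoot.2 ⟨hβ.trans hc.1, hc0⟩)

lemma laplaceExponent_pos {β : ℝ} (hβ : largestRoot ν < β) : 0 < laplaceExponent ν β := by
  by_contra! hle
  exact absurd (hν.le_largestRoot (hν.largestRoot_nonneg.trans hβ.le) hle) (not_le.2 hβ)

/-- The chord from the largest root to any later point has positive slope, and by convexity the
adjacent chord to its right is at least as steep. -/
lemma strictMonoOn_laplaceExponent : StrictMonoOn (laplaceExponent ν) (Ici (largestRoot ν)) := by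
  intro b hb c hc hbc
  have h0 := hν.largestRoot_nonneg
  rcases eq_or_lt_of_le (show largestRoot ν ≤ b from hb) with hb' | hb'
  · rw [← hb', hν.laplaceExponent_largestRoot]
    exact hν.laplaceExponent_pos (hb'.trans_lt hbc)
  · have hs := hν.convexOn_laplaceExponent.slope_mono_adjacent (x := largestRoot ν) (y := b) (z := c)
      h0 (h0.trans hc) hb' hbc
    rw [hν.laplaceExponent_largestRoot, sub_zero] at hs
    have h1 : 0 < laplaceExponent ν b / (b - largestRoot ν) :=
      div_pos (hν.laplaceExponent_pos hb') (by linarith)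
    have h2 := (h1.trans_le hs)
    rw [div_pos_iff_of_pos_right (by linarith)] at h2
    linarith

lemma bijOn_laplaceExponent : BijOn (laplaceExponent ν) (Ici (largestRoot ν)) (Ici 0) := by
  have h0 := hν.largestRoot_nonneg
  refine ⟨fun b hb => ?_, hν.strictMonoOn_laplaceExponent.injOn, fun y hy => ?_⟩
  · have := hν.strictMonoOn_laplaceExponent.monotoneOn self_mem_Ici hb hb
    rwa [hν.laplaceExponent_largestRoot] at this
  · obtain ⟨B, hB0, hB⟩ := ((hν.tendsto_laplaceExponent.eventually_ge_atTop y).and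
      (eventually_ge_atTop (largestRoot ν))).exists
    obtain ⟨c, hc, hc0⟩ := intermediate_value_Icc hB
      (hν.continuousOn_laplaceExponent.mono fun x hx => h0.trans hx.1)
      ⟨hν.laplaceExponent_largestRoot.trans_le hy, hB0⟩
    exact ⟨c, hc.1, hc0⟩

lemma invOn_laplaceInverse :
    InvOn (laplaceInverse ν) (laplaceExponent ν) (Ici (largestRoot ν)) (Ici 0) :=
  hν.bijOn_laplaceExponent.invOn_invFunOn

lemma laplaceInverse_zero : laplaceInverse ν 0 = largestRoot ν := by
  have := hν.invOn_laplaceInverse.1 (self_mem_Ici (a := largestRoot ν))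
  rwa [hν.laplaceExponent_largestRoot] at this

lemma laplaceExponent_laplaceInverse {p : ℝ} (hp : 0 ≤ p) :
    laplaceExponent ν (laplaceInverse ν p) = p := hν.invOn_laplaceInverse.2 hp

lemma mapsTo_laplaceInverse : MapsTo (laplaceInverse ν) (Ici 0) (Ici (largestRoot ν)) :=
  hν.bijOn_laplaceExponent.surjOn.mapsTo_invFunOn

lemma laplaceInverse_nonneg {p : ℝ} (hp : 0 ≤ p) : 0 ≤ laplaceInverse ν p :=
  hν.largestRoot_nonneg.trans (hν.mapsTo_laplaceInverse hp)

lemma strictMonoOn_laplaceInverse : StrictMonoOn (laplaceInverse ν) (Ici 0) := by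
  intro p hp q hq hpq
  rw [← hν.strictMonoOn_laplaceExponent.lt_iff_lt (hν.mapsTo_laplaceInverse hp)
    (hν.mapsTo_laplaceInverse hq), hν.laplaceExponent_laplaceInverse hp,
    hν.laplaceExponent_laplaceInverse hq]
  exact hpq

lemma laplaceInverse_pos {p : ℝ} (hp : 0 < p) : 0 < laplaceInverse ν p :=
  (hν.laplaceInverse_nonneg le_rfl).trans_lt
    (hν.strictMonoOn_laplaceInverse self_mem_Ici hp.le hp)

/-- This right-continuity lets p decrease to 0 in the Laplace transform of T_h. For `a` above the
largest root, every p < ψ(a) satisfies Φ(p) < a. -/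
lemma tendsto_laplaceInverse_zero :
    Tendsto (laplaceInverse ν) (𝓝[>] 0) (𝓝 (laplaceInverse ν 0)) := by
  rw [tendsto_order]
  constructor
  · intro a ha
    filter_upwards [self_mem_nhdsWithin] with p hp
    exact ha.trans (hν.strictMonoOn_laplaceInverse self_mem_Ici (mem_Ici.2 (le_of_lt hp)) hp)
  · intro a ha
    rw [hν.laplaceInverse_zero] at ha
    filter_upwards [Ioo_mem_nhdsGT (hν.laplaceExponent_pos ha)] with p hp
    rw [← hν.strictMonoOn_laplaceExponent.lt_iff_lt (hν.mapsTo_laplaceInverse (mem_Ici.2 hp.1.le))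
      (mem_Ici.2 ha.le), hν.laplaceExponent_laplaceInverse hp.1.le]
    exact hp.2

/-- The slopes of `ψ` at `0` decrease to a right derivative in `[-∞, ∞)`. -/
lemma exists_rightDeriv : ∃ d : EReal, d < ⊤ ∧
    Tendsto (fun β : ℝ => (((laplaceExponent ν β - laplaceExponent ν 0) / β : ℝ) : EReal))
      (𝓝[>] 0) (𝓝 d) ∧ (d < 0 → ∃ β, 0 < β ∧ laplaceExponent ν β < 0) := by
  set f : ℝ → EReal := fun β => (((laplaceExponent ν β - laplaceExponent ν 0) / β : ℝ) : EReal)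
  have hmono : MonotoneOn f (Ioi 0) := by
    intro x hx y hy hxy
    have := hν.convexOn_laplaceExponent.secant_mono (a := 0) (x := x) (y := y) self_mem_Ici
      (mem_Ici.2 (le_of_lt hx)) (mem_Ici.2 (le_of_lt hy)) (ne_of_gt hx) (ne_of_gt hy) hxy
    simpa [f] using this
  -- The right limit of monotone slopes is their infimum. It lies below the slope at 1, hence below
  -- ⊤, and if it is negative then some single slope is negative.
  refine ⟨sInf (f '' Ioi 0), ?_, hmono.tendsto_nhdsGT (OrderBot.bddBelow _), fun hd => ?_⟩
  · exact (sInf_le (mem_image_of_mem f (mem_Ioi.2 one_pos))).trans_lt (EReal.coe_lt_top _)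
  · obtain ⟨_, ⟨β, hβ, rfl⟩, hlt⟩ := sInf_lt_iff.1 hd
    refine ⟨β, hβ, ?_⟩
    simp only [f, laplaceExponent_zero, sub_zero] at hlt
    have hlt : laplaceExponent ν β / β < 0 := by exact_mod_cast hlt
    by_contra! hle
    exact absurd hlt (not_lt.2 (div_nonneg hle (le_of_lt hβ)))

end SkipFreeJumps

end SkipFree

/-! ### Compound Poisson marginals and increment estimates. -/

namespace SkipFree

/-- The `n`-fold convolution power of `ν`. -/
noncomputable def convPow (ν : Measure ℝ) : ℕ → Measure ℝ
  | 0 => Measure.dirac 0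
  | n + 1 => (convPow ν n).conv ν

/-- The law at time `t` of the compound Poisson process with Lévy measure `ν`. -/
noncomputable def compoundPoissonLaw (ν : Measure ℝ) (t : ℝ≥0) : Measure ℝ :=
  Measure.sum fun n : ℕ =>
    ENNReal.ofReal (Real.exp (-(t * ν.real univ)) * (t ^ n / n.factorial)) • convPow ν n

section convPow

variable (ν : Measure ℝ) [IsFiniteMeasure ν]

instance isFiniteMeasure_convPow (n : ℕ) : IsFiniteMeasure (convPow ν n) := by
  induction n with
  | zero => exact inferInstanceAs (IsFiniteMeasure (Measure.dirac 0))
  | succ n ih => exact inferInstanceAs (IsFiniteMeasure ((convPow ν n).conv ν))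

lemma lintegral_exp_convPow (β : ℝ) (n : ℕ) :
    ∫⁻ x, ENNReal.ofReal (Real.exp (β * x)) ∂(convPow ν n) =
      (∫⁻ x, ENNReal.ofReal (Real.exp (β * x)) ∂ν) ^ n := by
  induction n with
  | zero => simp [convPow]
  | succ n ih =>
    rw [convPow, Measure.lintegral_conv (by fun_prop)]
    simp_rw [mul_add, Real.exp_add, ENNReal.ofReal_mul (Real.exp_pos _).le]
    simp_rw [lintegral_const_mul _ (show Measurable fun y => ENNReal.ofReal (Real.exp (β * y)) by
      fun_prop)]
    rw [lintegral_mul_const _ (by fun_prop), ih, pow_succ]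

lemma charFun_convPow (z : ℝ) (n : ℕ) : charFun (convPow ν n) z = charFun ν z ^ n := by
  induction n with
  | zero => simp [convPow]
  | succ n ih => rw [convPow, charFun_conv, ih, pow_succ]

lemma lintegral_exp_compoundPoissonLaw (β : ℝ) (t : ℝ≥0)
    (hint : Integrable (fun x => Real.exp (β * x)) ν) :
    ∫⁻ x, ENNReal.ofReal (Real.exp (β * x)) ∂(compoundPoissonLaw ν t) =
      ENNReal.ofReal (Real.exp (t * (∫ x, Real.exp (β * x) ∂ν - ν.real univ))) := by
  rw [compoundPoissonLaw, lintegral_sum_measure]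
  simp_rw [lintegral_smul_measure, lintegral_exp_convPow]
  rw [← ofReal_integral_eq_lintegral_ofReal hint (ae_of_all _ fun x => (Real.exp_pos _).le)]
  set m := ∫ x, Real.exp (β * x) ∂ν with hm
  have hm0 : 0 ≤ m := integral_nonneg fun x => (Real.exp_pos _).le
  set l := ν.real univ
  have h1 : HasSum (fun n : ℕ => Real.exp (-(t * l)) * (t ^ n / n.factorial) * m ^ n)
      (Real.exp (t * (m - l))) := by
    have h1 := (NormedSpace.expSeries_div_hasSum_exp ((t : ℝ) * m)).mul_left (Real.exp (-(t * l)))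
    rw [← congrFun Real.exp_eq_exp_ℝ, ← Real.exp_add] at h1
    convert! h1 using 1
    · ext n
      rw [mul_pow]
      ring
    · ring_nf
  rw [← h1.tsum_eq, ENNReal.ofReal_tsum_of_nonneg (fun n => by positivity) h1.summable]
  refine tsum_congr fun n => ?_
  rw [smul_eq_mul, ← ENNReal.ofReal_pow hm0, ← ENNReal.ofReal_mul (by positivity)]

instance isProbabilityMeasure_compoundPoissonLaw (t : ℝ≥0) :
    IsProbabilityMeasure (compoundPoissonLaw ν t) := by
  -- At β = 0 the exponential moment is the total mass.
  have := lintegral_exp_compoundPoissonLaw ν 0 t (by simp)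
  refine ⟨?_⟩
  simpa using this

/-- This is the transform prescribed for X_t, so by uniqueness of characteristic functions the
marginals acquire an explicit Poisson mixture form. Exponential moments, lattice support and the
atom at 0 are read off from that form. -/
lemma charFun_compoundPoissonLaw (t : ℝ≥0) (z : ℝ) :
    charFun (compoundPoissonLaw ν t) z =
      Complex.exp ((t : ℂ) * ∫ x : ℝ, (Complex.exp (Complex.I * z * x) - 1) ∂ν) := by
  have hint : ∀ (m : Measure ℝ) [IsFiniteMeasure m],
      Integrable (fun x : ℝ => Complex.exp (z * x * Complex.I)) m := fun m _ =>
    (integrable_const (1 : ℝ)).mono (by fun_prop) (ae_of_all _ fun x => by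
      rw [← Complex.ofReal_mul, Complex.norm_exp_ofReal_mul_I]; simp)
  have hν : ∫ x : ℝ, (Complex.exp (Complex.I * z * x) - 1) ∂ν = charFun ν z - ν.real univ := by
    have e : ∀ x : ℝ, Complex.I * z * x = z * x * Complex.I := fun x => by ring
    simp_rw [e]
    rw [integral_sub (hint ν) (integrable_const _), charFun_apply_real]
    simp
  rw [hν, charFun_apply_real, compoundPoissonLaw, integral_sum_measure]
  swap
  · exact hint (compoundPoissonLaw ν t)
  simp_rw [integral_smul_measure, ← charFun_apply_real, charFun_convPow]
  have h1 := (NormedSpace.expSeries_div_hasSum_exp ((t : ℂ) * charFun ν z)).mul_left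
    (Complex.exp (-(t * ν.real univ)))
  rw [← congrFun Complex.exp_eq_exp_ℂ, ← Complex.exp_add] at h1
  rw [show (t : ℂ) * (charFun ν z - ν.real univ) = -(t * ν.real univ) + t * charFun ν z by ring,
    ← h1.tsum_eq]
  refine tsum_congr fun n => ?_
  rw [ENNReal.toReal_ofReal (by positivity), Complex.real_smul, mul_pow]
  push_cast
  ring

omit [IsFiniteMeasure ν] in
-- Only the term without jumps is kept.
lemma le_compoundPoissonLaw_zero (t : ℝ≥0) :
    ENNReal.ofReal (Real.exp (-(t * ν.real univ))) ≤ compoundPoissonLaw ν t {0} := by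
  rw [compoundPoissonLaw, Measure.sum_apply _ (measurableSet_singleton _)]
  refine le_trans ?_ (ENNReal.le_tsum 0)
  simp [convPow]

lemma measurableSet_lattice (h : ℝ) : MeasurableSet {x : ℝ | ∃ k : ℤ, x = h * k} := by
  have : {x : ℝ | ∃ k : ℤ, x = h * k} = range fun k : ℤ => h * k := by
    ext x
    simp [eq_comm]
  rw [this]
  exact (countable_range _).measurableSet

omit [IsFiniteMeasure ν] in
lemma ae_lattice_convPow {h : ℝ} (hl : ∀ᵐ x ∂ν, ∃ k : ℤ, x = h * k) (n : ℕ) :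
    ∀ᵐ x ∂(convPow ν n), ∃ k : ℤ, x = h * k := by
  induction n with
  | zero =>
    rw [convPow, ae_dirac_iff (measurableSet_lattice h)]
    exact ⟨0, by simp⟩
  | succ n ih =>
    rw [convPow, Measure.conv, ae_map_iff (by fun_prop) (measurableSet_lattice h)]
    have h1 : ∀ᵐ z ∂((convPow ν n).prod ν), ∃ k : ℤ, z.1 = h * k :=
      Measure.quasiMeasurePreserving_fst.ae ih
    have h2 : ∀ᵐ z ∂((convPow ν n).prod ν), ∃ k : ℤ, z.2 = h * k :=
      Measure.quasiMeasurePreserving_snd.ae hl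
    filter_upwards [h1, h2] with z ⟨k, hk⟩ ⟨l, hl⟩
    exact ⟨k + l, by rw [hk, hl]; push_cast; ring⟩

omit [IsFiniteMeasure ν] in
lemma ae_lattice_compoundPoissonLaw {h : ℝ} (hl : ∀ᵐ x ∂ν, ∃ k : ℤ, x = h * k) (t : ℝ≥0) :
    ∀ᵐ x ∂(compoundPoissonLaw ν t), ∃ k : ℤ, x = h * k := by
  rw [compoundPoissonLaw, Measure.ae_sum_iff' (measurableSet_lattice h)]
  intro n
  exact Measure.ae_smul_measure (ae_lattice_convPow ν hl n) _

end convPow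

variable {Ω : Type*} {mΩ : MeasurableSpace Ω} {μ : Measure Ω} {ℱ : Filtration ℝ≥0 mΩ}
  {X : ℝ≥0 → Ω → ℝ} {ν : Measure ℝ} {h : ℝ}

lemma IsLevyProcess.measurable (hX : IsLevyProcess μ ℱ X) (t : ℝ≥0) : Measurable (X t) :=
  (hX.adapted t).mono (ℱ.le t) le_rfl

lemma IsCompoundPoisson.hasLaw [IsProbabilityMeasure μ] (hX : IsCompoundPoisson μ ℱ X ν)
    (t : ℝ≥0) : HasLaw (X t) (compoundPoissonLaw ν t) μ := by
  have := hX.finite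
  refine ⟨(hX.levy.measurable t).aemeasurable, ?_⟩
  have := Measure.isProbabilityMeasure_map (μ := μ) (hX.levy.measurable t).aemeasurable
  refine Measure.ext_of_charFun ?_
  ext z
  rw [hX.charFun_eq, charFun_compoundPoissonLaw]

namespace IsSkipFreeLevyChain

variable [IsProbabilityMeasure μ] (hX : IsSkipFreeLevyChain μ ℱ X ν h)
include hX

lemma hasLaw_increment {s t : ℝ≥0} (hst : s ≤ t) :
    HasLaw (fun ω => X t ω - X s ω) (compoundPoissonLaw ν (t - s)) μ := by
  have h1 := hX.compoundPoisson.levy.stationary_increments s t hst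
  exact ⟨h1.aemeasurable_fst, h1.map_eq.trans (hX.compoundPoisson.hasLaw (t - s)).map_eq⟩

lemma lintegral_exp_increment {s t : ℝ≥0} (hst : s ≤ t) {β : ℝ} (hβ : 0 ≤ β) :
    ∫⁻ ω, ENNReal.ofReal (Real.exp (β * (X t ω - X s ω))) ∂μ =
      ENNReal.ofReal (Real.exp ((t - s : ℝ) * laplaceExponent ν β)) := by
  have := hX.skipFreeJumps.finite
  rw [(hX.hasLaw_increment hst).lintegral_comp (f := fun x => ENNReal.ofReal (Real.exp (β * x)))
    (by fun_prop), lintegral_exp_compoundPoissonLaw ν β _ (hX.skipFreeJumps.integrable_exp hβ),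
    hX.skipFreeJumps.laplaceExponent_eq hβ, NNReal.coe_sub hst]

lemma lattice_increment {s t : ℝ≥0} (hst : s ≤ t) :
    ∀ᵐ ω ∂μ, ∃ k : ℤ, X t ω - X s ω = h * k := by
  have := hX.skipFreeJumps.finite
  have h1 := ae_lattice_compoundPoissonLaw ν hX.skipFreeJumps.lattice (t - s)
  rw [← (hX.hasLaw_increment hst).map_eq] at h1
  exact ae_of_ae_map (hX.hasLaw_increment hst).aemeasurable h1

lemma le_measure_increment_eq_zero {s t : ℝ≥0} (hst : s ≤ t) :
    ENNReal.ofReal (Real.exp (-((t - s : ℝ) * ν.real univ))) ≤ μ {ω | X t ω - X s ω = 0} := by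
  have := hX.skipFreeJumps.finite
  rw [(hX.hasLaw_increment hst).measure_eq (p := fun x => x = 0) (measurableSet_singleton 0)]
  have := le_compoundPoissonLaw_zero ν (t - s)
  rwa [NNReal.coe_sub hst] at this

/-- Upward increments of size at least `2h` have probability `O(δ²)` over a time span `δ`. -/
lemma measure_two_mul_le_increment_le {s t : ℝ≥0} (hst : s < t) (hst' : t ≤ s + 1) :
    μ {ω | 2 * h ≤ X t ω - X s ω} ≤
      ENNReal.ofReal ((t - s : ℝ) ^ 2 * Real.exp (ν.real univ)) := by
  have hν := hX.skipFreeJumps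
  have hh := hν.step_pos
  set δ : ℝ := t - s with hδ
  have hδ0 : 0 < δ := sub_pos.2 (by exact_mod_cast hst)
  have hδ1 : δ ≤ 1 := by
    have : (t : ℝ) ≤ s + 1 := by exact_mod_cast hst'
    linarith
  -- The Chernoff exponent is tuned so that e^{βh} = 1/δ. Then δψ(β) ≤ ν(ℝ) stays bounded, while
  -- exceeding 2h gains the factor e^{-2βh} = δ².
  set β : ℝ := -Real.log δ / h with hβdef
  have hβ : 0 ≤ β := div_nonneg (neg_nonneg.2 (Real.log_nonpos hδ0.le hδ1)) hh.le
  have hβh : Real.exp (β * h) = δ⁻¹ := by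
    rw [hβdef, div_mul_cancel₀ _ hh.ne', Real.exp_neg, Real.exp_log hδ0]
  have hm : Measurable fun ω => X t ω - X s ω :=
    (hX.compoundPoisson.levy.measurable t).sub (hX.compoundPoisson.levy.measurable s)
  have h1 := mul_meas_ge_le_lintegral₀ (μ := μ)
    (f := fun ω => ENNReal.ofReal (Real.exp (β * (X t ω - X s ω))))
    ((hm.const_mul β).exp.ennreal_ofReal.aemeasurable)
    (ENNReal.ofReal (δ⁻¹ ^ 2))
  rw [hX.lintegral_exp_increment hst.le hβ] at h1
  have h2 : {ω | 2 * h ≤ X t ω - X s ω} ⊆ {ω | ENNReal.ofReal (δ⁻¹ ^ 2) ≤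
      ENNReal.ofReal (Real.exp (β * (X t ω - X s ω)))} := by
    intro ω hω
    refine ENNReal.ofReal_le_ofReal ?_
    rw [← hβh, ← Real.exp_nat_mul]
    refine Real.exp_le_exp.2 ?_
    have : β * (2 * h) ≤ β * (X t ω - X s ω) := mul_le_mul_of_nonneg_left hω hβ
    push_cast
    linarith
  have h3 : Real.exp (δ * laplaceExponent ν β) ≤ Real.exp (ν.real univ) := by
    refine Real.exp_le_exp.2 ?_
    have := hν.laplaceExponent_le hβ
    rw [hβh] at this
    calc δ * laplaceExponent ν β ≤ δ * (ν.real univ * δ⁻¹) := by gcongr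
      _ = ν.real univ := by field_simp
  calc μ {ω | 2 * h ≤ X t ω - X s ω}
      = ENNReal.ofReal (δ ^ 2) * (ENNReal.ofReal (δ⁻¹ ^ 2) * μ {ω | 2 * h ≤ X t ω - X s ω}) := by
        rw [← mul_assoc, ← ENNReal.ofReal_mul (by positivity)]
        field_simp
        simp
    _ ≤ ENNReal.ofReal (δ ^ 2) * ENNReal.ofReal (Real.exp (ν.real univ)) := by
        gcongr
        exact ((mul_le_mul_right (measure_mono h2) _).trans h1).trans (ENNReal.ofReal_le_ofReal h3)
    _ = _ := by rw [← ENNReal.ofReal_mul (by positivity)]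

end IsSkipFreeLevyChain

end SkipFree

/-! ### Path properties and first entrance times. -/

namespace SkipFree

/-- Paths of an upwards skip-free chain with step `h`: right-continuous, started at `0`, with values
in `hℤ`, and reaching no level `nh` without visiting it. -/
structure GoodPath (h : ℝ) (x : ℝ≥0 → ℝ) : Prop where
  rightCont : ∀ t, ContinuousWithinAt x (Ici t) t
  start : x 0 = 0
  lattice : ∀ t, ∃ k : ℤ, x t = h * k
  skipFree : ∀ (t : ℝ≥0) (n : ℕ), n * h ≤ x t → ∃ s ≤ t, x s = n * h

lemma isClosed_lattice (h : ℝ) : IsClosed {x : ℝ | ∃ k : ℤ, x = h * k} := by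
  rcases eq_or_ne h 0 with rfl | hh
  · have : {x : ℝ | ∃ k : ℤ, x = 0 * k} = {0} := by
      ext x
      simp
    rw [this]
    exact isClosed_singleton
  · have : {x : ℝ | ∃ k : ℤ, x = h * k} = (fun x => x / h) ⁻¹' (range ((↑) : ℤ → ℝ)) := by
      ext x
      simp only [mem_ofPred_eq, mem_preimage, mem_range]
      refine exists_congr fun k => ?_
      rw [eq_div_iff hh, mul_comm, eq_comm]
    rw [this]
    exact Int.isClosedEmbedding_coe_real.isClosed_range.preimage (by fun_prop)

lemma le_of_lattice_of_lt_add {h x : ℝ} (hh : 0 < h) {k l : ℤ} (hx : x = h * k)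
    (hl : h * (l - 1) < x) : h * l ≤ x := by
  rw [hx] at hl ⊢
  have h1 : ((l - 1 : ℤ) : ℝ) < (k : ℝ) := by
    push_cast
    exact lt_of_mul_lt_mul_left hl hh.le
  have h2 : l ≤ k := by
    have := Int.cast_lt.1 h1
    omega
  have h3 : (l : ℝ) ≤ k := by exact_mod_cast h2
  exact mul_le_mul_of_nonneg_left h3 hh.le

lemma exists_coe_eq {x : ℝ≥0∞} (hx : x ≠ ⊤) : ∃ t : ℝ≥0, (t : ℝ≥0∞) = x :=
  ⟨x.toNNReal, ENNReal.coe_toNNReal hx⟩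

lemma exists_denseSeq_mem_Ioo {s t : ℝ≥0} (hst : s < t) :
    ∃ i, TopologicalSpace.denseSeq ℝ≥0 i ∈ Ioo s t :=
  (TopologicalSpace.denseRange_denseSeq ℝ≥0).exists_mem_open isOpen_Ioo (nonempty_Ioo.2 hst)

lemma frequently_denseSeq (t : ℝ≥0) :
    ∃ᶠ s in 𝓝[≥] t, s ∈ range (TopologicalSpace.denseSeq ℝ≥0) := by
  rw [Filter.frequently_iff]
  intro U hU
  obtain ⟨u, hu, hU⟩ := (mem_nhdsGE_iff_exists_Ico_subset).1 hU
  obtain ⟨i, hi⟩ := exists_denseSeq_mem_Ioo hu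
  exact ⟨_, hU ⟨hi.1.le, hi.2⟩, mem_range_self i⟩

section passageTime

variable {Ω : Type*} {X : ℝ≥0 → Ω → ℝ} {ω : Ω} {h : ℝ}

lemma passageTime_le_of_le {a : ℝ} {t : ℝ≥0} (ht : a ≤ X t ω) : passageTime X a ω ≤ t :=
  iInf₂_le t ht

lemma passageTime_mono {a b : ℝ} (hab : a ≤ b) : passageTime X a ω ≤ passageTime X b ω :=
  le_iInf₂ fun _ ht => passageTime_le_of_le (hab.trans ht)

lemma lt_of_lt_passageTime {a : ℝ} {t : ℝ≥0} (ht : t < passageTime X a ω) : X t ω < a := by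
  by_contra! hle
  exact absurd ht (not_lt.2 (passageTime_le_of_le hle))

lemma exists_le_of_passageTime_lt {a : ℝ} {c : ℝ≥0∞} (hc : passageTime X a ω < c) :
    ∃ t : ℝ≥0, a ≤ X t ω ∧ (t : ℝ≥0∞) < c := by
  simpa [passageTime, iInf_lt_iff] using hc

/-- The infimum defining a first entrance time is attained. -/
lemma le_of_passageTime_eq (hr : ∀ t, ContinuousWithinAt (fun s => X s ω) (Ici t) t) {a : ℝ}
    {t : ℝ≥0} (ht : passageTime X a ω = t) : a ≤ X t ω := by
  by_contra! hlt
  have h1 : ∀ᶠ s in 𝓝[≥] t, X s ω < a := (hr t).eventually_lt_const hlt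
  obtain ⟨u, hu, hU⟩ := (mem_nhdsGE_iff_exists_Ico_subset).1 h1
  obtain ⟨s, hs, hsu⟩ := exists_le_of_passageTime_lt
    (show passageTime X a ω < u by rw [ht]; exact_mod_cast hu)
  have hts : t ≤ s := by
    have := passageTime_le_of_le hs
    rw [ht] at this
    exact_mod_cast this
  exact absurd hs (not_le.2 (hU ⟨hts, by exact_mod_cast hsu⟩))

lemma passageTime_le_iff (hr : ∀ t, ContinuousWithinAt (fun s => X s ω) (Ici t) t) {a : ℝ}
    {t : ℝ≥0} : passageTime X a ω ≤ t ↔ ∃ s ≤ t, a ≤ X s ω := by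
  constructor
  · intro hle
    obtain ⟨s, hs⟩ := exists_coe_eq (ne_top_of_le_ne_top ENNReal.coe_ne_top hle)
    exact ⟨s, by rw [← hs] at hle; exact_mod_cast hle, le_of_passageTime_eq hr hs.symm⟩
  · rintro ⟨s, hst, hs⟩
    exact (passageTime_le_of_le hs).trans (by exact_mod_cast hst)

variable (hh : 0 < h) (hg : GoodPath h (fun t => X t ω))
include hh hg

/-- Lattice-valued right-continuous paths are locally constant to the right. -/
lemma GoodPath.eventually_eq (t : ℝ≥0) : ∀ᶠ s in 𝓝[≥] t, X s ω = X t ω := by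
  have h1 : ∀ᶠ s in 𝓝[≥] t, |X s ω - X t ω| < h := by
    have := (hg.rightCont t).eventually (Metric.ball_mem_nhds (X t ω) hh)
    simpa [Metric.mem_ball, Real.dist_eq] using this
  filter_upwards [h1] with s hs
  obtain ⟨k, hk⟩ := hg.lattice s
  obtain ⟨l, hl⟩ := hg.lattice t
  rw [hk, hl, ← mul_sub, abs_mul, abs_of_pos hh] at hs
  have h2 : |(k : ℝ) - l| < 1 := by
    by_contra! hle
    nlinarith
  have h3 : |k - l| < 1 := by exact_mod_cast h2
  rw [Int.abs_lt_one_iff, sub_eq_zero] at h3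
  rw [hk, hl, h3]

omit hh in
-- There is no overshoot: the skip-free property supplies a visit to `n * h` no later than `t`, and
-- minimality of the entrance time forces that visit to occur at `t`.
lemma GoodPath.eq_of_passageTime_eq {n : ℕ} {t : ℝ≥0} (ht : passageTime X (n * h) ω = t) :
    X t ω = n * h := by
  obtain ⟨s, hst, hs⟩ := hg.skipFree t n (le_of_passageTime_eq hg.rightCont ht)
  have h1 := passageTime_le_of_le hs.ge
  rw [ht] at h1
  have : s = t := le_antisymm hst (by exact_mod_cast h1)
  rw [← this]
  exact hs

omit hh in
lemma GoodPath.passageTime_zero : passageTime X 0 ω = 0 :=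
  le_antisymm ((passageTime_le_of_le (t := 0) hg.start.ge).trans (by simp)) bot_le

/-- If the two times coincided, the path would be at two different levels at once. -/
lemma GoodPath.passageTime_lt {n : ℕ} (hn : passageTime X (n * h) ω < ⊤) :
    passageTime X (n * h) ω < passageTime X ((n + 1) * h) ω := by
  refine lt_of_le_of_ne (passageTime_mono (by nlinarith)) fun heq => ?_
  obtain ⟨t, ht⟩ := exists_coe_eq hn.ne
  have h1 := hg.eq_of_passageTime_eq ht.symm
  have h2 := hg.eq_of_passageTime_eq (n := n + 1) (t := t) (by push_cast; rw [← heq, ht])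
  rw [h1] at h2
  push_cast at h2
  linarith

/-- The path is constant for a short while after entering, so an entrance strictly before `t` is
witnessed at a dense time up to `t`; an entrance at `t` itself is the first alternative. Thus the
event is decided by countably many values up to time `t`, and right-continuity of the filtration is
not required. -/
lemma GoodPath.passageTime_le_iff_denseSeq {a : ℝ} {t : ℝ≥0} :
    passageTime X a ω ≤ t ↔ a ≤ X t ω ∨ ∃ i, TopologicalSpace.denseSeq ℝ≥0 i ≤ t ∧
      a ≤ X (TopologicalSpace.denseSeq ℝ≥0 i) ω := by
  rw [passageTime_le_iff hg.rightCont]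
  constructor
  · rintro ⟨s, hst, hs⟩
    rcases hst.eq_or_lt with rfl | hst
    · exact Or.inl hs
    · right
      have h1 : ∀ᶠ r in 𝓝[≥] s, r < t := nhdsWithin_le_nhds (eventually_lt_nhds hst)
      obtain ⟨r, ⟨i, rfl⟩, hr, hrt⟩ :=
        ((frequently_denseSeq s).and_eventually ((hg.eventually_eq hh s).and h1)).exists
      exact ⟨i, hrt.le, hr ▸ hs⟩
  · rintro (hs | ⟨i, hi, hs⟩)
    · exact ⟨t, le_rfl, hs⟩
    · exact ⟨_, hi, hs⟩

/-- This exhibits the entrance time as a function of countably many coordinates, hence measurable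
for the product σ-algebra on path space. -/
lemma GoodPath.passageTime_eq_iInf_denseSeq (a : ℝ) :
    passageTime X a ω = ⨅ i : ℕ, ⨅ _ : a ≤ X (TopologicalSpace.denseSeq ℝ≥0 i) ω,
      (TopologicalSpace.denseSeq ℝ≥0 i : ℝ≥0∞) := by
  refine le_antisymm (le_iInf₂ fun i hi => passageTime_le_of_le hi) ?_
  refine le_iInf₂ fun t ht => ENNReal.le_of_forall_pos_le_add fun ε hε _ => ?_
  have h1 : ∀ᶠ r in 𝓝[≥] t, r < t + ε :=
    nhdsWithin_le_nhds (eventually_lt_nhds (lt_add_of_pos_right t hε))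
  obtain ⟨r, ⟨i, rfl⟩, hr, hrt⟩ :=
    ((frequently_denseSeq t).and_eventually ((hg.eventually_eq hh t).and h1)).exists
  exact (iInf₂_le i (hr ▸ ht)).trans (by exact_mod_cast hrt.le)

end passageTime

variable {Ω : Type*} {mΩ : MeasurableSpace Ω} {μ : Measure Ω} {ℱ : Filtration ℝ≥0 mΩ}
  {X : ℝ≥0 → Ω → ℝ} {ν : Measure ℝ} {h : ℝ}

namespace IsSkipFreeLevyChain

variable [IsProbabilityMeasure μ] (hX : IsSkipFreeLevyChain μ ℱ X ν h)
include hX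

/-- The statement holds almost surely at all dense times simultaneously. It extends to all times
because the lattice is closed and paths are right-continuous. -/
lemma ae_lattice : ∀ᵐ ω ∂μ, ∀ t, ∃ k : ℤ, X t ω = h * k := by
  have h1 : ∀ᵐ ω ∂μ, ∀ i, ∃ k : ℤ, X (TopologicalSpace.denseSeq ℝ≥0 i) ω - X 0 ω = h * k :=
    ae_all_iff.2 fun i => hX.lattice_increment bot_le
  filter_upwards [h1, hX.compoundPoisson.levy.start] with ω hω h0 t
  refine (isClosed_lattice h).mem_of_frequently_of_tendsto ?_
    (hX.compoundPoisson.levy.right_continuous ω t)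
  refine (frequently_denseSeq t).mono ?_
  rintro _ ⟨i, rfl⟩
  simpa [h0] using hω i

/-- On all sufficiently fine grids, the increments over a long time interval are less than `2h`. -/
lemma ae_eventually_increment_lt : ∀ᵐ ω ∂μ, ∀ᶠ m : ℕ in atTop, ∀ k < 8 ^ m,
    X (((k + 1 : ℕ) : ℝ≥0) / 4 ^ m) ω - X ((k : ℝ≥0) / 4 ^ m) ω < 2 * h := by
  -- There are 8^m cells of length 4^{-m}, which cover [0, 2^m]. A cell is bad with probability of
  -- order 16^{-m}, so the union bound gives order 2^{-m} and Borel-Cantelli applies.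
  set D : ℕ → Set Ω := fun m => ⋃ k ∈ Finset.range (8 ^ m),
    {ω | 2 * h ≤ X (((k + 1 : ℕ) : ℝ≥0) / 4 ^ m) ω - X ((k : ℝ≥0) / 4 ^ m) ω} with hD
  have hle : ∀ m, μ (D m) ≤ ENNReal.ofReal (Real.exp (ν.real univ) * (1 / 2) ^ m) := by
    intro m
    have h1 : ∀ k ∈ Finset.range (8 ^ m),
        μ {ω | 2 * h ≤ X (((k + 1 : ℕ) : ℝ≥0) / 4 ^ m) ω - X ((k : ℝ≥0) / 4 ^ m) ω} ≤
          ENNReal.ofReal (((1 / 4) ^ m) ^ 2 * Real.exp (ν.real univ)) := by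
      intro k _
      have e : ((k + 1 : ℕ) : ℝ≥0) / 4 ^ m = (k : ℝ≥0) / 4 ^ m + (1 / 4) ^ m := by
        rw [div_pow, one_pow, ← add_div]
        push_cast
        rfl
      have hp : (0 : ℝ≥0) < (1 / 4) ^ m := by positivity
      have hp1 : ((1 : ℝ≥0) / 4) ^ m ≤ 1 := pow_le_one₀ (by positivity)
        (by rw [div_le_one (by positivity)]; norm_num)
      have := hX.measure_two_mul_le_increment_le (s := (k : ℝ≥0) / 4 ^ m)
        (t := ((k + 1 : ℕ) : ℝ≥0) / 4 ^ m) (by rw [e]; exact lt_add_of_pos_right _ hp)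
        (by rw [e]; gcongr)
      refine this.trans_eq ?_
      rw [e]
      congr 3
      push_cast
      ring
    refine (measure_biUnion_finset_le _ _).trans ((Finset.sum_le_sum h1).trans_eq ?_)
    rw [Finset.sum_const, Finset.card_range, nsmul_eq_mul, ← ENNReal.ofReal_natCast,
      ← ENNReal.ofReal_mul (by positivity)]
    congr 1
    push_cast
    rw [← pow_mul, mul_comm m 2, pow_mul, ← mul_assoc, ← mul_pow]
    norm_num
    ring
  have hsum : ∑' m, μ (D m) ≠ ⊤ := by
    refine ne_top_of_le_ne_top ?_ (ENNReal.tsum_le_tsum hle)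
    rw [← ENNReal.ofReal_tsum_of_nonneg (fun m => by positivity)
      ((summable_geometric_of_lt_one (by norm_num) (by norm_num)).mul_left _)]
    exact ENNReal.ofReal_ne_top
  filter_upwards [ae_eventually_notMem hsum] with ω hω
  filter_upwards [hω] with m hm k hk
  by_contra! hle
  exact hm (mem_biUnion (Finset.mem_range.2 hk) hle)

/-- Suppose the path enters `[nh, ∞)` at a time T with value at least (n+1)h. In a fine grid, the
cell around T has its left end before T, hence at most (n-1)h, and its right end just after T, hence
at least (n+1)h. Such an increment of 2h is excluded on fine grids. -/
lemma ae_goodPath : ∀ᵐ ω ∂μ, GoodPath h (fun t => X t ω) := by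
  have hh := hX.step_pos
  filter_upwards [hX.ae_lattice, hX.compoundPoisson.levy.start, hX.ae_eventually_increment_lt]
    with ω hl h0 hinc
  have hr := hX.compoundPoisson.levy.right_continuous ω
  refine ⟨hr, h0, hl, fun t n ht => ?_⟩
  have hle := passageTime_le_of_le ht
  obtain ⟨T, hT⟩ := exists_coe_eq (ne_top_of_le_ne_top ENNReal.coe_ne_top hle)
  have hTt : T ≤ t := by rw [← hT] at hle; exact_mod_cast hle
  have hXT : n * h ≤ X T ω := le_of_passageTime_eq hr hT.symm
  refine ⟨T, hTt, le_antisymm ?_ hXT⟩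
  by_contra! hlt
  obtain ⟨l, hl'⟩ := hl T
  have hn1 : h * ((n : ℤ) + 1 : ℤ) ≤ X T ω := by
    refine le_of_lattice_of_lt_add hh hl' ?_
    push_cast
    linarith
  push_cast at hn1
  have hT0 : 0 < T := by
    rw [pos_iff_ne_zero]
    rintro rfl
    rw [h0] at hlt
    have : (0 : ℝ) ≤ n * h := by positivity
    linarith
  have h1 : ∀ᶠ s in 𝓝[≥] T, n * h + h / 2 < X s ω :=
    (hr T).eventually_const_lt (show n * h + h / 2 < X T ω by linarith)
  obtain ⟨u, hu, hU⟩ := (mem_nhdsGE_iff_exists_Ico_subset).1 h1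
  have hm1 : ∀ᶠ m : ℕ in atTop, ((1 / 4 : ℝ≥0)) ^ m < u - T :=
    (NNReal.tendsto_pow_atTop_nhds_zero_of_lt_one
      (by rw [div_lt_one (by positivity)]; norm_num)).eventually_lt_const (tsub_pos_of_lt hu)
  have hm2 : ∀ᶠ m : ℕ in atTop, T < 2 ^ m :=
    (tendsto_pow_atTop_atTop_of_one_lt (by norm_num : (1 : ℝ≥0) < 2)).eventually_gt_atTop T
  obtain ⟨m, hm, hm1, hm2⟩ := (hinc.and (hm1.and hm2)).exists
  have hp4 : (0 : ℝ≥0) < 4 ^ m := by positivity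
  -- The predecessor of the ceiling indexes the grid point strictly before T; it exists because T >
  -- 0.
  obtain ⟨k, hk⟩ : ∃ k, ⌈T * 4 ^ m⌉₊ = k + 1 :=
    Nat.exists_eq_succ_of_ne_zero (Nat.ceil_pos.2 (by positivity)).ne'
  have hk1 : (k : ℝ≥0) / 4 ^ m < T := by
    rw [div_lt_iff₀ hp4]
    exact Nat.lt_ceil.1 (by omega)
  have hk2 : T ≤ ((k + 1 : ℕ) : ℝ≥0) / 4 ^ m := by
    rw [le_div_iff₀ hp4]
    exact Nat.ceil_le.1 hk.le
  have hk3 : ((k + 1 : ℕ) : ℝ≥0) / 4 ^ m < u := by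
    calc ((k + 1 : ℕ) : ℝ≥0) / 4 ^ m = (k : ℝ≥0) / 4 ^ m + (1 / 4) ^ m := by
          rw [div_pow, one_pow, ← add_div]
          push_cast
          rfl
      _ < T + (u - T) := by gcongr
      _ = u := add_tsub_cancel_of_le (le_of_lt hu)
  have hk8 : k < 8 ^ m := by
    have h3 : (k : ℝ≥0) < 8 ^ m := by
      calc (k : ℝ≥0) < T * 4 ^ m := by rwa [div_lt_iff₀ hp4] at hk1
        _ ≤ 2 ^ m * 4 ^ m := by gcongr
        _ = 8 ^ m := by rw [← mul_pow]; norm_num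
    exact_mod_cast h3
  have hlow : X ((k : ℝ≥0) / 4 ^ m) ω < n * h :=
    lt_of_lt_passageTime (by rw [← hT]; exact_mod_cast hk1)
  have hhigh : n * h + h / 2 < X (((k + 1 : ℕ) : ℝ≥0) / 4 ^ m) ω := hU ⟨hk2, hk3⟩
  obtain ⟨a, ha⟩ := hl ((k : ℝ≥0) / 4 ^ m)
  obtain ⟨b, hb⟩ := hl (((k + 1 : ℕ) : ℝ≥0) / 4 ^ m)
  have hb1 : h * ((n : ℤ) + 1 : ℤ) ≤ X (((k + 1 : ℕ) : ℝ≥0) / 4 ^ m) ω := by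
    refine le_of_lattice_of_lt_add hh hb ?_
    push_cast
    push_cast at hhigh
    linarith
  have ha1 : a ≤ (n : ℤ) - 1 := by
    rw [ha, mul_comm] at hlow
    have : (a : ℝ) < n := lt_of_mul_lt_mul_right hlow hh.le
    have : a < (n : ℤ) := by exact_mod_cast this
    omega
  have ha2 : X ((k : ℝ≥0) / 4 ^ m) ω ≤ h * (n - 1) := by
    rw [ha]
    refine mul_le_mul_of_nonneg_left ?_ hh.le
    exact_mod_cast ha1
  have := hm k hk8
  push_cast at hb1 this
  linarith

/-- An upwards skip-free chain is indistinguishable from one all of whose paths are good. -/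
lemma exists_regular : ∃ (ℱ' : Filtration ℝ≥0 mΩ) (X' : ℝ≥0 → Ω → ℝ),
    IsSkipFreeLevyChain μ ℱ' X' ν h ∧ (∀ ω, GoodPath h (fun t => X' t ω)) ∧
      ∀ᵐ ω ∂μ, ∀ t, X t ω = X' t ω := by
  classical
  have hL := hX.compoundPoisson.levy
  -- The set of bad paths need not be measurable, so its measurable hull is used. On that null set
  -- the path is replaced by the zero path.
  set N : Set Ω := toMeasurable μ {ω | ¬ GoodPath h (fun t => X t ω)} with hN
  have hNm : MeasurableSet N := measurableSet_toMeasurable _ _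
  have hN0 : μ N = 0 := by
    rw [hN, measure_toMeasurable]
    exact ae_iff.1 hX.ae_goodPath
  set X' : ℝ≥0 → Ω → ℝ := fun t ω => if ω ∈ N then 0 else X t ω with hX'
  have hXX' : ∀ᵐ ω ∂μ, ∀ t, X t ω = X' t ω := by
    have : ∀ᵐ ω ∂μ, ω ∉ N := measure_eq_zero_iff_ae_notMem.1 hN0
    filter_upwards [this] with ω hω t
    simp [hX', hω]
  have hXt : ∀ t, X' t =ᵐ[μ] X t := fun t => by
    filter_upwards [hXX'] with ω hω using (hω t).symm
  have hXd : ∀ s t, (fun ω => X' t ω - X' s ω) =ᵐ[μ] fun ω => X t ω - X s ω := fun s t => by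
    filter_upwards [hXX'] with ω hω
    rw [hω t, hω s]
  have hX'm : ∀ t, Measurable (X' t) := fun t =>
    Measurable.ite hNm measurable_const (hL.measurable t)
  have hpath : ∀ ω, (∀ t, X' t ω = 0) ∨ (∀ t, X' t ω = X t ω) ∧ GoodPath h (fun t => X t ω) := by
    intro ω
    by_cases hω : ω ∈ N
    · left
      simp [hX', hω]
    · right
      refine ⟨by simp [hX', hω], ?_⟩
      by_contra hbad
      exact hω (subset_toMeasurable _ _ hbad)
  have hgood : ∀ ω, GoodPath h (fun t => X' t ω) := by
    intro ω
    rcases hpath ω with h0 | ⟨h1, h2⟩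
    · simp_rw [h0]
      refine ⟨fun t => continuousWithinAt_const, rfl, fun t => ⟨0, by simp⟩, fun t n hn => ?_⟩
      have hn0 : (0 : ℝ) ≤ n * h := mul_nonneg (Nat.cast_nonneg n) hX.step_pos.le
      exact ⟨t, le_rfl, le_antisymm hn0 hn⟩
    · simp_rw [h1]
      exact h2
  -- The modified process is adapted only after null events are added to the filtration.
  -- Intersecting with `mΩ` keeps it within the ambient σ-algebra. Each of its sets agrees almost
  -- everywhere with one of `ℱ t`, so independence of the increments survives.
  let ℱ' : Filtration ℝ≥0 mΩ :=
    { seq := fun t => eventuallyMeasurableSpace (ℱ t) (ae μ) ⊓ mΩ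
      mono' := by
        intro s t hst
        refine inf_le_inf_right _ ?_
        rintro A ⟨B, hB, hAB⟩
        exact ⟨B, ℱ.mono hst _ hB, hAB⟩
      le' := fun t => inf_le_right }
  refine ⟨ℱ', X', ⟨⟨⟨?_, fun ω => (hgood ω).rightCont, ?_, ?_, ?_, ?_⟩,
    hX.compoundPoisson.finite, hX.compoundPoisson.ne_zero, hX.compoundPoisson.no_atom_zero, ?_⟩,
    hX.step_pos, hX.support_lattice, hX.support_pos⟩, hgood, hXX'⟩
  · intro t A hA
    refine ⟨⟨X t ⁻¹' A, hL.adapted t hA, ?_⟩, hX'm t hA⟩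
    exact (hXt t).preimage A
  · intro ω t
    rcases hpath ω with h0 | ⟨h1, -⟩
    · simp_rw [h0]
      exact ⟨0, tendsto_const_nhds⟩
    · simp_rw [h1]
      exact hL.left_limits ω t
  · exact ae_of_all _ fun ω => (hgood ω).start
  · intro s t hst
    have hind := hL.indep_increments s t hst
    rw [Indep_iff] at hind ⊢
    rintro A _ ⟨⟨A', hA', hAA'⟩, -⟩ ⟨B, hB, rfl⟩
    have h1 := hind A' _ hA' ⟨B, hB, rfl⟩
    have h2 := (hXd s t).preimage B
    rw [measure_congr hAA', measure_congr h2, ← h1]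
    exact measure_congr (hAA'.inter h2)
  · intro s t hst
    have h1 := hL.stationary_increments s t hst
    exact ((IdentDistrib.of_ae_eq ((hX'm t).sub (hX'm s)).aemeasurable (hXd s t)).trans h1).trans
      (IdentDistrib.of_ae_eq (hX'm _).aemeasurable (hXt (t - s))).symm
  · intro t z
    rw [Measure.map_congr (hXt t)]
    exact hX.compoundPoisson.charFun_eq t z

end IsSkipFreeLevyChain

end SkipFree

/-! ### Stopping times and the exponential martingale. -/

namespace SkipFree

variable {Ω : Type*} {mΩ : MeasurableSpace Ω} {μ : Measure Ω} {ℱ : Filtration ℝ≥0 mΩ}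
  {X : ℝ≥0 → Ω → ℝ} {ν : Measure ℝ} {h : ℝ}

/-- `[0, ∞]`-valued stopping times. -/
def IsStopping (ℱ : Filtration ℝ≥0 mΩ) (τ : Ω → ℝ≥0∞) : Prop :=
  ∀ t : ℝ≥0, MeasurableSet[ℱ t] {ω | τ ω ≤ t}

/-- `B` belongs to the past of the stopping time `τ`. -/
structure PriorTo (ℱ : Filtration ℝ≥0 mΩ) (τ : Ω → ℝ≥0∞) (B : Set Ω) : Prop where
  measurableSet : MeasurableSet B
  inter_le : ∀ t : ℝ≥0, MeasurableSet[ℱ t] (B ∩ {ω | τ ω ≤ t})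

lemma IsStopping.measurable_min {τ : Ω → ℝ≥0∞} (hτ : IsStopping ℱ τ) (t : ℝ≥0) :
    Measurable[ℱ t] fun ω => min (τ ω) t := by
  refine measurable_of_Iic (mδ := ℱ t) fun c => ?_
  rcases le_or_gt (t : ℝ≥0∞) c with hc | hc
  · have : (fun ω => min (τ ω) t) ⁻¹' Iic c = univ := by
      ext ω
      simp [hc]
    rw [this]
    exact @MeasurableSet.univ _ (ℱ t)
  · obtain ⟨s, rfl⟩ := exists_coe_eq hc.ne_top
    have : (fun ω => min (τ ω) t) ⁻¹' Iic (s : ℝ≥0∞) = {ω | τ ω ≤ s} := by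
      ext ω
      simp only [mem_preimage, mem_Iic, min_le_iff, mem_ofPred_eq, or_iff_left_iff_imp]
      exact fun hle => absurd hc (not_lt.2 hle)
    rw [this]
    exact ℱ.mono (by exact_mod_cast hc.le) _ (hτ s)

lemma IsStopping.measurable {τ : Ω → ℝ≥0∞} (hτ : IsStopping ℱ τ) : Measurable τ := by
  refine measurable_of_Iic fun c => ?_
  rcases eq_or_ne c ⊤ with rfl | hc
  · simp
  · obtain ⟨s, rfl⟩ := exists_coe_eq hc
    exact ℱ.le s _ (hτ s)

lemma IsStopping.priorTo_univ {τ : Ω → ℝ≥0∞} (hτ : IsStopping ℱ τ) : PriorTo ℱ τ univ :=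
  ⟨MeasurableSet.univ, fun t => by simpa using hτ t⟩

lemma PriorTo.mono {τ σ : Ω → ℝ≥0∞} {B : Set Ω} (hB : PriorTo ℱ τ B) (hσ : IsStopping ℱ σ)
    (hle : ∀ ω, τ ω ≤ σ ω) : PriorTo ℱ σ B := by
  refine ⟨hB.1, fun t => ?_⟩
  have : B ∩ {ω | σ ω ≤ t} = (B ∩ {ω | τ ω ≤ t}) ∩ {ω | σ ω ≤ t} := by
    ext ω
    simp only [mem_inter_iff, mem_ofPred_eq]
    exact ⟨fun ⟨h1, h2⟩ => ⟨⟨h1, (hle ω).trans h2⟩, h2⟩, fun ⟨⟨h1, _⟩, h2⟩ => ⟨h1, h2⟩⟩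
  rw [this]
  exact @MeasurableSet.inter _ (ℱ t) _ _ (hB.2 t) (hσ t)

/-- Where `τ ≤ t`, the time agrees with its truncation at `t`, which is known at time `t`. -/
lemma PriorTo.inter_preimage {τ : Ω → ℝ≥0∞} {B : Set Ω} (hB : PriorTo ℱ τ B)
    (hτ : IsStopping ℱ τ) {C : Set ℝ≥0∞} (hC : MeasurableSet C) :
    PriorTo ℱ τ (B ∩ τ ⁻¹' C) := by
  refine ⟨hB.1.inter (hτ.measurable hC), fun t => ?_⟩
  have : B ∩ τ ⁻¹' C ∩ {ω | τ ω ≤ t} =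
      (B ∩ {ω | τ ω ≤ t}) ∩ (fun ω => min (τ ω) t) ⁻¹' C := by
    ext ω
    simp only [mem_inter_iff, mem_ofPred_eq, mem_preimage]
    constructor
    · rintro ⟨⟨h1, h2⟩, h3⟩
      exact ⟨⟨h1, h3⟩, by rwa [min_eq_left h3]⟩
    · rintro ⟨⟨h1, h3⟩, h2⟩
      rw [min_eq_left h3] at h2
      exact ⟨⟨h1, h2⟩, h3⟩
  rw [this]
  exact @MeasurableSet.inter _ (ℱ t) _ _ (hB.2 t) (hτ.measurable_min t hC)

/-- The exponential martingale `exp(βX_t - tψ(β))`. -/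
noncomputable def expMart (ν : Measure ℝ) (X : ℝ≥0 → Ω → ℝ) (β : ℝ) (t : ℝ≥0) (ω : Ω) : ℝ≥0∞ :=
  ENNReal.ofReal (Real.exp (β * X t ω - t * laplaceExponent ν β))

/-- The point of the grid of mesh `2⁻ᵐ` at or immediately to the right of `t`. -/
noncomputable def gridCeil (m : ℕ) (t : ℝ≥0) : ℝ≥0 := (⌈t * 2 ^ m⌉₊ : ℝ≥0) / 2 ^ m

lemma le_gridCeil (m : ℕ) (t : ℝ≥0) : t ≤ gridCeil m t := by
  rw [gridCeil, le_div_iff₀ (by positivity)]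
  exact Nat.le_ceil _

lemma gridCeil_le {m : ℕ} {t : ℝ≥0} {N : ℕ} (ht : t ≤ N) : gridCeil m t ≤ N := by
  rw [gridCeil, div_le_iff₀ (by positivity)]
  have : ⌈t * 2 ^ m⌉₊ ≤ N * 2 ^ m := by
    rw [Nat.ceil_le]
    push_cast
    gcongr
  exact_mod_cast this

lemma tendsto_gridCeil (t : ℝ≥0) : Tendsto (fun m => gridCeil m t) atTop (𝓝[≥] t) := by
  refine tendsto_nhdsWithin_iff.2 ⟨?_, Eventually.of_forall fun m => le_gridCeil m t⟩
  have h1 : Tendsto (fun m : ℕ => t + (1 / 2) ^ m) atTop (𝓝 t) := by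
    have := (NNReal.tendsto_pow_atTop_nhds_zero_of_lt_one (r := 1 / 2)
      (by rw [div_lt_one (by positivity)]; norm_num)).const_add t
    rwa [add_zero] at this
  refine tendsto_of_tendsto_of_tendsto_of_le_of_le tendsto_const_nhds h1
    (fun m => le_gridCeil m t) fun m => ?_
  rw [gridCeil, div_le_iff₀ (by positivity), add_mul, ← mul_pow]
  refine (Nat.ceil_lt_add_one (by positivity)).le.trans_eq ?_
  norm_num

namespace IsSkipFreeLevyChain

section Martingale

variable [IsProbabilityMeasure μ] (hX : IsSkipFreeLevyChain μ ℱ X ν h)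
include hX

omit [IsProbabilityMeasure μ] in
lemma measurable_expMart (β : ℝ) (t : ℝ≥0) : Measurable[ℱ t] (expMart ν X β t) :=
  (show Measurable fun x : ℝ => ENNReal.ofReal (Real.exp (β * x - t * laplaceExponent ν β)) by
    fun_prop).comp (hX.compoundPoisson.levy.adapted t)

/-- The martingale property: the value at `t` is the value at `s` times a function of the increment,
which is independent of the past, and the compensator normalises the mean of that function to 1. -/
lemma setLIntegral_expMart {s t : ℝ≥0} (hst : s ≤ t) {β : ℝ} (hβ : 0 ≤ β) {A : Set Ω}
    (hA : MeasurableSet[ℱ s] A) :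
    ∫⁻ ω in A, expMart ν X β t ω ∂μ = ∫⁻ ω in A, expMart ν X β s ω ∂μ := by
  have hL := hX.compoundPoisson.levy
  have hA' := ℱ.le s _ hA
  have hm : Measurable fun ω => X t ω - X s ω := (hL.measurable t).sub (hL.measurable s)
  set c : ℝ := (t - s : ℝ) * laplaceExponent ν β with hc
  set g : Ω → ℝ≥0∞ := fun ω => ENNReal.ofReal (Real.exp (β * (X t ω - X s ω))) with hg
  have hfac : ∀ ω, expMart ν X β t ω =
      ENNReal.ofReal (Real.exp (-c)) * (expMart ν X β s ω * g ω) := by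
    intro ω
    simp only [expMart, hg]
    rw [← ENNReal.ofReal_mul (by positivity), ← ENNReal.ofReal_mul (by positivity),
      ← Real.exp_add, ← Real.exp_add]
    congr 2
    rw [hc]
    ring
  have hind := lintegral_mul_eq_lintegral_mul_lintegral_of_independent_measurableSpace
    (μ := μ) (f := A.indicator (expMart ν X β s)) (g := g) (ℱ.le s) hm.comap_le
    (hL.indep_increments s t hst)
    ((hX.measurable_expMart β s).indicator hA)
    (by
      have : Measurable fun x : ℝ => ENNReal.ofReal (Real.exp (β * x)) := by fun_prop
      exact this.comp (comap_measurable _))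
  have hg1 : ∫⁻ ω, g ω ∂μ = ENNReal.ofReal (Real.exp c) := hX.lintegral_exp_increment hst hβ
  simp_rw [hfac]
  rw [lintegral_const_mul' _ _ ENNReal.ofReal_ne_top, ← lintegral_indicator hA']
  have h1 : ∫⁻ ω, A.indicator (fun ω => expMart ν X β s ω * g ω) ω ∂μ =
      ∫⁻ ω, (A.indicator (expMart ν X β s) * g) ω ∂μ := by
    refine lintegral_congr fun ω => ?_
    by_cases hω : ω ∈ A <;> simp [hω]
  rw [h1]
  simp only [Pi.mul_apply] at hind ⊢
  rw [hind, hg1, lintegral_indicator hA', mul_comm, mul_assoc,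
    ← ENNReal.ofReal_mul (by positivity), ← Real.exp_add]
  simp

lemma lintegral_expMart {β : ℝ} (hβ : 0 ≤ β) (t : ℝ≥0) : ∫⁻ ω, expMart ν X β t ω ∂μ = 1 := by
  have := hX.setLIntegral_expMart (zero_le : (0 : ℝ≥0) ≤ t) hβ (@MeasurableSet.univ _ (ℱ 0))
  simp only [Measure.restrict_univ] at this
  rw [this]
  have h0 : ∫⁻ ω, expMart ν X β 0 ω ∂μ = ∫⁻ _, 1 ∂μ := by
    refine lintegral_congr_ae ?_
    filter_upwards [hX.compoundPoisson.levy.start] with ω hω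
    simp [expMart, hω]
  rw [h0]
  simp

omit [IsProbabilityMeasure μ] in
lemma measurable_expMart_gridCeil (β : ℝ) (m : ℕ) {τ : Ω → ℝ≥0∞} (hτ : Measurable τ) :
    Measurable fun ω => expMart ν X β (gridCeil m (τ ω).toNNReal) ω := by
  have h1 : Measurable fun z : ℕ × Ω => expMart ν X β ((z.1 : ℝ≥0) / 2 ^ m) z.2 := by
    refine measurable_from_prod_countable_right fun k => ?_
    exact (hX.measurable_expMart β ((k : ℝ≥0) / 2 ^ m)).mono (ℱ.le _) le_rfl
  have h2 : Measurable fun ω => ⌈(τ ω).toNNReal * 2 ^ m⌉₊ :=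
    (hτ.ennreal_toNNReal.mul_const (2 ^ m)).nat_ceil
  have h3 : Measurable fun ω => (⌈(τ ω).toNNReal * 2 ^ m⌉₊, ω) := h2.prodMk measurable_id
  have h4 : (fun ω => expMart ν X β (gridCeil m (τ ω).toNNReal) ω) =
      (fun z : ℕ × Ω => expMart ν X β ((z.1 : ℝ≥0) / 2 ^ m) z.2) ∘
        fun ω => (⌈(τ ω).toNNReal * 2 ^ m⌉₊, ω) := by
    funext ω
    rw [Function.comp_apply, gridCeil]
  rw [h4]
  exact h1.comp h3

/-- Rounding up to the grid leaves finitely many values on `τ ≤ N`. On each piece the rounded time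
is a constant k/2^m at which the piece is already decided, so the martingale property applies from
there to `N`. -/
lemma setLIntegral_expMart_gridCeil {β : ℝ} (hβ : 0 ≤ β) {τ : Ω → ℝ≥0∞} (hτ : IsStopping ℱ τ)
    {B : Set Ω} (hB : PriorTo ℱ τ B) (m N : ℕ) :
    ∫⁻ ω in B ∩ {ω | τ ω ≤ N}, expMart ν X β (gridCeil m (τ ω).toNNReal) ω ∂μ =
      ∫⁻ ω in B ∩ {ω | τ ω ≤ N}, expMart ν X β N ω ∂μ := by
  set S : ℕ → Set Ω := fun k => B ∩ {ω | τ ω ≤ N} ∩ {ω | ⌈(τ ω).toNNReal * 2 ^ m⌉₊ = k} with hS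
  have hm2 : Measurable fun ω => ⌈(τ ω).toNNReal * 2 ^ m⌉₊ :=
    Nat.measurable_ceil.comp (hτ.measurable.ennreal_toNNReal.mul_const _)
  have hSm : ∀ k, MeasurableSet (S k) := fun k =>
    (hB.1.inter (hτ.measurable measurableSet_Iic)).inter (hm2 (measurableSet_singleton k))
  have hU : B ∩ {ω | τ ω ≤ N} = ⋃ k ∈ Finset.range (N * 2 ^ m + 1), S k := by
    ext ω
    simp only [hS, mem_iUnion, mem_inter_iff, mem_ofPred_eq, Finset.mem_range]
    constructor
    · rintro ⟨h1, h2⟩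
      refine ⟨_, ?_, ⟨h1, h2⟩, rfl⟩
      rw [Nat.lt_add_one_iff, Nat.ceil_le]
      push_cast
      gcongr
      exact ENNReal.toNNReal_mono (ENNReal.natCast_ne_top N) h2
    · rintro ⟨k, -, h1, -⟩
      exact h1
  have hdisj : Set.PairwiseDisjoint ↑(Finset.range (N * 2 ^ m + 1)) S := by
    intro i _ j _ hij
    refine Set.disjoint_left.2 fun ω h1 h2 => hij ?_
    exact h1.2.symm.trans h2.2
  rw [hU, lintegral_biUnion_finset hdisj (fun k _ => hSm k),
    lintegral_biUnion_finset hdisj (fun k _ => hSm k)]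
  refine Finset.sum_congr rfl fun k hk => ?_
  have hkN : (k : ℝ≥0) / 2 ^ m ≤ N := by
    rw [div_le_iff₀ (by positivity)]
    exact_mod_cast Nat.lt_add_one_iff.1 (Finset.mem_range.1 hk)
  have hprior : MeasurableSet[ℱ ((k : ℝ≥0) / 2 ^ m)] (S k) := by
    have h1 := (hB.inter_preimage hτ (C := Iic (N : ℝ≥0∞) ∩
      {x | ⌈x.toNNReal * 2 ^ m⌉₊ = k}) ?_).inter_le ((k : ℝ≥0) / 2 ^ m)
    · convert! h1 using 1
      ext ω
      simp only [hS, mem_inter_iff, mem_ofPred_eq, mem_preimage, mem_Iic]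
      constructor
      · rintro ⟨⟨h1, h2⟩, h3⟩
        refine ⟨⟨h1, h2, h3⟩, ?_⟩
        rw [← ENNReal.coe_toNNReal (ne_top_of_le_ne_top (ENNReal.natCast_ne_top N) h2)]
        have h4 : (τ ω).toNNReal ≤ (k : ℝ≥0) / 2 ^ m := by
          rw [le_div_iff₀ (by positivity)]
          exact Nat.ceil_le.1 h3.le
        exact_mod_cast h4
      · rintro ⟨⟨h1, h2, h3⟩, -⟩
        exact ⟨⟨h1, h2⟩, h3⟩
    · have h2 : Measurable fun x : ℝ≥0∞ => ⌈x.toNNReal * 2 ^ m⌉₊ :=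
        Nat.measurable_ceil.comp (measurable_id.ennreal_toNNReal.mul_const _)
      exact measurableSet_Iic.inter (h2 (measurableSet_singleton k))
  rw [hX.setLIntegral_expMart hkN hβ hprior]
  refine setLIntegral_congr_fun (hSm k) fun ω hω => ?_
  have : ⌈(τ ω).toNNReal * 2 ^ m⌉₊ = k := hω.2
  simp only [gridCeil, this]

end Martingale

variable [IsProbabilityMeasure μ] (hX : IsSkipFreeLevyChain μ ℱ X ν h)
  (hg : ∀ ω, GoodPath h (fun t => X t ω))
include hX hg

omit [IsProbabilityMeasure μ] hX in
lemma tendsto_expMart_gridCeil (β : ℝ) (t : ℝ≥0) (ω : Ω) :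
    Tendsto (fun m => expMart ν X β (gridCeil m t) ω) atTop (𝓝 (expMart ν X β t ω)) := by
  refine ENNReal.tendsto_ofReal ((Real.continuous_exp.tendsto _).comp ?_)
  refine Tendsto.sub ?_ ?_
  · exact (((hg ω).rightCont t).tendsto.comp (tendsto_gridCeil t)).const_mul β
  · refine Tendsto.mul_const _ ?_
    exact (NNReal.continuous_coe.tendsto t).comp
      (tendsto_nhds_of_tendsto_nhdsWithin (tendsto_gridCeil t))

/-- Fatou's lemma along refining grids gives one inequality without any domination. It bounds the
entrance probabilities, which in turn provide the dominating function for the equality. -/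
lemma setLIntegral_expMart_stopped_le {β : ℝ} (hβ : 0 ≤ β) {τ : Ω → ℝ≥0∞}
    (hτ : IsStopping ℱ τ) {B : Set Ω} (hB : PriorTo ℱ τ B) (N : ℕ) :
    ∫⁻ ω in B ∩ {ω | τ ω ≤ N}, expMart ν X β (τ ω).toNNReal ω ∂μ ≤
      ∫⁻ ω in B ∩ {ω | τ ω ≤ N}, expMart ν X β N ω ∂μ := by
  have h1 := lintegral_liminf_le (u := atTop) (μ := μ.restrict (B ∩ {ω | τ ω ≤ N}))
    (f := fun m ω => expMart ν X β (gridCeil m (τ ω).toNNReal) ω)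
    fun m => hX.measurable_expMart_gridCeil β m hτ.measurable
  simp_rw [hX.setLIntegral_expMart_gridCeil hβ hτ hB, liminf_const] at h1
  refine le_trans (lintegral_mono fun ω => ?_) h1
  exact (tendsto_expMart_gridCeil hg β _ ω).liminf_eq.ge

omit [IsProbabilityMeasure μ] in
lemma isStopping_passageTime (a : ℝ) : IsStopping ℱ (passageTime X a) := by
  intro t
  have hL := hX.compoundPoisson.levy
  have : {ω | passageTime X a ω ≤ t} = {ω | a ≤ X t ω} ∪
      ⋃ i : {i : ℕ // TopologicalSpace.denseSeq ℝ≥0 i ≤ t},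
        {ω | a ≤ X (TopologicalSpace.denseSeq ℝ≥0 i) ω} := by
    ext ω
    simp only [mem_ofPred_eq, (hg ω).passageTime_le_iff_denseSeq hX.step_pos, mem_union,
      mem_iUnion, Subtype.exists, exists_prop]
  rw [this]
  refine @MeasurableSet.union _ (ℱ t) _ _ (hL.adapted t measurableSet_Ici) ?_
  exact @MeasurableSet.iUnion _ _ (ℱ t) _ _ fun i =>
    ℱ.mono i.2 _ (hL.adapted _ measurableSet_Ici)

/-- Markov's inequality for the martingale stopped at the entrance time, where the process equals k
h exactly. -/
lemma measure_passageTime_le {β : ℝ} (hβ : 0 ≤ β) (k N : ℕ) :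
    μ {ω | passageTime X (k * h) ω ≤ N} ≤
      ENNReal.ofReal (Real.exp (N * |laplaceExponent ν β| - β * (k * h))) := by
  have hτ := hX.isStopping_passageTime hg (k * h)
  have h1 := (hX.setLIntegral_expMart_stopped_le hg hβ hτ hτ.priorTo_univ N).trans
    ((setLIntegral_le_lintegral _ _).trans_eq (hX.lintegral_expMart hβ N))
  rw [univ_inter] at h1
  have h2 : ∀ ω ∈ {ω | passageTime X (k * h) ω ≤ N},
      ENNReal.ofReal (Real.exp (β * (k * h) - N * |laplaceExponent ν β|)) ≤
        expMart ν X β (passageTime X (k * h) ω).toNNReal ω := by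
    intro ω hω
    have hne : passageTime X (k * h) ω ≠ ⊤ := ne_top_of_le_ne_top (ENNReal.natCast_ne_top N) hω
    rw [expMart, (hg ω).eq_of_passageTime_eq (ENNReal.coe_toNNReal hne).symm]
    refine ENNReal.ofReal_le_ofReal (Real.exp_le_exp.2 (sub_le_sub_left ?_ _))
    have h3 : (passageTime X (k * h) ω).toNNReal ≤ N :=
      ENNReal.toNNReal_mono (ENNReal.natCast_ne_top N) hω
    have h4 : ((passageTime X (k * h) ω).toNNReal : ℝ) ≤ N := by exact_mod_cast h3
    calc _ ≤ ((passageTime X (k * h) ω).toNNReal : ℝ) * |laplaceExponent ν β| := by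
          gcongr
          exact le_abs_self _
      _ ≤ _ := by gcongr
  have h3 := (setLIntegral_mono' (hτ.measurable measurableSet_Iic) h2).trans h1
  rw [setLIntegral_const] at h3
  calc μ {ω | passageTime X (k * h) ω ≤ N}
      = ENNReal.ofReal (Real.exp (N * |laplaceExponent ν β| - β * (k * h))) *
        (ENNReal.ofReal (Real.exp (β * (k * h) - N * |laplaceExponent ν β|)) *
          μ {ω | passageTime X (k * h) ω ≤ N}) := by
        rw [← mul_assoc, ← ENNReal.ofReal_mul (by positivity), ← Real.exp_add]
        simp
    _ ≤ _ := by
        refine (mul_le_mul_right h3 _).trans_eq (mul_one _)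

/-- Optional stopping for the exponential martingale. -/
lemma setLIntegral_expMart_stopped {β : ℝ} (hβ : 0 < β) {τ : Ω → ℝ≥0∞}
    (hτ : IsStopping ℱ τ) {B : Set Ω} (hB : PriorTo ℱ τ B) (N : ℕ) :
    ∫⁻ ω in B ∩ {ω | τ ω ≤ N}, expMart ν X β (τ ω).toNNReal ω ∂μ =
      ∫⁻ ω in B ∩ {ω | τ ω ≤ N}, expMart ν X β N ω ∂μ := by
  have hh := hX.step_pos
  have hBm : MeasurableSet (B ∩ {ω | τ ω ≤ N}) := hB.1.inter (hτ.measurable measurableSet_Iic)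
  set c₁ : ℝ := N * |laplaceExponent ν β|
  set c₂ : ℝ := N * |laplaceExponent ν (2 * β)|
  set D : ℕ → Set Ω := fun k => {ω | passageTime X (k * h) ω ≤ N}
  have hDm : ∀ k, MeasurableSet (D k) := fun k =>
    (hX.isStopping_passageTime hg (k * h)).measurable measurableSet_Iic
  -- `G` dominates the martingale on all of [0, N]. It is integrable because the entrance bound is
  -- used at the doubled exponent 2β: the factor e^{-2βkh} beats e^{βkh} and leaves a geometric
  -- series.
  set G : Ω → ℝ≥0∞ := fun ω => ∑' k : ℕ, (D k).indicator
    (fun _ => ENNReal.ofReal (Real.exp (β * (k * h) + c₁))) ω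
  have hGint : ∫⁻ ω, G ω ∂μ ≠ ⊤ := by
    have h1 : ∀ k : ℕ, ∫⁻ ω, (D k).indicator
        (fun _ => ENNReal.ofReal (Real.exp (β * (k * h) + c₁))) ω ∂μ ≤
          ENNReal.ofReal (Real.exp (c₁ + c₂) * Real.exp (-(β * h)) ^ k) := by
      intro k
      rw [lintegral_indicator_const (hDm k)]
      refine (mul_le_mul_right (hX.measure_passageTime_le hg (β := 2 * β) (by positivity) k N)
        _).trans_eq ?_
      rw [← ENNReal.ofReal_mul (by positivity), ← Real.exp_add, ← Real.exp_nat_mul, ← Real.exp_add]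
      congr 2
      ring
    rw [lintegral_tsum fun k => (measurable_const.indicator (hDm k)).aemeasurable]
    refine ne_top_of_le_ne_top ?_ (ENNReal.tsum_le_tsum h1)
    have hsum : Summable fun k : ℕ => Real.exp (c₁ + c₂) * Real.exp (-(β * h)) ^ k :=
      (summable_geometric_of_lt_one (Real.exp_pos _).le
        (Real.exp_lt_one_iff.2 (neg_neg_of_pos (mul_pos hβ hh)))).mul_left _
    rw [← ENNReal.ofReal_tsum_of_nonneg (fun m => by positivity) hsum]
    exact ENNReal.ofReal_ne_top
  have hdom : ∀ ω, ∀ s : ℝ≥0, s ≤ N → expMart ν X β s ω ≤ G ω := by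
    intro ω s hs
    have hs' : (s : ℝ) ≤ N := by exact_mod_cast hs
    have hc : -(s * laplaceExponent ν β) ≤ c₁ := by
      calc -(s * laplaceExponent ν β) = s * -laplaceExponent ν β := by ring
        _ ≤ s * |laplaceExponent ν β| := by
          gcongr
          exact neg_le_abs _
        _ ≤ c₁ := by
          simp only [c₁]
          gcongr
    -- For a nonnegative value take its own level, which has been entered by time `s`; for a
    -- negative value take level 0, entered at time 0.
    obtain ⟨k, hk, hXk⟩ : ∃ k : ℕ, ω ∈ D k ∧ X s ω ≤ k * h := by
      rcases le_or_gt 0 (X s ω) with h0 | h0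
      · obtain ⟨l, hl⟩ := (hg ω).lattice s
        rw [hl] at h0
        have hl0 : 0 ≤ l := by
          have := nonneg_of_mul_nonneg_right h0 hh
          exact_mod_cast this
        lift l to ℕ using hl0
        have e : X s ω = l * h := by
          rw [hl, mul_comm]
          simp
        exact ⟨l, (passageTime_le_of_le e.ge).trans (by exact_mod_cast hs), e.le⟩
      · refine ⟨0, ?_, by simpa using h0.le⟩
        simp [D, (hg ω).passageTime_zero]
    refine le_trans ?_ (ENNReal.le_tsum k)
    rw [indicator_of_mem hk]
    refine ENNReal.ofReal_le_ofReal (Real.exp_le_exp.2 ?_)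
    have := mul_le_mul_of_nonneg_left hXk hβ.le
    linarith
  have hlim := tendsto_lintegral_of_dominated_convergence
    (μ := μ.restrict (B ∩ {ω | τ ω ≤ N}))
    (F := fun m ω => expMart ν X β (gridCeil m (τ ω).toNNReal) ω)
    (f := fun ω => expMart ν X β (τ ω).toNNReal ω) G
    (fun m => hX.measurable_expMart_gridCeil β m hτ.measurable)
    (fun m => by
      filter_upwards [ae_restrict_mem hBm] with ω hω
      refine hdom ω _ (gridCeil_le ?_)
      exact ENNReal.toNNReal_mono (ENNReal.natCast_ne_top N) hω.2)
    (ne_top_of_le_ne_top hGint (setLIntegral_le_lintegral _ _))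
    (ae_of_all _ fun ω => tendsto_expMart_gridCeil hg β _ ω)
  simp_rw [hX.setLIntegral_expMart_gridCeil hβ.le hτ hB] at hlim
  exact tendsto_nhds_unique hlim tendsto_const_nhds

end IsSkipFreeLevyChain

end SkipFree

/-! ### Laplace transforms on the extended half-line. -/

namespace SkipFree

/-- `e^{-px}` for `x ∈ [0, ∞]`, with value `0` at `∞`. -/
noncomputable def expNeg (p : ℝ) (x : ℝ≥0∞) : ℝ≥0∞ :=
  if x = ⊤ then 0 else ENNReal.ofReal (Real.exp (-(p * x.toReal)))

lemma measurable_expNeg (p : ℝ) : Measurable (expNeg p) :=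
  Measurable.ite (measurableSet_singleton ⊤) measurable_const
    ((measurable_id.ennreal_toReal.const_mul p).neg.exp.ennreal_ofReal)

lemma expNeg_top (p : ℝ) : expNeg p ⊤ = 0 := if_pos rfl

lemma expNeg_of_ne_top (p : ℝ) {x : ℝ≥0∞} (hx : x ≠ ⊤) :
    expNeg p x = ENNReal.ofReal (Real.exp (-(p * x.toReal))) := if_neg hx

lemma expNeg_ne_zero (p : ℝ) {x : ℝ≥0∞} (hx : x ≠ ⊤) : expNeg p x ≠ 0 := by
  rw [expNeg_of_ne_top p hx, Ne, ENNReal.ofReal_eq_zero, not_le]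
  exact Real.exp_pos _

lemma expNeg_ne_top (p : ℝ) (x : ℝ≥0∞) : expNeg p x ≠ ⊤ := by
  rw [expNeg]
  split_ifs
  · exact ENNReal.zero_ne_top
  · exact ENNReal.ofReal_ne_top

lemma expNeg_le_one {p : ℝ} (hp : 0 ≤ p) (x : ℝ≥0∞) : expNeg p x ≤ 1 := by
  rw [expNeg]
  split_ifs
  · exact zero_le_one
  · rw [ENNReal.ofReal_le_one, Real.exp_le_one_iff, neg_nonpos]
    exact mul_nonneg hp ENNReal.toReal_nonneg

lemma expNeg_add (p : ℝ) (x y : ℝ≥0∞) : expNeg p (x + y) = expNeg p x * expNeg p y := by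
  rcases eq_or_ne x ⊤ with rfl | hx
  · simp [expNeg_top]
  rcases eq_or_ne y ⊤ with rfl | hy
  · simp [expNeg_top]
  rw [expNeg_of_ne_top p hx, expNeg_of_ne_top p hy, expNeg_of_ne_top p (by simp [hx, hy]),
    ENNReal.toReal_add hx hy, ← ENNReal.ofReal_mul (by positivity), ← Real.exp_add]
  ring_nf

/-- `e^{-x}` as a map from `[0, ∞]` to the unit interval. -/
noncomputable def expNegUnit (x : ℝ≥0∞) : unitInterval :=
  ⟨(expNeg 1 x).toReal, ENNReal.toReal_nonneg, by
    have := ENNReal.toReal_mono ENNReal.one_ne_top (expNeg_le_one zero_le_one x)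
    simpa using this⟩

lemma coe_expNegUnit (x : ℝ≥0∞) : (expNegUnit x : ℝ) = (expNeg 1 x).toReal := rfl

lemma measurable_expNegUnit : Measurable expNegUnit :=
  (measurable_expNeg 1).ennreal_toReal.subtype_mk

/-- The inverse of `x ↦ e^{-x}`. -/
noncomputable def negLogUnit (y : unitInterval) : ℝ≥0∞ :=
  if (y : ℝ) = 0 then ⊤ else ENNReal.ofReal (-Real.log y)

lemma measurable_negLogUnit : Measurable negLogUnit :=
  Measurable.ite (measurable_subtype_coe (measurableSet_singleton 0)) measurable_const
    (Real.measurable_log.comp measurable_subtype_coe).neg.ennreal_ofReal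

lemma negLogUnit_expNegUnit (x : ℝ≥0∞) : negLogUnit (expNegUnit x) = x := by
  rcases eq_or_ne x ⊤ with rfl | hx
  · simp [negLogUnit, coe_expNegUnit, expNeg_top]
  · have : (expNegUnit x : ℝ) = Real.exp (-x.toReal) := by
      rw [coe_expNegUnit, expNeg_of_ne_top 1 hx, ENNReal.toReal_ofReal (Real.exp_pos _).le, one_mul]
    rw [negLogUnit, if_neg (by rw [this]; exact (Real.exp_pos _).ne'), this, Real.log_exp,
      neg_neg, ENNReal.ofReal_toReal hx]

/-- Finite measures on the unit interval are determined by their moments. -/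
lemma Measure.ext_of_moments {m₁ m₂ : Measure unitInterval} [IsFiniteMeasure m₁]
    [IsFiniteMeasure m₂] (hm : ∀ n : ℕ, ∫ y, (y : ℝ) ^ n ∂m₁ = ∫ y, (y : ℝ) ^ n ∂m₂) :
    m₁ = m₂ := by
  refine ext_of_forall_integral_eq_of_IsFiniteMeasure fun f => ?_
  have hint : ∀ (m : Measure unitInterval) [IsFiniteMeasure m] (g : C(unitInterval, ℝ)),
      Integrable g m := fun m _ g =>
    (integrable_const ‖g‖).mono' (by fun_prop) (ae_of_all _ fun y => g.norm_coe_le_norm y)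
  have hpoly : ∀ q : Polynomial ℝ, ∫ y : unitInterval, q.eval (y : ℝ) ∂m₁ =
      ∫ y : unitInterval, q.eval (y : ℝ) ∂m₂ := by
    intro q
    simp_rw [Polynomial.eval_eq_sum_range]
    rw [integral_finsetSum, integral_finsetSum]
    · simp_rw [integral_const_mul, hm]
    · exact fun i _ => hint m₂ ⟨fun y => q.coeff i * (y : ℝ) ^ i, by fun_prop⟩
    · exact fun i _ => hint m₁ ⟨fun y => q.coeff i * (y : ℝ) ^ i, by fun_prop⟩
  have hcont : ∀ (m : Measure unitInterval) [IsFiniteMeasure m],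
      Continuous fun g : C(unitInterval, ℝ) => ∫ y, g y ∂m := by
    intro m _
    refine (LipschitzWith.of_dist_le_mul (K := (m.real univ).toNNReal) fun g g' => ?_).continuous
    rw [dist_eq_norm, ← integral_sub (hint m g) (hint m g'), dist_eq_norm,
      Real.coe_toNNReal _ measureReal_nonneg, mul_comm]
    exact norm_integral_le_of_norm_le_const (ae_of_all _ fun y => (g - g').norm_coe_le_norm y)
  -- The functions with equal integrals form a closed set containing all polynomials, hence
  -- everything by Weierstrass.
  have hclosed : IsClosed {g : C(unitInterval, ℝ) | ∫ y, g y ∂m₁ = ∫ y, g y ∂m₂} :=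
    isClosed_eq (hcont m₁) (hcont m₂)
  have hsub : (polynomialFunctions unitInterval : Set C(unitInterval, ℝ)) ⊆
      {g : C(unitInterval, ℝ) | ∫ y, g y ∂m₁ = ∫ y, g y ∂m₂} := by
    rintro g ⟨q, -, rfl⟩
    exact hpoly q
  have htop : (f : C(unitInterval, ℝ)) ∈ (polynomialFunctions unitInterval).topologicalClosure := by
    rw [polynomialFunctions_closure_eq_top']
    trivial
  exact closure_minimal hsub hclosed htop

/-- Weighting by e^{-x} shifts the n-th moment of e^{-x} to the Laplace transform at n + 1 > 0. This
avoids the parameter 0, where no equality is assumed. -/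
lemma coe_expNegUnit_pow_mul (n : ℕ) (x : ℝ≥0∞) :
    expNeg 1 x * ENNReal.ofReal ((expNegUnit x : ℝ) ^ n) = expNeg (n + 1) x := by
  rcases eq_or_ne x ⊤ with rfl | hx
  · simp [expNeg_top]
  · have : (expNegUnit x : ℝ) = Real.exp (-x.toReal) := by
      rw [coe_expNegUnit, expNeg_of_ne_top 1 hx, ENNReal.toReal_ofReal (Real.exp_pos _).le, one_mul]
    rw [this, expNeg_of_ne_top _ hx, expNeg_of_ne_top _ hx, ← ENNReal.ofReal_mul (by positivity),
      ← Real.exp_nat_mul, ← Real.exp_add]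
    ring_nf

/-- Finite measures on `[0, ∞]` with the same Laplace transform on `(0, ∞)` agree on `[0, ∞)`. -/
lemma Measure.restrict_eq_of_laplace {κ₁ κ₂ : Measure ℝ≥0∞} [IsFiniteMeasure κ₁]
    [IsFiniteMeasure κ₂]
    (hκ : ∀ p : ℝ, 0 < p → ∫⁻ x, expNeg p x ∂κ₁ = ∫⁻ x, expNeg p x ∂κ₂) :
    κ₁.restrict {⊤}ᶜ = κ₂.restrict {⊤}ᶜ := by
  have hfin : ∀ (κ : Measure ℝ≥0∞) [IsFiniteMeasure κ],
      IsFiniteMeasure (κ.withDensity (expNeg 1)) := fun κ _ =>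
    isFiniteMeasure_withDensity (ne_top_of_le_ne_top (measure_ne_top κ univ)
      ((lintegral_mono fun x => expNeg_le_one zero_le_one x).trans_eq (lintegral_one)))
  have := hfin κ₁
  have := hfin κ₂
  have hmom : ∀ (κ : Measure ℝ≥0∞) [IsFiniteMeasure κ] (n : ℕ),
      ∫ y, (y : ℝ) ^ n ∂((κ.withDensity (expNeg 1)).map expNegUnit) =
        (∫⁻ x, expNeg (n + 1) x ∂κ).toReal := by
    intro κ _ n
    have hm : Measurable fun y : unitInterval => (y : ℝ) ^ n := measurable_subtype_coe.pow_const n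
    have hm' : Measurable fun x => ENNReal.ofReal ((expNegUnit x : ℝ) ^ n) :=
      (hm.comp measurable_expNegUnit).ennreal_ofReal
    rw [integral_eq_lintegral_of_nonneg_ae (ae_of_all _ fun y => pow_nonneg y.2.1 n)
      hm.aestronglyMeasurable, lintegral_map hm.ennreal_ofReal measurable_expNegUnit,
      lintegral_withDensity_eq_lintegral_mul _ (measurable_expNeg 1) hm']
    simp only [Pi.mul_apply, coe_expNegUnit_pow_mul]
  have h1 : (κ₁.withDensity (expNeg 1)).map expNegUnit =
      (κ₂.withDensity (expNeg 1)).map expNegUnit := by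
    refine Measure.ext_of_moments fun n => ?_
    rw [hmom κ₁, hmom κ₂, hκ _ (by positivity)]
  have h2 : κ₁.withDensity (expNeg 1) = κ₂.withDensity (expNeg 1) := by
    have h3 := congrArg (Measure.map negLogUnit) h1
    have e : negLogUnit ∘ expNegUnit = id := funext negLogUnit_expNegUnit
    rwa [Measure.map_map measurable_negLogUnit measurable_expNegUnit,
      Measure.map_map measurable_negLogUnit measurable_expNegUnit, e, Measure.map_id,
      Measure.map_id] at h3
  -- The density e^{-x} is invertible off ⊤ and vanishes at ⊤, so the weighted measure determines
  -- everything except the mass at ⊤.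
  have h4 : ∀ (κ : Measure ℝ≥0∞) (A : Set ℝ≥0∞), MeasurableSet A → κ (A ∩ {⊤}ᶜ) =
      ∫⁻ x in A ∩ {⊤}ᶜ, (expNeg 1 x)⁻¹ ∂(κ.withDensity (expNeg 1)) := by
    intro κ A hA
    have hA' : MeasurableSet (A ∩ {⊤}ᶜ) := hA.inter (measurableSet_singleton ⊤).compl
    rw [setLIntegral_withDensity_eq_setLIntegral_mul _ (measurable_expNeg 1)
      (g := fun x => (expNeg 1 x)⁻¹) (measurable_expNeg 1).inv hA', ← setLIntegral_one]
    refine setLIntegral_congr_fun hA' fun x hx => ?_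
    simp only [Pi.mul_apply]
    rw [ENNReal.mul_inv_cancel (expNeg_ne_zero 1 hx.2) (expNeg_ne_top 1 x)]
  ext A hA
  rw [Measure.restrict_apply hA, Measure.restrict_apply hA, h4 κ₁ A hA, h4 κ₂ A hA, h2]

/-- As p decreases to 0, e^{-px} tends to 1 at finite `x` and stays 0 at ⊤; the constant 1
dominates. -/
lemma tendsto_lintegral_expNeg (κ : Measure ℝ≥0∞) [IsFiniteMeasure κ] :
    Tendsto (fun k : ℕ => ∫⁻ x, expNeg (1 / ((k : ℝ) + 1)) x ∂κ) atTop (𝓝 (κ {⊤}ᶜ)) := by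
  have h1 : κ {⊤}ᶜ = ∫⁻ x, ({⊤}ᶜ : Set ℝ≥0∞).indicator 1 x ∂κ := by
    rw [lintegral_indicator_one (measurableSet_singleton ⊤).compl]
  rw [h1]
  refine tendsto_lintegral_of_dominated_convergence (fun _ => 1)
    (fun k => measurable_expNeg _) (fun k => ae_of_all _ fun x => expNeg_le_one (by positivity) x)
    (by simp) (ae_of_all _ fun x => ?_)
  rcases eq_or_ne x ⊤ with rfl | hx
  · simp [expNeg_top]
  · simp only [expNeg_of_ne_top _ hx, indicator_of_mem (show x ∈ ({⊤}ᶜ : Set ℝ≥0∞) from hx),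
      Pi.one_apply]
    have h2 : Tendsto (fun k : ℕ => Real.exp (-(1 / ((k : ℝ) + 1) * x.toReal))) atTop
        (𝓝 (Real.exp (-(0 * x.toReal)))) :=
      (Real.continuous_exp.tendsto _).comp
        ((tendsto_one_div_add_atTop_nhds_zero_nat.mul_const _).neg)
    have h3 := ENNReal.tendsto_ofReal h2
    simpa using h3

end SkipFree

/-! ### Laplace transforms and the strong Markov property at level times. -/

namespace SkipFree

variable {Ω : Type*} {mΩ : MeasurableSpace Ω} {μ : Measure Ω} {ℱ : Filtration ℝ≥0 mΩ}
  {X : ℝ≥0 → Ω → ℝ} {ν : Measure ℝ} {h : ℝ}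

/-- The first entrance time `T_{nh}` of the level `nh`. -/
noncomputable def levelTime (X : ℝ≥0 → Ω → ℝ) (h : ℝ) (n : ℕ) (ω : Ω) : ℝ≥0∞ :=
  passageTime X (n * h) ω

section levelTime

variable {ω : Ω} (hh : 0 < h) (hg : GoodPath h (fun t => X t ω))
include hh

lemma levelTime_le_succ (n : ℕ) : levelTime X h n ω ≤ levelTime X h (n + 1) ω := by
  refine passageTime_mono ?_
  push_cast
  nlinarith

lemma levelTime_mono : Monotone fun n => levelTime X h n ω :=
  monotone_nat_of_le_succ fun n => levelTime_le_succ hh n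

include hg

omit hh in
lemma levelTime_zero : levelTime X h 0 ω = 0 := by
  simp [levelTime, hg.passageTime_zero]

lemma levelTime_lt_succ {n : ℕ} (hn : levelTime X h n ω ≠ ⊤) :
    levelTime X h n ω < levelTime X h (n + 1) ω := by
  have := hg.passageTime_lt hh (n := n) (lt_top_iff_ne_top.2 hn)
  simpa [levelTime] using this

omit hh in
lemma eq_at_levelTime {n : ℕ} (hn : levelTime X h n ω ≠ ⊤) :
    X (levelTime X h n ω).toNNReal ω = n * h :=
  hg.eq_of_passageTime_eq (ENNReal.coe_toNNReal hn).symm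

end levelTime

lemma IsStopping.measurable_expNeg_stopped {τ : Ω → ℝ≥0∞} (hτ : IsStopping ℱ τ) (p : ℝ) :
    Measurable fun ω => expNeg p (τ ω) :=
  (measurable_expNeg p).comp hτ.measurable

lemma IsStopping.tendsto_setLIntegral_expNeg {τ : Ω → ℝ≥0∞} (hτ : IsStopping ℱ τ) {B : Set Ω}
    (p : ℝ) :
    Tendsto (fun N : ℕ => ∫⁻ ω in B ∩ {ω | τ ω ≤ N}, expNeg p (τ ω) ∂μ) atTop
      (𝓝 (∫⁻ ω in B, expNeg p (τ ω) ∂μ)) := by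
  have hS : ∀ N : ℕ, MeasurableSet {ω | τ ω ≤ N} := fun N => hτ.measurable measurableSet_Iic
  have h1 : ∀ N : ℕ, ∫⁻ ω in B ∩ {ω | τ ω ≤ N}, expNeg p (τ ω) ∂μ =
      ∫⁻ ω in B, {ω | τ ω ≤ N}.indicator (fun ω => expNeg p (τ ω)) ω ∂μ := by
    intro N
    rw [lintegral_indicator (hS N), Measure.restrict_restrict (hS N), inter_comm]
  simp_rw [h1]
  refine lintegral_tendsto_of_tendsto_of_monotone
    (fun N => ((hτ.measurable_expNeg_stopped p).indicator (hS N)).aemeasurable)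
    (ae_of_all _ fun ω => ?_) (ae_of_all _ fun ω => ?_)
  · intro N M hNM
    refine indicator_le_indicator_of_subset (fun ω hω => ?_) (fun _ => zero_le) ω
    have h2 : (N : ℝ≥0∞) ≤ M := by exact_mod_cast hNM
    exact le_trans hω h2
  · rcases eq_or_ne (τ ω) ⊤ with ht | ht
    · simp only [ht, expNeg_top]
      have : ∀ N : ℕ, {ω | τ ω ≤ N}.indicator (fun ω => expNeg p (τ ω)) ω = 0 := by
        intro N
        refine indicator_of_notMem (fun hω => ?_) _
        rw [mem_ofPred_eq, ht] at hω
        exact absurd hω (by simp)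
      simp_rw [this]
      exact tendsto_const_nhds
    · obtain ⟨N, hN⟩ := ENNReal.exists_nat_gt ht
      refine tendsto_const_nhds.congr' ?_
      filter_upwards [eventually_ge_atTop N] with M hM
      have h2 : (N : ℝ≥0∞) ≤ M := by exact_mod_cast hM
      rw [indicator_of_mem (show ω ∈ {ω | τ ω ≤ M} from hN.le.trans h2)]

lemma PriorTo.inter_sub {τ σ : Ω → ℝ≥0∞} {B : Set Ω} (hB : PriorTo ℱ τ B)
    (hτ : IsStopping ℱ τ) (hσ : IsStopping ℱ σ) (hle : ∀ ω, τ ω ≤ σ ω) {A : Set ℝ≥0∞}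
    (hA : MeasurableSet A) : PriorTo ℱ σ (B ∩ {ω | σ ω - τ ω ∈ A}) := by
  have hB' := hB.mono hσ hle
  refine ⟨hB.1.inter ((hσ.measurable.sub hτ.measurable) hA), fun t => ?_⟩
  have : B ∩ {ω | σ ω - τ ω ∈ A} ∩ {ω | σ ω ≤ t} =
      (B ∩ {ω | σ ω ≤ t}) ∩ (fun ω => min (σ ω) t - min (τ ω) t) ⁻¹' A := by
    ext ω
    simp only [mem_inter_iff, mem_ofPred_eq, mem_preimage]
    constructor
    · rintro ⟨⟨h1, h2⟩, h3⟩
      exact ⟨⟨h1, h3⟩, by rwa [min_eq_left h3, min_eq_left ((hle ω).trans h3)]⟩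
    · rintro ⟨⟨h1, h3⟩, h2⟩
      rw [min_eq_left h3, min_eq_left ((hle ω).trans h3)] at h2
      exact ⟨⟨h1, h2⟩, h3⟩
  rw [this]
  exact @MeasurableSet.inter _ (ℱ t) _ _ (hB'.2 t)
    (((hσ.measurable_min t).sub (hτ.measurable_min t)) hA)

namespace IsSkipFreeLevyChain

variable [IsProbabilityMeasure μ] (hX : IsSkipFreeLevyChain μ ℱ X ν h)
  (hg : ∀ ω, GoodPath h (fun t => X t ω))
include hX hg

omit [IsProbabilityMeasure μ] in
lemma isStopping_levelTime (n : ℕ) : IsStopping ℱ (levelTime X h n) :=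
  hX.isStopping_passageTime hg _

/-- At exponent Φ(p) the compensator is p, and at the level time the position is exactly nh, so the
stopped martingale is a constant times e^{-pT_{nh}}. -/
lemma setLIntegral_expMart_levelTime {p : ℝ} (hp : 0 < p) {n : ℕ} {B : Set Ω}
    (hB : PriorTo ℱ (levelTime X h n) B) (N : ℕ) :
    ∫⁻ ω in B ∩ {ω | levelTime X h n ω ≤ N}, expMart ν X (laplaceInverse ν p) N ω ∂μ =
      ENNReal.ofReal (Real.exp (laplaceInverse ν p * (n * h))) *
        ∫⁻ ω in B ∩ {ω | levelTime X h n ω ≤ N}, expNeg p (levelTime X h n ω) ∂μ := by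
  have hτ := hX.isStopping_levelTime hg n
  rw [← hX.setLIntegral_expMart_stopped hg (hX.skipFreeJumps.laplaceInverse_pos hp) hτ hB N,
    ← lintegral_const_mul _ (hτ.measurable_expNeg_stopped p)]
  refine setLIntegral_congr_fun (hB.1.inter (hτ.measurable measurableSet_Iic)) fun ω hω => ?_
  have hne : levelTime X h n ω ≠ ⊤ := ne_top_of_le_ne_top (ENNReal.natCast_ne_top N) hω.2
  simp only [expMart]
  rw [eq_at_levelTime (hg ω) hne, expNeg_of_ne_top p hne, ← ENNReal.ofReal_mul (by positivity),
    ← Real.exp_add, hX.skipFreeJumps.laplaceExponent_laplaceInverse hp.le]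
  congr 2
  rw [ENNReal.coe_toNNReal_eq_toReal]
  ring

/-- The Laplace transform of the next level time, on an event of the past. -/
lemma setLIntegral_expNeg_levelTime_succ {p : ℝ} (hp : 0 < p) {n : ℕ} {B : Set Ω}
    (hB : PriorTo ℱ (levelTime X h n) B) :
    ∫⁻ ω in B, expNeg p (levelTime X h (n + 1) ω) ∂μ =
      ENNReal.ofReal (Real.exp (-(laplaceInverse ν p * h))) *
        ∫⁻ ω in B, expNeg p (levelTime X h n ω) ∂μ := by
  have hh := hX.step_pos
  have hτ := hX.isStopping_levelTime hg n
  have hσ := hX.isStopping_levelTime hg (n + 1)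
  have hB' := hB.mono hσ fun ω => levelTime_le_succ hh n
  set β := laplaceInverse ν p with hβ
  have hβ0 : 0 < β := hX.skipFreeJumps.laplaceInverse_pos hp
  have hψ : laplaceExponent ν β = p := hX.skipFreeJumps.laplaceExponent_laplaceInverse hp.le
  set c : ℕ → ℝ≥0∞ := fun k => ENNReal.ofReal (Real.exp (β * (k * h))) with hc
  have hcfin : ∀ k, c k ≠ ⊤ := fun k => ENNReal.ofReal_ne_top
  set a : ℕ → ℝ≥0∞ := fun N =>
    ∫⁻ ω in B ∩ {ω | levelTime X h n ω ≤ N}, expNeg p (levelTime X h n ω) ∂μ with ha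
  set b : ℕ → ℝ≥0∞ := fun N =>
    ∫⁻ ω in B ∩ {ω | levelTime X h (n + 1) ω ≤ N}, expNeg p (levelTime X h (n + 1) ω) ∂μ with hb
  have ha_lim : Tendsto (fun N => c n * a N) atTop
      (𝓝 (c n * ∫⁻ ω in B, expNeg p (levelTime X h n ω) ∂μ)) :=
    ENNReal.Tendsto.const_mul (hτ.tendsto_setLIntegral_expNeg p) (Or.inr (hcfin n))
  have hb_lim : Tendsto (fun N => c (n + 1) * b N) atTop
      (𝓝 (c (n + 1) * ∫⁻ ω in B, expNeg p (levelTime X h (n + 1) ω) ∂μ)) :=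
    ENNReal.Tendsto.const_mul (hσ.tendsto_setLIntegral_expNeg p) (Or.inr (hcfin (n + 1)))
  have hsub : ∀ N : ℕ, B ∩ {ω | levelTime X h (n + 1) ω ≤ N} ⊆
      B ∩ {ω | levelTime X h n ω ≤ N} := fun N ω hω =>
    ⟨hω.1, (levelTime_le_succ hh n).trans hω.2⟩
  have hle1 : ∀ N, c (n + 1) * b N ≤ c n * a N := by
    intro N
    simp only [hc, ha, hb]
    rw [← hX.setLIntegral_expMart_levelTime hg hp hB, ← hX.setLIntegral_expMart_levelTime hg hp hB']
    exact lintegral_mono_set (hsub N)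
  -- On the difference of the two events level n+1 is not yet reached at time N, so X_N < (n+1)h and
  -- the martingale there is at most a constant times e^{-Np}. This error vanishes as N grows.
  have hle2 : ∀ N : ℕ, c n * a N ≤ c (n + 1) * b N +
      c (n + 1) * ENNReal.ofReal (Real.exp (-(N * p))) := by
    intro N
    simp only [hc, ha, hb]
    rw [← hX.setLIntegral_expMart_levelTime hg hp hB, ← hX.setLIntegral_expMart_levelTime hg hp hB']
    have hm2 : MeasurableSet (B ∩ {ω | levelTime X h (n + 1) ω ≤ N}) :=
      hB.1.inter (hσ.measurable measurableSet_Iic)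
    rw [← union_sdiff_cancel (hsub N)]
    refine (lintegral_union_le _ _ _).trans ?_
    gcongr
    have hpt : ∀ ω ∈ (B ∩ {ω | levelTime X h n ω ≤ N}) \
        (B ∩ {ω | levelTime X h (n + 1) ω ≤ N}), expMart ν X β N ω ≤
          ENNReal.ofReal (Real.exp (β * ((n + 1 : ℕ) * h))) *
            ENNReal.ofReal (Real.exp (-(N * p))) := by
      rintro ω ⟨hω1, hω2⟩
      have hlt : ((N : ℝ≥0) : ℝ≥0∞) < passageTime X ((n + 1 : ℕ) * h) ω := by
        by_contra! hle
        exact hω2 ⟨hω1.1, by simpa [levelTime] using hle⟩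
      have h1 := lt_of_lt_passageTime hlt
      rw [expMart, ← ENNReal.ofReal_mul (by positivity), ← Real.exp_add, hψ]
      refine ENNReal.ofReal_le_ofReal (Real.exp_le_exp.2 ?_)
      have h2 := mul_le_mul_of_nonneg_left h1.le hβ0.le
      simp only [NNReal.coe_natCast]
      linarith
    have hmd : MeasurableSet ((B ∩ {ω | levelTime X h n ω ≤ N}) \
        (B ∩ {ω | levelTime X h (n + 1) ω ≤ N})) :=
      MeasurableSet.diff (hB.1.inter (hτ.measurable measurableSet_Iic)) hm2
    refine (setLIntegral_mono' hmd hpt).trans ?_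
    rw [setLIntegral_const]
    exact mul_le_of_le_one_right' prob_le_one
  have herr : Tendsto (fun N : ℕ => c (n + 1) * ENNReal.ofReal (Real.exp (-(N * p)))) atTop
      (𝓝 (c (n + 1) * 0)) := by
    refine ENNReal.Tendsto.const_mul ?_ (Or.inr (hcfin (n + 1)))
    have h1 : Tendsto (fun N : ℕ => Real.exp (-(N * p))) atTop (𝓝 0) :=
      Real.tendsto_exp_neg_atTop_nhds_zero.comp
        (tendsto_natCast_atTop_atTop.atTop_mul_const hp)
    simpa using ENNReal.tendsto_ofReal h1
  have hEq : c (n + 1) * ∫⁻ ω in B, expNeg p (levelTime X h (n + 1) ω) ∂μ =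
      c n * ∫⁻ ω in B, expNeg p (levelTime X h n ω) ∂μ := by
    refine le_antisymm (le_of_tendsto_of_tendsto' hb_lim ha_lim hle1) ?_
    have := le_of_tendsto_of_tendsto' ha_lim (hb_lim.add herr) hle2
    simpa using this
  have hcc : c n = ENNReal.ofReal (Real.exp (-(β * h))) * c (n + 1) := by
    simp only [hc]
    rw [← ENNReal.ofReal_mul (by positivity), ← Real.exp_add]
    congr 2
    push_cast
    ring
  have hinv : ENNReal.ofReal (Real.exp (-(β * ((n + 1 : ℕ) * h)))) * c (n + 1) = 1 := by
    simp only [hc]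
    rw [← ENNReal.ofReal_mul (by positivity), ← Real.exp_add]
    simp
  calc ∫⁻ ω in B, expNeg p (levelTime X h (n + 1) ω) ∂μ
      = ENNReal.ofReal (Real.exp (-(β * ((n + 1 : ℕ) * h)))) *
          (c (n + 1) * ∫⁻ ω in B, expNeg p (levelTime X h (n + 1) ω) ∂μ) := by
        rw [← mul_assoc, hinv, one_mul]
    _ = ENNReal.ofReal (Real.exp (-(β * h))) * (ENNReal.ofReal (Real.exp (-(β * ((n + 1 : ℕ) * h))))
          * c (n + 1) * ∫⁻ ω in B, expNeg p (levelTime X h n ω) ∂μ) := by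
        rw [hEq, hcc]
        ring
    _ = _ := by rw [hinv, one_mul]

lemma lintegral_expNeg_levelTime {p : ℝ} (hp : 0 < p) (n : ℕ) :
    ∫⁻ ω, expNeg p (levelTime X h n ω) ∂μ =
      ENNReal.ofReal (Real.exp (-(laplaceInverse ν p * h))) ^ n := by
  induction n with
  | zero =>
    have h0 : ∀ ω, expNeg p (levelTime X h 0 ω) = 1 := fun ω => by
      rw [levelTime_zero (hg ω), expNeg_of_ne_top p ENNReal.zero_ne_top]
      simp
    simp [h0]
  | succ n ih =>
    have := hX.setLIntegral_expNeg_levelTime_succ hg hp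
      (hX.isStopping_levelTime hg n).priorTo_univ
    rw [Measure.restrict_univ] at this
    rw [this, ih, pow_succ']

/-- The increment to the next level time has a fixed conditional Laplace transform. -/
lemma setLIntegral_expNeg_sub {p : ℝ} (hp : 0 < p) {n : ℕ} {B : Set Ω}
    (hB : PriorTo ℱ (levelTime X h n) B) :
    ∫⁻ ω in B ∩ {ω | levelTime X h n ω ≠ ⊤},
        expNeg p (levelTime X h (n + 1) ω - levelTime X h n ω) ∂μ =
      ENNReal.ofReal (Real.exp (-(laplaceInverse ν p * h))) *
        μ (B ∩ {ω | levelTime X h n ω ≠ ⊤}) := by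
  have hh := hX.step_pos
  have hτ := hX.isStopping_levelTime hg n
  have hσ := hX.isStopping_levelTime hg (n + 1)
  set τ := levelTime X h n
  set σ := levelTime X h (n + 1)
  set a := ENNReal.ofReal (Real.exp (-(laplaceInverse ν p * h)))
  have hS : MeasurableSet (B ∩ {ω | τ ω ≠ ⊤}) :=
    hB.1.inter (hτ.measurable (measurableSet_singleton ⊤)).compl
  -- Both are laws of `τ` on `B`, weighted by e^{-pσ} and e^{-pτ} respectively. Since `B` cut down
  -- by an event on `τ` is again in the past of `τ`, the previous transform identity says that they
  -- are proportional. Integrating e^{pτ} over finite values then turns e^{-pσ} into e^{-p(σ-τ)}.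
  set κ₁ : Measure ℝ≥0∞ := ((μ.restrict B).withDensity fun ω => expNeg p (σ ω)).map τ
  set κ₂ : Measure ℝ≥0∞ := ((μ.restrict B).withDensity fun ω => expNeg p (τ ω)).map τ
  have hκ : κ₁ = a • κ₂ := by
    ext C hC
    have hC' := hB.inter_preimage hτ hC
    rw [Measure.smul_apply, Measure.map_apply hτ.measurable hC, Measure.map_apply hτ.measurable hC,
      withDensity_apply _ (hτ.measurable hC), withDensity_apply _ (hτ.measurable hC),
      Measure.restrict_restrict (hτ.measurable hC), inter_comm, smul_eq_mul]
    exact hX.setLIntegral_expNeg_levelTime_succ hg hp hC'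
  set f : ℝ≥0∞ → ℝ≥0∞ := fun x => ({⊤}ᶜ : Set ℝ≥0∞).indicator (fun x => (expNeg p x)⁻¹) x
  have hf : Measurable f :=
    (measurable_expNeg p).inv.indicator (measurableSet_singleton ⊤).compl
  have hfτ : Measurable fun ω => f (τ ω) := hf.comp hτ.measurable
  have hint := congrArg (fun κ => ∫⁻ x, f x ∂κ) hκ
  simp only [κ₁, κ₂] at hint
  rw [lintegral_smul_measure, lintegral_map hf hτ.measurable, lintegral_map hf hτ.measurable,
    lintegral_withDensity_eq_lintegral_mul _ (hσ.measurable_expNeg_stopped p)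
      hfτ, lintegral_withDensity_eq_lintegral_mul _ (hτ.measurable_expNeg_stopped p) hfτ,
    smul_eq_mul] at hint
  have e2 : ∀ g : Ω → ℝ≥0∞, ∫⁻ ω in B, expNeg p (g ω) * f (τ ω) ∂μ =
      ∫⁻ ω in B ∩ {ω | τ ω ≠ ⊤}, expNeg p (g ω) * (expNeg p (τ ω))⁻¹ ∂μ := by
    intro g
    have hT : MeasurableSet {ω | τ ω ≠ ⊤} := (hτ.measurable (measurableSet_singleton ⊤)).compl
    rw [inter_comm, ← Measure.restrict_restrict hT, ← lintegral_indicator hT]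
    refine lintegral_congr fun ω => ?_
    by_cases hω : τ ω = ⊤ <;> simp [f, hω]
  simp only [Pi.mul_apply, e2] at hint
  calc ∫⁻ ω in B ∩ {ω | τ ω ≠ ⊤}, expNeg p (σ ω - τ ω) ∂μ
      = ∫⁻ ω in B ∩ {ω | τ ω ≠ ⊤}, expNeg p (σ ω) * (expNeg p (τ ω))⁻¹ ∂μ := by
        refine setLIntegral_congr_fun hS fun ω hω => ?_
        have hle : τ ω ≤ σ ω := levelTime_le_succ hh n
        have := expNeg_add p (σ ω - τ ω) (τ ω)
        rw [tsub_add_cancel_of_le hle] at this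
        rw [this, mul_assoc, ENNReal.mul_inv_cancel (expNeg_ne_zero p hω.2) (expNeg_ne_top p _),
          mul_one]
    _ = a * ∫⁻ ω in B ∩ {ω | τ ω ≠ ⊤}, expNeg p (τ ω) * (expNeg p (τ ω))⁻¹ ∂μ := hint
    _ = a * μ (B ∩ {ω | τ ω ≠ ⊤}) := by
        rw [← setLIntegral_one]
        congr 1
        refine setLIntegral_congr_fun hS fun ω hω => ?_
        rw [ENNReal.mul_inv_cancel (expNeg_ne_zero p hω.2) (expNeg_ne_top p _)]

/-- The strong Markov property at the level times. -/
lemma measure_inter_sub_mem {n : ℕ} {B : Set Ω} (hB : PriorTo ℱ (levelTime X h n) B)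
    {A : Set ℝ≥0∞} (hA : MeasurableSet A) :
    μ (B ∩ {ω | levelTime X h n ω ≠ ⊤} ∩
        {ω | levelTime X h (n + 1) ω - levelTime X h n ω ∈ A ∩ {⊤}ᶜ}) =
      μ (B ∩ {ω | levelTime X h n ω ≠ ⊤}) * μ {ω | levelTime X h 1 ω ∈ A ∩ {⊤}ᶜ} := by
  have hτ := hX.isStopping_levelTime hg n
  have hσ := hX.isStopping_levelTime hg (n + 1)
  have hm : Measurable fun ω => levelTime X h (n + 1) ω - levelTime X h n ω :=
    hσ.measurable.sub hτ.measurable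
  have hm1 := (hX.isStopping_levelTime hg 1).measurable
  set S := B ∩ {ω | levelTime X h n ω ≠ ⊤}
  -- On `S` the law of the increment is compared with `μ S` times the law of T_h: their Laplace
  -- transforms agree for every p > 0.
  have hκ := Measure.restrict_eq_of_laplace
    (κ₁ := (μ.restrict S).map fun ω => levelTime X h (n + 1) ω - levelTime X h n ω)
    (κ₂ := (μ S).toNNReal • μ.map (levelTime X h 1)) fun p hp => by
      rw [lintegral_map (measurable_expNeg p) hm, hX.setLIntegral_expNeg_sub hg hp hB,
        lintegral_smul_measure, lintegral_map (measurable_expNeg p) hm1,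
        hX.lintegral_expNeg_levelTime hg hp 1, pow_one, mul_comm]
      simp only [ENNReal.smul_def, smul_eq_mul]
      rw [ENNReal.coe_toNNReal (measure_ne_top μ S)]
  have hA' : MeasurableSet (A ∩ {⊤}ᶜ) := hA.inter (measurableSet_singleton ⊤).compl
  have h1 := congrArg (fun κ => κ A) hκ
  simp only [Measure.restrict_apply hA, Measure.smul_apply] at h1
  rw [Measure.map_apply hm hA', Measure.map_apply hm1 hA', Measure.restrict_apply (hm hA'),
    ENNReal.smul_def, smul_eq_mul, ENNReal.coe_toNNReal (measure_ne_top μ S), inter_comm] at h1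
  exact h1

/-- The limit of E[e^{-pT_h}] = e^{-Φ(p)h} along p = 1/(k+1), by right-continuity of Φ at 0. -/
lemma measure_levelTime_one_ne_top : μ {ω | levelTime X h 1 ω ≠ ⊤} =
    ENNReal.ofReal (Real.exp (-(laplaceInverse ν 0 * h))) := by
  have hm1 := (hX.isStopping_levelTime hg 1).measurable
  have : IsProbabilityMeasure (μ.map (levelTime X h 1)) :=
    Measure.isProbabilityMeasure_map hm1.aemeasurable
  have h1 := tendsto_lintegral_expNeg (μ.map (levelTime X h 1))
  simp_rw [lintegral_map (measurable_expNeg _) hm1] at h1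
  have h2 : ∀ k : ℕ, ∫⁻ ω, expNeg (1 / ((k : ℝ) + 1)) (levelTime X h 1 ω) ∂μ =
      ENNReal.ofReal (Real.exp (-(laplaceInverse ν (1 / ((k : ℝ) + 1)) * h))) := fun k => by
    rw [hX.lintegral_expNeg_levelTime hg (by positivity) 1, pow_one]
  simp_rw [h2] at h1
  rw [Measure.map_apply hm1 (measurableSet_singleton ⊤).compl] at h1
  refine tendsto_nhds_unique h1 (ENNReal.tendsto_ofReal ((Real.continuous_exp.tendsto _).comp
    (Tendsto.neg (Tendsto.mul_const h ?_))))
  refine hX.skipFreeJumps.tendsto_laplaceInverse_zero.comp (tendsto_nhdsWithin_iff.2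
    ⟨tendsto_one_div_add_atTop_nhds_zero_nat, Eventually.of_forall fun k => ?_⟩)
  exact mem_Ioi.2 (by positivity)

end IsSkipFreeLevyChain

end SkipFree

/-! ### Geometric counts and laws of sequences. -/

namespace SkipFree

section Geometric

variable {Ω : Type*} {mΩ : MeasurableSpace Ω} {μ : Measure Ω} [IsProbabilityMeasure μ]

/-- If `E 0 ⊇ E 1 ⊇ …` have probabilities `aⁿ` with `a < 1`, then the index of the last event that
occurs is geometric with failure probability `a`. -/
lemma exists_geometric_count {E : ℕ → Set Ω} (hE : ∀ n, MeasurableSet (E n)) (hanti : Antitone E)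
    {a : ℝ} (ha0 : 0 ≤ a) (ha1 : a < 1) (hμ : ∀ n, μ (E n) = ENNReal.ofReal a ^ n) :
    ∃ (q : unitInterval) (N : Ω → ℕ), q ≠ 0 ∧ (q : ℝ) = 1 - a ∧
      HasLaw N (geometricMeasure q) μ ∧ ∀ᵐ ω ∂μ, ∀ n, ω ∈ E n ↔ n ≤ N ω := by
  classical
  let q : unitInterval := ⟨1 - a, by linarith, by linarith⟩
  have hq1 : (q : ℝ) = 1 - a := rfl
  have hq : q ≠ 0 := by
    intro h0
    have h1 : (q : ℝ) = 0 := by simp [h0]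
    linarith
  -- The second alternative makes the search succeed everywhere. On the null event that all `E k`
  -- occur the count defaults to 0.
  have hp : ∀ ω, ∃ n, ω ∉ E (n + 1) ∨ ∀ k, ω ∈ E k := by
    intro ω
    by_cases hω : ∀ k, ω ∈ E k
    · exact ⟨0, Or.inr hω⟩
    · push Not at hω
      obtain ⟨k, hk⟩ := hω
      exact ⟨k, Or.inl fun hk' => hk (hanti (Nat.le_succ k) hk')⟩
  let N : Ω → ℕ := fun ω => Nat.find (hp ω)
  have hN : Measurable N := by
    refine measurable_find hp fun k => ?_
    have : {ω | ω ∉ E (k + 1) ∨ ∀ j, ω ∈ E j} = (E (k + 1))ᶜ ∪ ⋂ j, E j := by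
      ext ω
      simp
    rw [this]
    exact (hE _).compl.union (MeasurableSet.iInter hE)
  have h0 : ∀ᵐ ω ∂μ, ω ∈ E 0 := by
    exact (mem_ae_iff_prob_eq_one (hE 0)).2 (by rw [hμ 0, pow_zero])
  have hinf : ∀ᵐ ω ∂μ, ∃ k, ω ∉ E k := by
    have h1 : μ (⋂ k, E k) = 0 := by
      have h2 := tendsto_measure_iInter_atTop (μ := μ) (fun k => (hE k).nullMeasurableSet) hanti
        ⟨0, measure_ne_top _ _⟩
      have h3 : Tendsto (fun k => μ (E k)) atTop (𝓝 0) := by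
        simp_rw [hμ]
        exact ENNReal.tendsto_pow_atTop_nhds_zero_of_lt_one (by
          rw [← ENNReal.ofReal_one]
          exact (ENNReal.ofReal_lt_ofReal_iff one_pos).2 ha1)
      exact tendsto_nhds_unique h2 h3
    filter_upwards [measure_eq_zero_iff_ae_notMem.1 h1] with ω hω
    simpa using hω
  have hchar : ∀ᵐ ω ∂μ, ∀ n, ω ∈ E n ↔ n ≤ N ω := by
    filter_upwards [h0, hinf] with ω hω0 ⟨k, hk⟩ n
    have hno : ¬ ∀ k, ω ∈ E k := fun hall => hk (hall k)
    have hfind : ω ∉ E (N ω + 1) := (Nat.find_spec (hp ω)).resolve_right hno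
    constructor
    · intro hn
      by_contra! hlt
      exact hfind (hanti hlt hn)
    · intro hn
      rcases n with _ | n
      · exact hω0
      · have := Nat.find_min (hp ω) (m := n) (Nat.lt_of_succ_le hn)
        push Not at this
        exact this.1
  refine ⟨q, N, hq, rfl, ⟨hN.aemeasurable, ?_⟩, hchar⟩
  refine Measure.ext_of_singleton fun n => ?_
  rw [Measure.map_apply hN (measurableSet_singleton n), geometricMeasure_singleton hq]
  have h1 : N ⁻¹' {n} =ᵐ[μ] (E n \ E (n + 1) : Set Ω) := by
    filter_upwards [hchar] with ω hω
    refine propext ?_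
    change N ω = n ↔ ω ∈ E n ∧ ω ∉ E (n + 1)
    rw [hω n, hω (n + 1)]
    omega
  rw [measure_congr h1, measure_sdiff (hanti (Nat.le_add_right n 1)) (hE _).nullMeasurableSet
    (measure_ne_top _ _), hμ, hμ, ← ENNReal.ofReal_pow ha0, ← ENNReal.ofReal_pow ha0,
    ← ENNReal.ofReal_sub _ (by positivity), hq1]
  congr 1
  ring

end Geometric

section Sequences

lemma isPiSystem_initialBoxes {α : Type*} [MeasurableSpace α] :
    IsPiSystem {S : Set (ℕ → α) | ∃ (n : ℕ) (A : ℕ → Set α), (∀ k, MeasurableSet (A k)) ∧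
      S = {y | ∀ k < n, y k ∈ A k}} := by
  classical
  rintro _ ⟨n, A, hA, rfl⟩ _ ⟨m, A', hA', rfl⟩ -
  refine ⟨max n m, fun k => (if k < n then A k else univ) ∩ (if k < m then A' k else univ),
    fun k => ?_, ?_⟩
  · refine MeasurableSet.inter ?_ ?_
    · split_ifs
      exacts [hA k, MeasurableSet.univ]
    · split_ifs
      exacts [hA' k, MeasurableSet.univ]
  · ext y
    simp only [mem_inter_iff, mem_ofPred_eq, lt_max_iff]
    constructor
    · rintro ⟨h1, h2⟩ k -
      constructor
      · split_ifs with hk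
        exacts [h1 k hk, mem_univ _]
      · split_ifs with hk
        exacts [h2 k hk, mem_univ _]
    · intro h1
      refine ⟨fun k hk => ?_, fun k hk => ?_⟩
      · simpa [hk] using (h1 k (Or.inl hk)).1
      · simpa [hk] using (h1 k (Or.inr hk)).2

lemma generateFrom_initialBoxes {α : Type*} [mα : MeasurableSpace α] :
    (MeasurableSpace.pi : MeasurableSpace (ℕ → α)) =
      MeasurableSpace.generateFrom {S : Set (ℕ → α) | ∃ (n : ℕ) (A : ℕ → Set α),
        (∀ k, MeasurableSet (A k)) ∧ S = {y | ∀ k < n, y k ∈ A k}} := by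
  classical
  refine le_antisymm ?_ ?_
  · refine iSup_le fun i => ?_
    rintro _ ⟨s, hs, rfl⟩
    refine MeasurableSpace.measurableSet_generateFrom
      ⟨i + 1, fun k => if k = i then s else univ, fun k => ?_, ?_⟩
    · beta_reduce
      split_ifs
      exacts [hs, MeasurableSet.univ]
    · ext y
      simp only [mem_preimage, mem_ofPred_eq]
      constructor
      · intro hy k _
        split_ifs with hk
        exacts [hk ▸ hy, mem_univ _]
      · intro hy
        simpa using hy i (Nat.lt_succ_self i)
  · refine MeasurableSpace.generateFrom_le ?_
    rintro _ ⟨n, A, hA, rfl⟩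
    have : {y : ℕ → α | ∀ k < n, y k ∈ A k} = ⋂ k, ⋂ (_ : k < n), (fun y => y k) ⁻¹' A k := by
      ext y
      simp
    rw [this]
    exact MeasurableSet.iInter fun k => MeasurableSet.iInter fun _ => measurable_pi_apply k (hA k)

lemma measurableSet_initialBox {α : Type*} [MeasurableSpace α] (n : ℕ) {A : ℕ → Set α}
    (hA : ∀ k, MeasurableSet (A k)) : MeasurableSet {y : ℕ → α | ∀ k < n, y k ∈ A k} := by
  rw [generateFrom_initialBoxes]
  exact MeasurableSpace.measurableSet_generateFrom ⟨n, A, hA, rfl⟩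

lemma Measure.ext_of_initialBoxes {α : Type*} [MeasurableSpace α] {P Q : Measure (ℕ → α)}
    [IsProbabilityMeasure P] [IsProbabilityMeasure Q]
    (hPQ : ∀ (n : ℕ) (A : ℕ → Set α), (∀ k, MeasurableSet (A k)) →
      P {y | ∀ k < n, y k ∈ A k} = Q {y | ∀ k < n, y k ∈ A k}) : P = Q := by
  refine ext_of_generate_finite _ generateFrom_initialBoxes isPiSystem_initialBoxes ?_ (by simp)
  rintro _ ⟨n, A, hA, rfl⟩
  exact hPQ n A hA

/-- The law of a `[0, ∞]`-valued sequence for which `∞` is absorbing is determined by the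
probabilities of its finite boxes. -/
lemma Measure.ext_of_absorbing {P Q : Measure (ℕ → ℝ≥0∞)}
    [IsProbabilityMeasure P] [IsProbabilityMeasure Q]
    (hP : ∀ᵐ y ∂P, ∀ k, y k = ⊤ → y (k + 1) = ⊤) (hQ : ∀ᵐ y ∂Q, ∀ k, y k = ⊤ → y (k + 1) = ⊤)
    (hPQ : ∀ (n : ℕ) (A : ℕ → Set ℝ≥0∞), (∀ k, MeasurableSet (A k)) →
      P {y | ∀ k < n, y k ∈ A k ∩ {⊤}ᶜ} = Q {y | ∀ k < n, y k ∈ A k ∩ {⊤}ᶜ}) : P = Q := by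
  classical
  have htop : MeasurableSet ({⊤}ᶜ : Set ℝ≥0∞) := (measurableSet_singleton ⊤).compl
  -- Split a box of length n+1 by whether coordinate n is finite. If it is, all earlier ones are
  -- finite too by absorption. If it is ⊤, the last constraint is just ⊤ ∈ A n, and what remains is
  -- the box of length n minus its part with finite coordinate n, where the last coordinate is
  -- otherwise free. So boxes are determined recursively by boxes of finite values.
  have hrec : ∀ (ρ : Measure (ℕ → ℝ≥0∞)) [IsProbabilityMeasure ρ],
      (∀ᵐ y ∂ρ, ∀ k, y k = ⊤ → y (k + 1) = ⊤) → ∀ (n : ℕ) (A : ℕ → Set ℝ≥0∞),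
      (∀ k, MeasurableSet (A k)) → ρ {y | ∀ k < n + 1, y k ∈ A k} =
        ρ {y | ∀ k < n + 1, y k ∈ A k ∩ {⊤}ᶜ} + (if ⊤ ∈ A n then ρ {y | ∀ k < n, y k ∈ A k} -
          ρ {y | ∀ k < n + 1, y k ∈ (if k < n then A k else univ) ∩ {⊤}ᶜ} else 0) := by
    intro ρ _ hR n A hA
    have hfin : ∀ᵐ y ∂ρ, y n ≠ ⊤ → ∀ k ≤ n, y k ≠ ⊤ := by
      filter_upwards [hR] with y hy hn k hk hkt
      refine hn ?_
      induction n, hk using Nat.le_induction with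
      | base => exact hkt
      | succ m hm ih => exact hy m (by_contra fun h1 => h1 (by
          by_contra h2
          exact h1 (ih h2)))
    set S : Set (ℕ → ℝ≥0∞) := {y | y n ≠ ⊤}
    have hev : Measurable fun y : ℕ → ℝ≥0∞ => y n := measurable_pi_apply n
    have hS : MeasurableSet S := hev htop
    have hA' : ∀ k, MeasurableSet ((if k < n then A k else univ) : Set ℝ≥0∞) := by
      intro k
      split_ifs
      exacts [hA k, MeasurableSet.univ]
    rw [← measure_inter_add_sdiff {y | ∀ k < n + 1, y k ∈ A k} hS]
    congr 1
    · refine measure_congr ?_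
      filter_upwards [hfin] with y hy
      refine propext ⟨fun ⟨h1, h2⟩ k hk => ⟨h1 k hk, hy h2 k (by omega)⟩, fun h1 =>
        ⟨fun k hk => (h1 k hk).1, (h1 n (Nat.lt_succ_self n)).2⟩⟩
    · split_ifs with hn
      · have h1 : ({y | ∀ k < n + 1, y k ∈ A k} \ S : Set (ℕ → ℝ≥0∞)) =
            {y | ∀ k < n, y k ∈ A k} \ S := by
          ext y
          simp only [Set.mem_sdiff, mem_ofPred_eq, S, not_not]
          refine and_congr_left fun hyn => ⟨fun h1 k hk => h1 k (by omega), fun h1 k hk => ?_⟩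
          rcases Nat.lt_succ_iff_lt_or_eq.1 hk with hk | rfl
          · exact h1 k hk
          · rw [hyn]
            exact hn
        have h2 : (({y | ∀ k < n, y k ∈ A k} ∩ S : Set (ℕ → ℝ≥0∞))) =ᵐ[ρ]
            {y | ∀ k < n + 1, y k ∈ (if k < n then A k else univ) ∩ {⊤}ᶜ} := by
          filter_upwards [hfin] with y hy
          refine propext ⟨fun ⟨h1, h2⟩ k hk => ⟨?_, hy h2 k (by omega)⟩, fun h1 =>
            ⟨fun k hk => ?_, (h1 n (Nat.lt_succ_self n)).2⟩⟩
          · split_ifs with hkn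
            exacts [h1 k hkn, mem_univ _]
          · simpa [hk] using (h1 k (by omega)).1
        rw [h1, ← measure_congr h2, ← measure_inter_add_sdiff {y | ∀ k < n, y k ∈ A k} hS,
          ENNReal.add_sub_cancel_left (measure_ne_top _ _)]
      · have h1 : ({y | ∀ k < n + 1, y k ∈ A k} \ S : Set (ℕ → ℝ≥0∞)) = ∅ := by
          ext y
          simp only [Set.mem_sdiff, mem_ofPred_eq, S, not_not, mem_empty_iff_false, iff_false, not_and]
          intro h1 hyn
          have := h1 n (Nat.lt_succ_self n)
          rw [hyn] at this
          exact hn this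
        rw [h1, measure_empty]
  refine Measure.ext_of_initialBoxes fun n => ?_
  induction n with
  | zero => simp
  | succ n ih =>
    intro A hA
    have hA' : ∀ k, MeasurableSet ((if k < n then A k else univ) : Set ℝ≥0∞) := by
      intro k
      split_ifs
      exacts [hA k, MeasurableSet.univ]
    rw [hrec P hP n A hA, hrec Q hQ n A hA, hPQ _ _ hA, hPQ _ _ hA', ih A hA]

lemma lt_explosionTime_iff {S : ℕ → ℝ≥0∞} (hS : Monotone S) (n : ℕ) :
    (n : ℕ∞) < explosionTime S ↔ S n ≠ ⊤ := by
  constructor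
  · intro hlt htop
    exact absurd hlt (not_lt.2 (iInf₂_le n htop))
  · intro hn
    by_contra! hle
    have h1 : explosionTime S < ((n + 1 : ℕ) : ℕ∞) :=
      hle.trans_lt (by exact_mod_cast Nat.lt_succ_self n)
    rw [explosionTime] at h1
    simp only [iInf_lt_iff] at h1
    obtain ⟨m, hm, hmn⟩ := h1
    have hmn' : m ≤ n := Nat.lt_succ_iff.1 (by exact_mod_cast hmn)
    exact hn (top_le_iff.1 (hm ▸ hS hmn'))

end Sequences

end SkipFree

/-! ### The level times as a killed random walk. -/

namespace SkipFree

variable {Ω : Type*} {mΩ : MeasurableSpace Ω} {μ : Measure Ω} {ℱ : Filtration ℝ≥0 mΩ}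
  {X : ℝ≥0 → Ω → ℝ} {ν : Measure ℝ} {h : ℝ}

/-- The law of `T_h` given `T_h < ∞`. -/
noncomputable def stepLaw (μ : Measure Ω) (X : ℝ≥0 → Ω → ℝ) (h : ℝ) : Measure ℝ≥0∞ :=
  (μ[|{ω | levelTime X h 1 ω ≠ ⊤}]).map (levelTime X h 1)

/-- The first `n` increments of the level times lie in `A 0, …, A (n - 1)`. -/
def incrementEvent (X : ℝ≥0 → Ω → ℝ) (h : ℝ) (A : ℕ → Set ℝ≥0∞) (n : ℕ) : Set Ω :=
  {ω | ∀ k < n, levelTime X h (k + 1) ω - levelTime X h k ω ∈ A k}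

lemma incrementEvent_succ (A : ℕ → Set ℝ≥0∞) (n : ℕ) : incrementEvent X h A (n + 1) =
    incrementEvent X h A n ∩ {ω | levelTime X h (n + 1) ω - levelTime X h n ω ∈ A n} := by
  ext ω
  simp only [incrementEvent, mem_inter_iff, mem_ofPred_eq]
  refine ⟨fun h1 => ⟨fun k hk => h1 k (by omega), h1 n (by omega)⟩, fun ⟨h1, h2⟩ k hk => ?_⟩
  rcases Nat.lt_succ_iff_lt_or_eq.1 hk with hk | rfl
  exacts [h1 k hk, h2]

lemma ofReal_exp_ne_zero (x : ℝ) : ENNReal.ofReal (Real.exp x) ≠ 0 := by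
  rw [Ne, ENNReal.ofReal_eq_zero, not_le]
  exact Real.exp_pos _

namespace IsSkipFreeLevyChain

variable [IsProbabilityMeasure μ] (hX : IsSkipFreeLevyChain μ ℱ X ν h)
  (hg : ∀ ω, GoodPath h (fun t => X t ω))
include hX hg

lemma isProbabilityMeasure_stepLaw : IsProbabilityMeasure (stepLaw μ X h) := by
  have hm := (hX.isStopping_levelTime hg 1).measurable
  have : IsProbabilityMeasure (μ[|{ω | levelTime X h 1 ω ≠ ⊤}]) := by
    refine cond_isProbabilityMeasure ?_
    rw [hX.measure_levelTime_one_ne_top hg]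
    exact (ofReal_exp_ne_zero _)
  exact Measure.isProbabilityMeasure_map hm.aemeasurable

lemma mul_stepLaw {A : Set ℝ≥0∞} (hA : MeasurableSet A) :
    ENNReal.ofReal (Real.exp (-(laplaceInverse ν 0 * h))) * stepLaw μ X h A =
      μ {ω | levelTime X h 1 ω ∈ A ∩ {⊤}ᶜ} := by
  have hm := (hX.isStopping_levelTime hg 1).measurable
  have hS : MeasurableSet {ω | levelTime X h 1 ω ≠ ⊤} := hm (measurableSet_singleton ⊤).compl
  rw [stepLaw, Measure.map_apply hm hA, cond_apply hS, hX.measure_levelTime_one_ne_top hg,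
    ← mul_assoc, ENNReal.mul_inv_cancel (ofReal_exp_ne_zero _) ENNReal.ofReal_ne_top,
    one_mul]
  congr 1
  ext ω
  simp [and_comm]

/-- T_h is strictly later than T_0 = 0, and the conditioning removes the value ⊤. -/
lemma stepLaw_compl_Ioo : stepLaw μ X h (Ioo 0 ⊤)ᶜ = 0 := by
  have h1 := hX.mul_stepLaw hg (A := (Ioo 0 ⊤)ᶜ) measurableSet_Ioo.compl
  have h2 : {ω | levelTime X h 1 ω ∈ (Ioo 0 ⊤)ᶜ ∩ {⊤}ᶜ} = ∅ := by
    ext ω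
    simp only [mem_ofPred_eq, mem_inter_iff, mem_compl_iff, mem_Ioo, mem_singleton_iff,
      mem_empty_iff_false, iff_false, not_and, not_not]
    intro h3
    by_contra h4
    have h5 := levelTime_lt_succ hX.step_pos (hg ω) (n := 0) (by simp [levelTime_zero (hg ω)])
    rw [levelTime_zero (hg ω)] at h5
    exact h3 h5 (lt_top_iff_ne_top.2 h4)
  rw [h2, measure_empty, mul_eq_zero] at h1
  exact h1.resolve_left (ofReal_exp_ne_zero _)

omit [IsProbabilityMeasure μ] in
lemma priorTo_incrementEvent {A : ℕ → Set ℝ≥0∞} (hA : ∀ k, MeasurableSet (A k)) (n : ℕ) :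
    PriorTo ℱ (levelTime X h n) (incrementEvent X h A n) := by
  induction n with
  | zero =>
    have : incrementEvent X h A 0 = univ := by
      ext ω
      simp [incrementEvent]
    rw [this]
    exact (hX.isStopping_levelTime hg 0).priorTo_univ
  | succ n ih =>
    rw [incrementEvent_succ]
    exact ih.inter_sub (hX.isStopping_levelTime hg n) (hX.isStopping_levelTime hg (n + 1))
      (fun ω => levelTime_le_succ hX.step_pos n) (hA n)

/-- The joint law of the increments of the level times up to explosion. -/
lemma measure_incrementEvent {A : ℕ → Set ℝ≥0∞} (hA : ∀ k, MeasurableSet (A k)) (n : ℕ) :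
    μ (incrementEvent X h A n ∩ {ω | levelTime X h n ω ≠ ⊤}) =
      ENNReal.ofReal (Real.exp (-(laplaceInverse ν 0 * h))) ^ n *
        ∏ k ∈ Finset.range n, stepLaw μ X h (A k) := by
  induction n with
  | zero =>
    have : incrementEvent X h A 0 ∩ {ω | levelTime X h 0 ω ≠ ⊤} = univ := by
      ext ω
      simp [incrementEvent, levelTime_zero (hg ω)]
    rw [this]
    simp
  | succ n ih =>
    -- Since ⊤ - ⊤ = 0, a finite increment certifies a finite next time only together with
    -- finiteness of the current one.
    have h1 : incrementEvent X h A (n + 1) ∩ {ω | levelTime X h (n + 1) ω ≠ ⊤} =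
        incrementEvent X h A n ∩ {ω | levelTime X h n ω ≠ ⊤} ∩
          {ω | levelTime X h (n + 1) ω - levelTime X h n ω ∈ A n ∩ {⊤}ᶜ} := by
      ext ω
      have hle : levelTime X h n ω ≤ levelTime X h (n + 1) ω := levelTime_le_succ hX.step_pos n
      simp only [incrementEvent_succ, mem_inter_iff, mem_ofPred_eq, mem_compl_iff,
        mem_singleton_iff, ENNReal.sub_eq_top_iff, not_and, not_not]
      constructor
      · rintro ⟨⟨h1, h2⟩, h3⟩
        exact ⟨⟨h1, ne_top_of_le_ne_top h3 hle⟩, h2, fun h4 => absurd h4 h3⟩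
      · rintro ⟨⟨h1, h2⟩, h3, h4⟩
        exact ⟨⟨h1, h3⟩, fun h5 => h2 (h4 h5)⟩
    rw [h1, hX.measure_inter_sub_mem hg (hX.priorTo_incrementEvent hg hA n) (hA n), ih,
      ← hX.mul_stepLaw hg (hA n), Finset.prod_range_succ, pow_succ]
    ring

lemma measure_levelTime_ne_top (n : ℕ) : μ {ω | levelTime X h n ω ≠ ⊤} =
    ENNReal.ofReal (Real.exp (-(laplaceInverse ν 0 * h))) ^ n := by
  have := hX.isProbabilityMeasure_stepLaw hg
  have h1 := hX.measure_incrementEvent hg (A := fun _ => univ) (fun _ => MeasurableSet.univ) n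
  simpa [incrementEvent] using h1

omit [IsProbabilityMeasure μ] in
lemma measurableSet_levelTime_ne_top (n : ℕ) : MeasurableSet {ω | levelTime X h n ω ≠ ⊤} :=
  (hX.isStopping_levelTime hg n).measurable (measurableSet_singleton ⊤).compl

omit [IsProbabilityMeasure μ] in
lemma measurable_explosionTime :
    Measurable fun ω => explosionTime (fun n => levelTime X h n ω) := by
  have h1 : ∀ n : ℕ, Measurable fun ω => ⨅ _ : levelTime X h n ω = ⊤, (n : ℕ∞) := by
    intro n
    have : (fun ω => ⨅ _ : levelTime X h n ω = ⊤, (n : ℕ∞)) =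
        (fun x : ℝ≥0∞ => ⨅ _ : x = ⊤, (n : ℕ∞)) ∘ levelTime X h n := rfl
    rw [this]
    refine Measurable.comp ?_ (hX.isStopping_levelTime hg n).measurable
    classical
    have h2 : (fun x : ℝ≥0∞ => ⨅ _ : x = ⊤, (n : ℕ∞)) = fun x => if x = ⊤ then (n : ℕ∞) else ⊤ := by
      ext1 x
      split_ifs with hx <;> simp [hx]
    rw [h2]
    exact Measurable.ite (measurableSet_singleton ⊤) measurable_const measurable_const
  have : BorelSpace ℕ∞ := ⟨by rw [borel_eq_top_of_countable]; rfl⟩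
  exact Measurable.iInf h1

/-- The events of reaching level n decrease and have probabilities a^n. If a = 1 they all occur
almost surely and there is no explosion; otherwise the last level reached is geometric and explosion
comes one index later. -/
lemma isGeometricKillingLaw_map_explosionTime :
    IsGeometricKillingLaw (μ.map fun ω => explosionTime (fun n => levelTime X h n ω))
      (Real.exp (-(laplaceInverse ν 0 * h))) := by
  have hh := hX.step_pos
  have hmono : ∀ ω, Monotone fun n => levelTime X h n ω := fun ω => levelTime_mono hh
  have hζm := hX.measurable_explosionTime hg
  set a := Real.exp (-(laplaceInverse ν 0 * h)) with ha
  have ha1 : a ≤ 1 := by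
    rw [ha, Real.exp_le_one_iff, neg_nonpos]
    exact mul_nonneg (hX.skipFreeJumps.laplaceInverse_nonneg le_rfl) hh.le
  have hE : ∀ n, MeasurableSet {ω | levelTime X h n ω ≠ ⊤} :=
    hX.measurableSet_levelTime_ne_top hg
  have hanti : Antitone fun n => {ω | levelTime X h n ω ≠ ⊤} := fun n m hnm ω hω =>
    ne_top_of_le_ne_top hω (hmono ω hnm)
  rcases eq_or_lt_of_le ha1 with ha1 | ha1
  · right
    refine ⟨ha1, ?_⟩
    have h1 : ∀ᵐ ω ∂μ, ∀ n, levelTime X h n ω ≠ ⊤ := by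
      refine ae_all_iff.2 fun n => (mem_ae_iff_prob_eq_one (hE n)).2 ?_
      rw [hX.measure_levelTime_ne_top hg, ← ha, ha1]
      simp
    have h2 : (fun ω => explosionTime (fun n => levelTime X h n ω)) =ᵐ[μ] fun _ => ⊤ := by
      filter_upwards [h1] with ω hω
      refine ENat.eq_top_iff_forall_gt.2 fun n => ?_
      exact (lt_explosionTime_iff (hmono ω) n).2 (hω n)
    rw [Measure.map_congr h2, Measure.map_const, measure_univ, one_smul]
  · left
    obtain ⟨q, N, hq, hqa, hN, hchar⟩ := exists_geometric_count hE hanti (Real.exp_pos _).le ha1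
      (hX.measure_levelTime_ne_top hg)
    refine ⟨q, hq, hqa, ?_⟩
    rw [← hN.map_eq, AEMeasurable.map_map_of_aemeasurable
      (Measurable.of_discrete (f := fun n : ℕ => (n : ℕ∞) + 1)).aemeasurable hN.aemeasurable]
    refine Measure.map_congr ?_
    filter_upwards [hchar] with ω hω
    refine le_antisymm ?_ ?_
    · by_contra! hlt
      have h1 : ((N ω + 1 : ℕ) : ℕ∞) < explosionTime (fun n => levelTime X h n ω) := by
        exact_mod_cast hlt
      have h2 := (hω _).1 ((lt_explosionTime_iff (hmono ω) _).1 h1)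
      omega
    · have h1 := (lt_explosionTime_iff (hmono ω) _).2 ((hω (N ω)).2 le_rfl)
      exact Order.add_one_le_of_lt h1

/-- The joint law up to explosion is a^n times a product, and conditioning divides by a^n. -/
lemma hasStationaryIndepIncrements :
    HasStationaryIndepIncrementsUpToExplosion μ (levelTime X h) (stepLaw μ X h) := by
  classical
  have hh := hX.step_pos
  have := hX.isProbabilityMeasure_stepLaw hg
  intro n
  have hset : {ω | (n : ℕ∞) < explosionTime (fun m => levelTime X h m ω)} =
      {ω | levelTime X h n ω ≠ ⊤} := by
    ext ω
    exact lt_explosionTime_iff (levelTime_mono hh) n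
  rw [hset]
  have hT : ∀ k, Measurable (levelTime X h k) := fun k => (hX.isStopping_levelTime hg k).measurable
  have hm : Measurable fun ω (k : Fin n) => levelTime X h (k + 1) ω - levelTime X h k ω :=
    measurable_pi_iff.2 fun k => (hT _).sub (hT _)
  refine ⟨hm.aemeasurable, (Measure.pi_eq fun s hs => ?_).symm⟩
  set A : ℕ → Set ℝ≥0∞ := fun k => if hk : k < n then s ⟨k, hk⟩ else univ with hAdef
  have hA : ∀ k, MeasurableSet (A k) := by
    intro k
    simp only [hAdef]
    split_ifs
    exacts [hs _, MeasurableSet.univ]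
  have hpre : (fun ω (k : Fin n) => levelTime X h (k + 1) ω - levelTime X h k ω) ⁻¹'
      (univ.pi s) = incrementEvent X h A n := by
    ext ω
    simp only [mem_preimage, mem_univ_pi, incrementEvent, mem_ofPred_eq, hAdef]
    constructor
    · intro h1 k hk
      simpa [hk] using h1 ⟨k, hk⟩
    · intro h1 k
      simpa using h1 k k.2
  rw [Measure.map_apply hm (MeasurableSet.univ_pi hs), hpre,
    cond_apply (hX.measurableSet_levelTime_ne_top hg n), inter_comm,
    hX.measure_incrementEvent hg hA, hX.measure_levelTime_ne_top hg, ← mul_assoc,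
    ENNReal.inv_mul_cancel (pow_ne_zero _ (ofReal_exp_ne_zero _))
      (ENNReal.pow_ne_top ENNReal.ofReal_ne_top), one_mul, Finset.prod_range]
  refine Finset.prod_congr rfl fun k _ => ?_
  simp [hAdef]

/-- The level times form a killed random walk. -/
lemma isKilledRandomWalk :
    IsKilledRandomWalk μ (levelTime X h) (stepLaw μ X h)
      (μ.map fun ω => explosionTime (fun n => levelTime X h n ω)) := by
  classical
  have hh := hX.step_pos
  have := hX.isProbabilityMeasure_stepLaw hg
  have hmono : ∀ ω, Monotone fun n => levelTime X h n ω := fun ω => levelTime_mono hh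
  have hT : ∀ k, Measurable (levelTime X h k) := fun k => (hX.isStopping_levelTime hg k).measurable
  have hζm := hX.measurable_explosionTime hg
  set F := stepLaw μ X h
  set G := μ.map fun ω => explosionTime (fun n => levelTime X h n ω)
  have hGp : IsProbabilityMeasure G := Measure.isProbabilityMeasure_map hζm.aemeasurable
  have hG : ∀ n : ℕ, G {N | (n : ℕ∞) < N} =
      ENNReal.ofReal (Real.exp (-(laplaceInverse ν 0 * h))) ^ n := by
    intro n
    rw [Measure.map_apply hζm MeasurableSet.of_discrete, ← hX.measure_levelTime_ne_top hg n]
    congr 1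
    ext ω
    exact lt_explosionTime_iff (hmono ω) n
  set cum : (ℕ → ℝ≥0∞) → ℕ → ℝ≥0∞ := fun y n => ∑ i ∈ Finset.range n, y i
  have hcum : Measurable cum := measurable_pi_iff.2 fun n =>
    Finset.measurable_sum _ fun i _ => measurable_pi_apply i
  -- The comparison is made for steps rather than positions, partial sums recovering the positions.
  -- Every step into an infinite time is set to ⊤, so that ⊤ is absorbing. In `Z` step `k` leads to
  -- index k+1, which is alive precisely when k+1 is below the killing time.
  set Y : Ω → ℕ → ℝ≥0∞ := fun ω k => if levelTime X h (k + 1) ω = ⊤ then ⊤ else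
    levelTime X h (k + 1) ω - levelTime X h k ω with hYdef
  set Z : (ℕ → ℝ≥0∞) × ℕ∞ → ℕ → ℝ≥0∞ := fun z k =>
    if ((k + 1 : ℕ) : ℕ∞) < z.2 then z.1 k else ⊤ with hZdef
  have hY : Measurable Y := measurable_pi_iff.2 fun k =>
    Measurable.ite (hT _ (measurableSet_singleton ⊤)) measurable_const ((hT _).sub (hT _))
  have hZ : Measurable Z := by
    refine measurable_pi_iff.2 fun k => Measurable.ite ?_
      ((measurable_pi_apply k).comp measurable_fst) measurable_const
    exact measurable_snd (MeasurableSet.of_discrete (s := {N : ℕ∞ | ((k + 1 : ℕ) : ℕ∞) < N}))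
  have hcumY : ∀ ω, cum (Y ω) = fun n => levelTime X h n ω := by
    intro ω
    funext n
    induction n with
    | zero => simp [cum, levelTime_zero (hg ω)]
    | succ n ih =>
      simp only [cum, Finset.sum_range_succ] at ih ⊢
      rw [ih]
      simp only [hYdef]
      split_ifs with htop
      · simp [htop]
      · exact add_tsub_cancel_of_le (levelTime_le_succ hh n)
  -- A walk killed at index 0 would start at ⊤, whereas the empty sum is 0; that case has
  -- probability zero.
  have hcumZ : ∀ z : (ℕ → ℝ≥0∞) × ℕ∞, 0 < z.2 → cum (Z z) = killedWalk z.1 z.2 := by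
    intro z hz
    funext n
    simp only [cum, killedWalk, hZdef]
    split_ifs with hn
    · refine Finset.sum_congr rfl fun k hk => if_pos (lt_of_le_of_lt ?_ hn)
      exact_mod_cast Finset.mem_range.1 hk
    · rcases n with _ | n
      · exact absurd hz (by simpa using hn)
      · rw [Finset.sum_range_succ, if_neg hn, add_top]
  have hpos : ∀ᵐ z ∂((Measure.infinitePi fun _ : ℕ => F).prod G), 0 < z.2 := by
    refine Measure.quasiMeasurePreserving_snd.ae (p := fun N : ℕ∞ => 0 < N) ?_
    refine (mem_ae_iff_prob_eq_one MeasurableSet.of_discrete).2 ?_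
    simpa using hG 0
  have habs : MeasurableSet {y : ℕ → ℝ≥0∞ | ∀ k, y k = ⊤ → y (k + 1) = ⊤} := by
    have e : {y : ℕ → ℝ≥0∞ | ∀ k, y k = ⊤ → y (k + 1) = ⊤} =
        ⋂ k, ((fun y : ℕ → ℝ≥0∞ => y k) ⁻¹' {⊤})ᶜ ∪ (fun y : ℕ → ℝ≥0∞ => y (k + 1)) ⁻¹' {⊤} := by
      ext y
      simp [imp_iff_not_or]
    rw [e]
    have hev : ∀ k, Measurable fun y : ℕ → ℝ≥0∞ => y k := fun k => measurable_pi_apply k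
    exact MeasurableSet.iInter fun k => ((hev k) (measurableSet_singleton ⊤)).compl.union
      ((hev (k + 1)) (measurableSet_singleton ⊤))
  have hYabs : ∀ᵐ y ∂(μ.map Y), ∀ k, y k = ⊤ → y (k + 1) = ⊤ := by
    rw [ae_map_iff hY.aemeasurable habs]
    refine ae_of_all _ fun ω k hk => ?_
    have h1 : levelTime X h (k + 1) ω = ⊤ := by
      by_contra h1
      simp only [hYdef, if_neg h1] at hk
      exact h1 (ENNReal.sub_eq_top_iff.1 hk).1
    exact if_pos (top_le_iff.1 (h1 ▸ levelTime_le_succ hh (k + 1)))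
  have hFtop : F {⊤} = 0 := measure_mono_null (by simp) (hX.stepLaw_compl_Ioo hg)
  have hξ : ∀ᵐ z ∂((Measure.infinitePi fun _ : ℕ => F).prod G), ∀ k, z.1 k ≠ ⊤ := by
    refine Measure.quasiMeasurePreserving_fst.ae (p := fun ξ : ℕ → ℝ≥0∞ => ∀ k, ξ k ≠ ⊤) ?_
    refine ae_all_iff.2 fun k => ?_
    have h1 := (measurePreserving_eval_infinitePi (fun _ : ℕ => F) k).quasiMeasurePreserving.ae
      (p := fun x => x ≠ ⊤) (measure_eq_zero_iff_ae_notMem.1 hFtop)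
    exact h1
  have hZabs : ∀ᵐ y ∂(((Measure.infinitePi fun _ : ℕ => F).prod G).map Z),
      ∀ k, y k = ⊤ → y (k + 1) = ⊤ := by
    rw [ae_map_iff hZ.aemeasurable habs]
    filter_upwards [hξ] with z hz k hk
    have h1 : ¬ ((k + 1 : ℕ) : ℕ∞) < z.2 := by
      intro h1
      simp only [hZdef, if_pos h1] at hk
      exact hz k hk
    refine if_neg fun h2 => h1 (lt_trans ?_ h2)
    exact_mod_cast Nat.lt_succ_self (k + 1)
  -- Both sequences absorb at ⊤, and both give a box of n finite values the probability a^n ∏ F(A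
  -- k), so their laws agree.
  have hmain : μ.map Y = ((Measure.infinitePi fun _ : ℕ => F).prod G).map Z := by
    have : IsProbabilityMeasure (μ.map Y) := Measure.isProbabilityMeasure_map hY.aemeasurable
    have : IsProbabilityMeasure (((Measure.infinitePi fun _ : ℕ => F).prod G).map Z) :=
      Measure.isProbabilityMeasure_map hZ.aemeasurable
    refine Measure.ext_of_absorbing hYabs hZabs fun n A hA => ?_
    have hbox : MeasurableSet {y : ℕ → ℝ≥0∞ | ∀ k < n, y k ∈ A k ∩ {⊤}ᶜ} :=
      measurableSet_initialBox n fun k => (hA k).inter (measurableSet_singleton ⊤).compl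
    rw [Measure.map_apply hY hbox, Measure.map_apply hZ hbox]
    have e1 : Y ⁻¹' {y : ℕ → ℝ≥0∞ | ∀ k < n, y k ∈ A k ∩ {⊤}ᶜ} =
        incrementEvent X h A n ∩ {ω | levelTime X h n ω ≠ ⊤} := by
      ext ω
      simp only [mem_preimage, mem_ofPred_eq, incrementEvent, mem_inter_iff, mem_compl_iff,
        mem_singleton_iff, hYdef]
      constructor
      · intro h1
        have h2 : ∀ k < n, levelTime X h (k + 1) ω ≠ ⊤ := by
          intro k hk htop
          exact (h1 k hk).2 (if_pos htop)
        refine ⟨fun k hk => ?_, ?_⟩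
        · have := (h1 k hk).1
          rwa [if_neg (h2 k hk)] at this
        · rcases n with _ | n
          · simp [levelTime_zero (hg ω)]
          · exact h2 n (Nat.lt_succ_self n)
      · rintro ⟨h1, h2⟩ k hk
        have h3 : levelTime X h (k + 1) ω ≠ ⊤ := ne_top_of_le_ne_top h2 (hmono ω hk)
        rw [if_neg h3]
        exact ⟨h1 k hk, fun h4 => h3 (ENNReal.sub_eq_top_iff.1 h4).1⟩
    have e2 : (Z ⁻¹' {y : ℕ → ℝ≥0∞ | ∀ k < n, y k ∈ A k ∩ {⊤}ᶜ} : Set _)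
        =ᵐ[(Measure.infinitePi fun _ : ℕ => F).prod G]
        (((Finset.range n : Set ℕ).pi A) ×ˢ {N : ℕ∞ | (n : ℕ∞) < N} : Set _) := by
      filter_upwards [hξ, hpos] with z hz hz0
      refine propext ?_
      change (∀ k < n, Z z k ∈ A k ∩ {⊤}ᶜ) ↔
        (∀ k ∈ (Finset.range n : Set ℕ), z.1 k ∈ A k) ∧ (n : ℕ∞) < z.2
      simp only [mem_inter_iff, mem_compl_iff, mem_singleton_iff, hZdef, Finset.coe_range, mem_Iio]
      constructor
      · intro h1
        have h2 : ∀ k < n, ((k + 1 : ℕ) : ℕ∞) < z.2 := by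
          intro k hk
          by_contra h3
          exact (h1 k hk).2 (if_neg h3)
        refine ⟨fun k hk => ?_, ?_⟩
        · have := (h1 k hk).1
          rwa [if_pos (h2 k hk)] at this
        · rcases n with _ | n
          · simpa using hz0
          · exact h2 n (Nat.lt_succ_self n)
      · rintro ⟨h1, h2⟩ k hk
        have h3 : ((k + 1 : ℕ) : ℕ∞) < z.2 := lt_of_le_of_lt (by exact_mod_cast hk) h2
        rw [if_pos h3]
        exact ⟨h1 k hk, hz k⟩
    rw [e1, hX.measure_incrementEvent hg hA, measure_congr e2, Measure.prod_prod, hG,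
      Measure.infinitePi_pi _ fun k _ => hA k, mul_comm]
  refine ⟨(measurable_pi_iff.2 hT).aemeasurable, ?_⟩
  have h1 : (fun ω n => levelTime X h n ω) = cum ∘ Y := by
    funext ω
    exact (hcumY ω).symm
  rw [h1, ← Measure.map_map hcum hY, hmain, Measure.map_map hcum hZ]
  refine Measure.map_congr ?_
  filter_upwards [hpos] with z hz using hcumZ z hz

end IsSkipFreeLevyChain

end SkipFree

/-! ### The running supremum at an exponential time and the overall supremum. -/

namespace SkipFree

variable {Ω : Type*} {mΩ : MeasurableSpace Ω} {μ : Measure Ω} {ℱ : Filtration ℝ≥0 mΩ}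
  {X : ℝ≥0 → Ω → ℝ} {ν : Measure ℝ} {h : ℝ}

lemma expMeasure_le_ofReal {p : ℝ} (hp : 0 < p) (t : ℝ≥0∞) :
    expMeasure p {x | t ≤ ENNReal.ofReal x} = expNeg p t := by
  have := isProbabilityMeasure_expMeasure hp
  rcases eq_or_ne t ⊤ with rfl | ht
  · simp [expNeg_top]
  -- `ENNReal.ofReal` sends negative reals to 0, so at `t = 0` the event is the whole line and not a
  -- half-line.
  rcases eq_or_ne t 0 with rfl | ht0
  · simp [expNeg_of_ne_top]
  have h1 : {x | t ≤ ENNReal.ofReal x} = Ici t.toReal := by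
    ext x
    rcases le_or_gt 0 x with hx | hx
    · exact ENNReal.le_ofReal_iff_toReal_le ht hx
    · have h2 := ENNReal.toReal_pos ht0 ht
      simp only [mem_ofPred_eq, mem_Ici, ENNReal.ofReal_of_nonpos hx.le, nonpos_iff_eq_zero, ht0,
        false_iff, not_le]
      linarith
  have hna : NullSingletonClass (expMeasure p) :=
    ⟨fun x => withDensity_absolutelyContinuous _ _ (measure_singleton x)⟩
  have hcdf := cdf_expMeasure_eq hp t.toReal
  rw [if_pos ENNReal.toReal_nonneg, cdf_eq_real] at hcdf
  rw [h1, ← measure_congr Ioi_ae_eq_Ici, ← compl_Iic, ← ofReal_measureReal,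
    probReal_compl_eq_one_sub measurableSet_Iic, hcdf, expNeg_of_ne_top p ht]
  congr 1
  ring

/-- For lattice values the supremum is the highest level reached: a value strictly above Nh would be
at least (N+1)h. -/
lemma iSup_div_eq {x : ℝ≥0 → ℝ} (hh : 0 < h) (hl : ∀ t, ∃ k : ℤ, x t = h * k) {S : Set ℝ≥0}
    {N : ℕ} (hN : ∀ n : ℕ, (∃ s ∈ S, n * h ≤ x s) ↔ n ≤ N) :
    (⨆ s ∈ S, (x s : EReal)) / (h : EReal) = ((N : ℝ) : EReal) := by
  have h1 : (⨆ s ∈ S, (x s : EReal)) = ((N * h : ℝ) : EReal) := by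
    refine le_antisymm (iSup₂_le fun s hs => ?_) ?_
    · rw [EReal.coe_le_coe_iff]
      by_contra! hlt
      obtain ⟨k, hk⟩ := hl s
      have h2 : h * ((N + 1 : ℤ) : ℝ) ≤ x s := by
        refine le_of_lattice_of_lt_add hh hk ?_
        push_cast
        linarith
      push_cast at h2
      have := (hN (N + 1)).1 ⟨s, hs, by push_cast; linarith⟩
      omega
    · obtain ⟨s, hs, hle⟩ := (hN N).2 le_rfl
      exact (EReal.coe_le_coe_iff.2 hle).trans (le_iSup₂ (f := fun s _ => (x s : EReal)) s hs)
  rw [h1, ← EReal.coe_div, mul_div_cancel_right₀ _ hh.ne']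

lemma hasGeometricLaw_of_count [IsProbabilityMeasure μ] {q : unitInterval} {N : Ω → ℕ} {a : ℝ}
    {Y : Ω → EReal} (hq : q ≠ 0) (hqa : (q : ℝ) = 1 - a) (hN : HasLaw N (geometricMeasure q) μ)
    (hY : Y =ᵐ[μ] fun ω => ((N ω : ℝ) : EReal)) : HasGeometricLaw μ Y a := by
  refine ⟨q, hq, hqa, ?_⟩
  have hm : Measurable fun n : ℕ => ((n : ℝ) : EReal) := Measurable.of_discrete
  have h1 : HasLaw (fun n : ℕ => ((n : ℝ) : EReal))
      ((geometricMeasure q).map fun n : ℕ => ((n : ℝ) : EReal)) (geometricMeasure q) :=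
    ⟨hm.aemeasurable, rfl⟩
  exact (h1.comp hN).congr hY

namespace IsSkipFreeLevyChain

variable [IsProbabilityMeasure μ] (hX : IsSkipFreeLevyChain μ ℱ X ν h)
  (hg : ∀ ω, GoodPath h (fun t => X t ω))
include hX hg

omit [IsProbabilityMeasure μ] in
lemma indepFun_levelTime {e : Ω → ℝ} (hind : IndepFun (fun ω t => X t ω) e μ) (n : ℕ) :
    IndepFun (levelTime X h n) e μ := by
  classical
  set f : (ℝ≥0 → ℝ) → ℝ≥0∞ := fun x =>
    ⨅ i : ℕ, ⨅ _ : (n * h : ℝ) ≤ x (TopologicalSpace.denseSeq ℝ≥0 i),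
      (TopologicalSpace.denseSeq ℝ≥0 i : ℝ≥0∞)
  have hf : Measurable f := by
    refine Measurable.iInf fun i => ?_
    have h2 : (fun x : ℝ≥0 → ℝ => ⨅ _ : (n * h : ℝ) ≤ x (TopologicalSpace.denseSeq ℝ≥0 i),
        (TopologicalSpace.denseSeq ℝ≥0 i : ℝ≥0∞)) = fun x =>
          if (n * h : ℝ) ≤ x (TopologicalSpace.denseSeq ℝ≥0 i) then
            (TopologicalSpace.denseSeq ℝ≥0 i : ℝ≥0∞) else ⊤ := by
      ext1 x
      split_ifs with hx <;> simp [hx]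
    rw [h2]
    have hev : Measurable fun x : ℝ≥0 → ℝ => x (TopologicalSpace.denseSeq ℝ≥0 i) :=
      measurable_pi_apply _
    exact Measurable.ite (hev measurableSet_Ici) measurable_const measurable_const
  have h1 : levelTime X h n = f ∘ fun ω t => X t ω := by
    funext ω
    exact (hg ω).passageTime_eq_iInf_denseSeq hX.step_pos _
  rw [h1]
  exact hind.comp hf measurable_id

/-- An independent exponential time survives past T_{nh} with conditional probability e^{-pT_{nh}},
so this is the Laplace transform of T_{nh} at p. -/
lemma measure_levelTime_le_exponential {p : ℝ} (hp : 0 < p) {e : Ω → ℝ}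
    (he : HasLaw e (expMeasure p) μ) (hind : IndepFun (fun ω t => X t ω) e μ) (n : ℕ) :
    μ {ω | levelTime X h n ω ≤ ENNReal.ofReal (e ω)} =
      ENNReal.ofReal (Real.exp (-(laplaceInverse ν p * h))) ^ n := by
  have := isProbabilityMeasure_expMeasure hp
  have hT := (hX.isStopping_levelTime hg n).measurable
  have hm := (indepFun_iff_map_prod_eq_prod_map_map hT.aemeasurable he.aemeasurable).1
    (hX.indepFun_levelTime hg hind n)
  rw [he.map_eq] at hm
  have hS : MeasurableSet {z : ℝ≥0∞ × ℝ | z.1 ≤ ENNReal.ofReal z.2} :=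
    measurableSet_le measurable_fst (measurable_snd.ennreal_ofReal)
  have h1 : μ {ω | levelTime X h n ω ≤ ENNReal.ofReal (e ω)} =
      (μ.map fun ω => (levelTime X h n ω, e ω)) {z | z.1 ≤ ENNReal.ofReal z.2} := by
    rw [Measure.map_apply_of_aemeasurable (hT.aemeasurable.prodMk he.aemeasurable) hS]
    rfl
  rw [h1, hm, Measure.prod_apply hS, ← hX.lintegral_expNeg_levelTime hg hp n,
    ← lintegral_map (measurable_expNeg p) hT]
  exact lintegral_congr fun t => expMeasure_le_ofReal hp t

lemma hasGeometricLaw_runningSup {p : ℝ} (hp : 0 < p) {e : Ω → ℝ}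
    (he : HasLaw e (expMeasure p) μ) (hind : IndepFun (fun ω t => X t ω) e μ) :
    HasGeometricLaw μ (fun ω => runningSup X (e ω).toNNReal ω / (h : EReal))
      (Real.exp (-(laplaceInverse ν p * h))) := by
  have hh := hX.step_pos
  -- The exponential time is only almost everywhere measurable; a measurable version makes the
  -- counting events measurable.
  set e' := he.aemeasurable.mk e with he'
  have hee' : e =ᵐ[μ] e' := he.aemeasurable.ae_eq_mk
  have hem' : Measurable e' := he.aemeasurable.measurable_mk
  have hlaw' : HasLaw e' (expMeasure p) μ := he.congr hee'.symm
  have hind' : IndepFun (fun ω t => X t ω) e' μ := hind.congr EventuallyEq.rfl hee'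
  obtain ⟨q, N, hq, hqa, hN, hchar⟩ := exists_geometric_count
    (E := fun n => {ω | levelTime X h n ω ≤ ENNReal.ofReal (e' ω)})
    (fun n => measurableSet_le (hX.isStopping_levelTime hg n).measurable hem'.ennreal_ofReal)
    (fun n m hnm ω hω => (levelTime_mono hh hnm).trans hω) (Real.exp_pos _).le
    (Real.exp_lt_one_iff.2 (neg_neg_of_pos (mul_pos (hX.skipFreeJumps.laplaceInverse_pos hp) hh)))
    (hX.measure_levelTime_le_exponential hg hp hlaw' hind')
  refine hasGeometricLaw_of_count hq hqa hN ?_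
  filter_upwards [hchar, hee'] with ω hω hωe
  rw [hωe]
  refine iSup_div_eq (x := fun t => X t ω) (S := Iic (e' ω).toNNReal) hh (hg ω).lattice fun n => ?_
  rw [← hω n]
  exact (passageTime_le_iff (hg ω).rightCont).symm

lemma hasGeometricLaw_overallSup (hΦ : 0 < laplaceInverse ν 0) :
    HasGeometricLaw μ (fun ω => overallSup X ω / (h : EReal))
      (Real.exp (-(laplaceInverse ν 0 * h))) := by
  have hh := hX.step_pos
  obtain ⟨q, N, hq, hqa, hN, hchar⟩ := exists_geometric_count
    (E := fun n => {ω | levelTime X h n ω ≠ ⊤}) (hX.measurableSet_levelTime_ne_top hg)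
    (fun n m hnm ω hω => ne_top_of_le_ne_top hω (levelTime_mono hh hnm)) (Real.exp_pos _).le
    (Real.exp_lt_one_iff.2 (neg_neg_of_pos (mul_pos hΦ hh))) (hX.measure_levelTime_ne_top hg)
  refine hasGeometricLaw_of_count hq hqa hN ?_
  filter_upwards [hchar] with ω hω
  have h1 := iSup_div_eq (x := fun t => X t ω) (S := univ) (N := N ω) hh (hg ω).lattice fun n => ?_
  · simpa [overallSup] using h1
  · rw [← hω n]
    constructor
    · rintro ⟨s, -, hs⟩
      exact ne_top_of_le_ne_top ENNReal.coe_ne_top (passageTime_le_of_le hs)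
    · intro hne
      exact ⟨_, mem_univ _, (eq_at_levelTime (hg ω) hne).ge⟩

end IsSkipFreeLevyChain

end SkipFree

/-! ### Means from Laplace transforms, and centred random walks. -/

namespace SkipFree

variable {Ω : Type*} {mΩ : MeasurableSpace Ω} {μ : Measure Ω}

/-- A measure whose Laplace transform has right derivative `d` at `0` has mean `d`. -/
lemma integral_eq_of_tendsto_laplace {ρ : Measure ℝ} [IsProbabilityMeasure ρ] {d : ℝ}
    (hint : ∀ β, 0 ≤ β → Integrable (fun x => Real.exp (β * x)) ρ)
    (hd : Tendsto (fun β : ℝ => ((∫ x, Real.exp (β * x) ∂ρ) - 1) / β) (𝓝[>] 0) (𝓝 d)) :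
    Integrable (fun x => x) ρ ∧ ∫ x, x ∂ρ = d := by
  set b : ℕ → ℝ := fun n => 1 / ((n : ℝ) + 1)
  have hb0 : ∀ n, 0 < b n := fun n => Nat.one_div_pos_of_nat
  have hb1 : ∀ n, b n ≤ 1 := fun n => by
    simpa [b] using Nat.one_div_le_one_div (α := ℝ) (Nat.zero_le n)
  have hb : Tendsto b atTop (𝓝[>] 0) :=
    tendsto_nhdsWithin_iff.2 ⟨tendsto_one_div_add_atTop_nhds_zero_nat, .of_forall hb0⟩
  -- These difference quotients tend to x and, by convexity of exp and b n ≤ 1, lie between x and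
  -- e^x - 1.
  set q : ℕ → ℝ → ℝ := fun n x => (Real.exp (b n * x) - 1) / b n
  have hqint : ∀ n, Integrable (q n) ρ := fun n =>
    ((hint _ (hb0 n).le).sub (integrable_const 1)).div_const _
  have hqI : ∀ n, ∫ x, q n x ∂ρ = ((∫ x, Real.exp (b n * x) ∂ρ) - 1) / b n := fun n => by
    simp only [q]
    rw [integral_div, integral_sub (hint _ (hb0 n).le) (integrable_const 1)]
    simp
  have hqlim : ∀ x, Tendsto (fun n => q n x) atTop (𝓝 x) := fun x => by
    have h1 : HasDerivAt (fun β : ℝ => Real.exp (β * x)) x 0 := by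
      simpa using ((hasDerivAt_id (0 : ℝ)).mul_const x).exp
    have h2 := (hasDerivWithinAt_iff_tendsto_slope' self_notMem_Ioi).1
      (h1.hasDerivWithinAt (s := Ioi 0))
    refine (h2.comp hb).congr fun n => ?_
    simp [slope_def_field, q]
  have hlow : ∀ n x, x ≤ q n x := fun n x => by
    rw [le_div_iff₀ (hb0 n)]
    linarith [Real.add_one_le_exp (b n * x)]
  have hup : ∀ n x, q n x ≤ Real.exp x - 1 := fun n x => by
    rw [div_le_iff₀ (hb0 n)]
    have := convexOn_exp.2 (mem_univ x) (mem_univ 0) (hb0 n).le (sub_nonneg.2 (hb1 n)) (by ring)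
    simp only [smul_eq_mul, mul_zero, add_zero, Real.exp_zero] at this
    linarith
  have he : Integrable Real.exp ρ := by simpa using hint 1 zero_le_one
  have hI : Tendsto (fun n => ∫ x, q n x ∂ρ) atTop (𝓝 d) := by
    simp only [hqI]
    exact hd.comp hb
  have he' : Integrable (fun x => Real.exp x - 1) ρ := he.sub (integrable_const 1)
  have hdiff : ∀ n, Integrable (fun x => Real.exp x - 1 - q n x) ρ := fun n =>
    he'.sub (hqint n)
  -- Integrability of x is not given. The nonnegative gaps e^x - 1 - q n x have convergent
  -- integrals, so Fatou makes their limit e^x - 1 - x integrable, and hence x.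
  have hlim2 : Tendsto (fun n => ∫⁻ x, ‖Real.exp x - 1 - q n x‖ₑ ∂ρ) atTop
      (𝓝 (ENNReal.ofReal ((∫ x, (Real.exp x - 1) ∂ρ) - d))) := by
    have h1 : ∀ n, ∫⁻ x, ‖Real.exp x - 1 - q n x‖ₑ ∂ρ =
        ENNReal.ofReal ((∫ x, (Real.exp x - 1) ∂ρ) - ∫ x, q n x ∂ρ) := fun n => by
      rw [← integral_sub he' (hqint n),
        ofReal_integral_eq_lintegral_ofReal (hdiff n)
          (.of_forall fun x => sub_nonneg.2 (hup n x))]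
      exact lintegral_congr fun x => Real.enorm_of_nonneg (sub_nonneg.2 (hup n x))
    simp only [h1]
    exact (ENNReal.continuous_ofReal.tendsto _).comp (hI.const_sub _)
  have hlimit : Integrable (fun x => Real.exp x - 1 - x) ρ :=
    integrable_of_tendsto (.of_forall fun x => (hqlim x).const_sub _)
      (fun n => (hdiff n).aestronglyMeasurable) (by rw [hlim2.liminf_eq]; exact ENNReal.ofReal_ne_top)
  have hid : Integrable (fun x : ℝ => x) ρ := by
    refine (he'.sub hlimit).congr (.of_forall fun x => ?_)
    simp
  refine ⟨hid, tendsto_nhds_unique (tendsto_integral_of_dominated_convergence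
    (fun x => |x| + |Real.exp x - 1|) (fun n => (hqint n).aestronglyMeasurable)
    (hid.abs.add he'.abs) (fun n => .of_forall fun x => ?_)
    (.of_forall hqlim)) hI⟩
  rw [Real.norm_eq_abs, abs_le]
  constructor
  · linarith [hlow n x, neg_abs_le x, abs_nonneg (Real.exp x - 1)]
  · linarith [hup n x, le_abs_self (Real.exp x - 1), abs_nonneg x]

/-- A stationary solution of the Lindley recursion `f = max 0 (f' - ξ)` driven by a centred,
nondegenerate variable `ξ` is infinite. -/
lemma eq_top_of_lindley [IsProbabilityMeasure μ] {f f' : Ω → ℝ≥0∞} {ξ : Ω → ℝ}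
    (hf : Measurable f) (hf' : Measurable f') (hξ : Measurable ξ) (hint : Integrable ξ μ)
    (hmean : ∫ ω, ξ ω ∂μ = 0) (hnd : ¬ ξ =ᵐ[μ] 0) (hind : IndepFun ξ f' μ)
    (hid : IdentDistrib f' f μ μ) (htop : ∀ ω, f ω = ⊤ ↔ f' ω = ⊤)
    (hrec : ∀ ω, f ω ≠ ⊤ → (f ω).toReal = max 0 ((f' ω).toReal - ξ ω)) :
    ∀ᵐ ω ∂μ, f ω = ⊤ := by
  set A : Set Ω := {ω | f ω ≠ ⊤} with hA
  have hAm : MeasurableSet A := (hf (measurableSet_singleton ⊤)).compl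
  have hA' : A = f' ⁻¹' {⊤}ᶜ := by
    ext ω
    simp [hA, htop]
  -- `A` is an event of `f'`, which is independent of the centred `ξ`.
  have hξA : ∫ ω in A, ξ ω ∂μ = 0 := by
    have h1 : IndepFun ξ (fun ω => ({⊤}ᶜ : Set ℝ≥0∞).indicator (fun _ => (1 : ℝ)) (f' ω)) μ :=
      hind.comp measurable_id
        (measurable_const.indicator (measurableSet_singleton (⊤ : ℝ≥0∞)).compl)
    have h2 := h1.integral_fun_mul_eq_mul_integral hξ.aestronglyMeasurable
      ((measurable_const.indicator (measurableSet_singleton (⊤ : ℝ≥0∞)).compl).comp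
        hf').aestronglyMeasurable
    rw [hmean, zero_mul] at h2
    rw [← integral_indicator hAm, ← h2]
    refine integral_congr_ae (.of_forall fun ω => ?_)
    by_cases hω : f' ω = ⊤ <;> simp [hA', hω]
  -- `f` may have no mean, so the equality in law of `f` and `f'` is used through truncations.
  -- Truncation is 1-Lipschitz and |f' - f| ≤ |ξ| on `A`, so dominated convergence removes it.
  set u : ℕ → ℝ≥0∞ → ℝ := fun K x => min x.toReal K with hu
  have hum : ∀ K, Measurable (u K) := fun K => ENNReal.measurable_toReal.min measurable_const
  have hub : ∀ K x, ‖u K x‖ ≤ K := fun K x => by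
    have : 0 ≤ u K x := le_min ENNReal.toReal_nonneg (Nat.cast_nonneg K)
    rw [Real.norm_of_nonneg this]
    exact min_le_right _ _
  have huint : ∀ K (g : Ω → ℝ≥0∞), Measurable g → Integrable (fun ω => u K (g ω)) μ :=
    fun K g hg => .of_bound ((hum K).comp hg).aestronglyMeasurable K (.of_forall fun ω => hub K _)
  have hueq : ∀ K, ∫ ω in A, u K (f' ω) ∂μ = ∫ ω in A, u K (f ω) ∂μ := fun K => by
    have hv : Measurable (({⊤}ᶜ : Set ℝ≥0∞).indicator (u K)) :=
      (hum K).indicator (measurableSet_singleton (⊤ : ℝ≥0∞)).compl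
    have h1 := (hid.comp hv).integral_eq
    rw [← integral_indicator hAm, ← integral_indicator hAm]
    refine Eq.trans (integral_congr_ae (.of_forall fun ω => ?_))
      (h1.trans (integral_congr_ae (.of_forall fun ω => ?_)))
    · by_cases hω : f' ω = ⊤ <;> simp [hA', hω]
    · by_cases hω : f ω = ⊤ <;> simp [hA, hω]
  set D : ℕ → Ω → ℝ := fun K ω => ξ ω - (u K (f' ω) - u K (f ω))
  have hDint : ∀ K, Integrable (D K) (μ.restrict A) := fun K =>
    (hint.sub ((huint K f' hf').sub (huint K f hf))).restrict
  have hD0 : ∀ K, ∫ ω in A, D K ω ∂μ = 0 := fun K => by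
    simp only [D]
    have h1 : Integrable (fun ω => u K (f' ω) - u K (f ω)) μ :=
      (huint K f' hf').sub (huint K f hf)
    rw [integral_sub hint.restrict h1.restrict, integral_sub (huint K f' hf').restrict (huint K f hf).restrict, hueq, hξA]
    simp
  have hbound : ∀ K ω, ω ∈ A → ‖D K ω‖ ≤ |ξ ω| + |ξ ω| := fun K ω hω => by
    have h1 : |u K (f' ω) - u K (f ω)| ≤ |ξ ω| := by
      refine (abs_min_sub_min_le_max _ _ _ _).trans ?_
      rw [sub_self, abs_zero, max_eq_left (abs_nonneg _), hrec ω hω]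
      have h0 : 0 ≤ (f' ω).toReal := ENNReal.toReal_nonneg
      rcases max_cases 0 ((f' ω).toReal - ξ ω) with h | h <;> rw [h.1, abs_le] <;>
        constructor <;> linarith [le_abs_self (ξ ω), neg_abs_le (ξ ω)]
    exact (abs_sub _ _).trans (add_le_add le_rfl h1)
  set D' : Ω → ℝ := fun ω => ξ ω - ((f' ω).toReal - (f ω).toReal) with hD'
  have hlim : Tendsto (fun K => ∫ ω in A, D K ω ∂μ) atTop (𝓝 (∫ ω in A, D' ω ∂μ)) := by
    refine tendsto_integral_of_dominated_convergence (fun ω => |ξ ω| + |ξ ω|)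
      (fun K => (hDint K).aestronglyMeasurable) (hint.abs.add hint.abs).restrict
      (fun K => (ae_restrict_iff' hAm).2 (.of_forall fun ω hω => hbound K ω hω))
      (.of_forall fun ω => ?_)
    have h1 : ∀ x : ℝ≥0∞, Tendsto (fun K => u K x) atTop (𝓝 x.toReal) := fun x => by
      refine tendsto_const_nhds.congr' ?_
      filter_upwards [eventually_ge_atTop ⌈x.toReal⌉₊] with K hK
      exact (min_eq_left ((Nat.le_ceil _).trans (by exact_mod_cast hK))).symm
    exact ((h1 _).sub (h1 _)).const_sub _
  have hD'0 : ∫ ω in A, D' ω ∂μ = 0 :=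
    tendsto_nhds_unique hlim (by simp only [hD0]; exact tendsto_const_nhds)
  have hD'nn : ∀ ω ∈ A, 0 ≤ D' ω := fun ω hω => by
    simp only [hD', hrec ω hω]
    linarith [le_max_right 0 ((f' ω).toReal - ξ ω)]
  have hD'b : ∀ ω ∈ A, ‖D' ω‖ ≤ |ξ ω| + |ξ ω| := fun ω hω => by
    have h1 : ∀ x : ℝ≥0∞, u ⌈x.toReal⌉₊ x = x.toReal := fun x => min_eq_left (Nat.le_ceil _)
    have h2 : |(f' ω).toReal - (f ω).toReal| ≤ |ξ ω| := by
      rw [hrec ω hω]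
      have h0 : 0 ≤ (f' ω).toReal := ENNReal.toReal_nonneg
      rcases max_cases 0 ((f' ω).toReal - ξ ω) with h | h <;> rw [h.1, abs_le] <;>
        constructor <;> linarith [le_abs_self (ξ ω), neg_abs_le (ξ ω)]
    exact (abs_sub _ _).trans (add_le_add le_rfl h2)
  have hD'm : Measurable D' := hξ.sub (hf'.ennreal_toReal.sub hf.ennreal_toReal)
  have hD'int : Integrable D' (μ.restrict A) :=
    (hint.abs.add hint.abs).restrict.mono' hD'm.aestronglyMeasurable
      ((ae_restrict_iff' hAm).2 (.of_forall hD'b))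
  -- `D'` is nonnegative on `A` with zero integral, so the maximum in the recursion is almost never
  -- attained by a strictly larger 0.
  have hzero : ∀ᵐ ω ∂μ, ω ∈ A → (f' ω).toReal = (f ω).toReal + ξ ω := by
    have h1 := (integral_eq_zero_iff_of_nonneg_ae ((ae_restrict_iff' hAm).2
      (.of_forall fun ω hω => hD'nn ω hω)) hD'int).1 hD'0
    filter_upwards [(ae_restrict_iff' hAm).1 h1] with ω hω hωA
    have := hω hωA
    simp only [hD', Pi.zero_apply] at this
    linarith
  obtain ⟨δ, hδ, hδpos⟩ : ∃ δ : ℝ, 0 < δ ∧ μ {ω | δ ≤ ξ ω} ≠ 0 := by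
    by_contra! hno
    have h1 : ∀ᵐ ω ∂μ, ∀ n : ℕ, ξ ω < 1 / ((n : ℝ) + 1) := by
      refine ae_all_iff.2 fun n => ?_
      have := hno (1 / ((n : ℝ) + 1)) Nat.one_div_pos_of_nat
      rw [ae_iff]
      simpa only [not_lt] using this
    have h2 : ∀ᵐ ω ∂μ, 0 ≤ -ξ ω := by
      filter_upwards [h1] with ω hω
      exact neg_nonneg.2 (ge_of_tendsto' tendsto_one_div_add_atTop_nhds_zero_nat
        fun n => (hω n).le)
    have h3 := (integral_eq_zero_iff_of_nonneg_ae h2 hint.neg).1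
      (by simp [integral_neg, hmean])
    refine hnd ?_
    filter_upwards [h3] with ω hω
    simpa using hω
  -- If f ≥ kδ almost surely, then f' = f + ξ ≥ (k+1)δ wherever ξ ≥ δ and f' is finite. As {ξ ≥ δ}
  -- has positive probability and is independent of f', the bound f' ≥ (k+1)δ holds almost surely,
  -- and f has the same law.
  have hstep : ∀ k : ℕ, μ {ω | f ω < ENNReal.ofReal (k * δ)} = 0 := by
    intro k
    induction k with
    | zero => simp
    | succ k ih =>
      have h1 : ∀ᵐ ω ∂μ, ¬ (δ ≤ ξ ω ∧ f' ω < ENNReal.ofReal ((k + 1 : ℕ) * δ)) := by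
        have ih' : ∀ᵐ ω ∂μ, ENNReal.ofReal (k * δ) ≤ f ω := by
          rw [ae_iff]
          simpa only [not_le] using ih
        filter_upwards [ih', hzero] with ω h2 h3 ⟨h4, h5⟩
        have h6 : f' ω ≠ ⊤ := h5.ne_top
        have h7 : f ω ≠ ⊤ := fun h => h6 ((htop ω).1 h)
        have h8 := (ENNReal.ofReal_le_iff_le_toReal h7).1 h2
        have h9 := (ENNReal.lt_ofReal_iff_toReal_lt h6).1 h5
        rw [h3 h7] at h9
        push_cast at h9
        linarith
      have h2 : μ (ξ ⁻¹' Ici δ ∩ f' ⁻¹' Iio (ENNReal.ofReal ((k + 1 : ℕ) * δ))) = 0 := by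
        rw [ae_iff] at h1
        simp only [not_not] at h1
        exact h1
      rw [hind.measure_inter_preimage_eq_mul _ _ measurableSet_Ici measurableSet_Iio,
        mul_eq_zero] at h2
      have h3 := h2.resolve_left hδpos
      rwa [hid.measure_mem_eq measurableSet_Iio] at h3
  have hall : ∀ᵐ ω ∂μ, ∀ k : ℕ, ENNReal.ofReal (k * δ) ≤ f ω := by
    refine ae_all_iff.2 fun k => ?_
    rw [ae_iff]
    simpa only [not_le] using hstep k
  filter_upwards [hall] with ω hω
  by_contra hne
  obtain ⟨k, hk⟩ := exists_nat_gt ((f ω).toReal / δ)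
  have := (ENNReal.ofReal_le_iff_le_toReal hne).1 (hω k)
  rw [div_lt_iff₀ hδ] at hk
  linarith

/-- A centred nondegenerate random walk is unbounded below. -/
lemma ae_not_bddBelow_sum [IsProbabilityMeasure μ] {ξ : ℕ → Ω → ℝ} (hm : ∀ i, Measurable (ξ i))
    (hind : iIndepFun ξ μ) (hid : ∀ i, IdentDistrib (ξ i) (ξ 0) μ μ) (hint : Integrable (ξ 0) μ)
    (hmean : ∫ ω, ξ 0 ω ∂μ = 0) (hnd : ¬ ξ 0 =ᵐ[μ] 0) :
    ∀ᵐ ω ∂μ, ¬ BddBelow (range fun n => ∑ i ∈ Finset.range n, ξ i ω) := by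
  -- The depth of the walk below its start. Removing the first step gives a copy with the same law,
  -- independent of that step, and the two depths satisfy the Lindley recursion; infinite depth is
  -- the claim.
  set φ : (ℕ → ℝ) → ℝ≥0∞ := fun x => ⨆ n, ENNReal.ofReal (-∑ i ∈ Finset.range n, x i) with hφ
  have hφm : Measurable φ := Measurable.iSup fun n => Measurable.ennreal_ofReal
    (Finset.measurable_sum _ fun i _ => measurable_pi_apply i).neg
  have hmξ : Measurable fun ω i => ξ i ω := measurable_pi_iff.2 hm
  have hmξ' : Measurable fun ω i => ξ (i + 1) ω := measurable_pi_iff.2 fun i => hm _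
  have hlaw : IdentDistrib (fun ω i => ξ (i + 1) ω) (fun ω i => ξ i ω) μ μ := by
    refine ⟨hmξ'.aemeasurable, hmξ.aemeasurable, ?_⟩
    rw [(hind.precomp (add_left_injective 1)).map_fun_eq_infinitePi_map (fun i => hm _),
      hind.map_fun_eq_infinitePi_map hm]
    congr 1
    ext1 i
    rw [(hid (i + 1)).map_eq, (hid i).map_eq]
  have hind0 : IndepFun (ξ 0) (fun ω i => ξ (i + 1) ω) μ := by
    have h1 := indep_iSup_of_disjoint (fun i => (hm i).comap_le) hind
      (S := {0}) (T := Ioi 0) (by simp)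
    rw [IndepFun_iff_Indep]
    refine indep_of_indep_of_le_left (indep_of_indep_of_le_right h1 ?_) (by simp)
    rw [← measurable_iff_comap_le]
    refine @measurable_pi_iff _ _ _ (_) _ _ |>.2 fun i => ?_
    exact (comap_measurable (ξ (i + 1))).mono
      (le_iSup₂ (f := fun i (_ : i ∈ Ioi 0) => MeasurableSpace.comap (ξ i) inferInstance)
        (i + 1) (Nat.succ_pos i)) le_rfl
  have hsum : ∀ ω n, ∑ i ∈ Finset.range (n + 1), ξ i ω =
      ∑ i ∈ Finset.range n, ξ (i + 1) ω + ξ 0 ω := fun ω n => Finset.sum_range_succ' _ _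
  have hle1 : ∀ ω, φ (fun i => ξ (i + 1) ω) ≤ φ (fun i => ξ i ω) + ENNReal.ofReal (ξ 0 ω) := by
    refine fun ω => iSup_le fun n => ?_
    have h1 : -∑ i ∈ Finset.range n, ξ (i + 1) ω =
        -∑ i ∈ Finset.range (n + 1), ξ i ω + ξ 0 ω := by
      rw [hsum]
      ring
    rw [h1]
    exact ENNReal.ofReal_add_le.trans (add_le_add (le_iSup
      (fun n => ENNReal.ofReal (-∑ i ∈ Finset.range n, ξ i ω)) (n + 1)) le_rfl)
  have hle2 : ∀ ω, φ (fun i => ξ i ω) ≤ φ (fun i => ξ (i + 1) ω) + ENNReal.ofReal (-ξ 0 ω) := by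
    refine fun ω => iSup_le fun n => ?_
    rcases n with _ | n
    · simp
    · have h1 : -∑ i ∈ Finset.range (n + 1), ξ i ω =
          -∑ i ∈ Finset.range n, ξ (i + 1) ω + -ξ 0 ω := by
        rw [hsum]
        ring
      rw [h1]
      exact ENNReal.ofReal_add_le.trans (add_le_add (le_iSup
        (fun n => ENNReal.ofReal (-∑ i ∈ Finset.range n, ξ (i + 1) ω)) n) le_rfl)
  have htop : ∀ ω, φ (fun i => ξ i ω) = ⊤ ↔ φ (fun i => ξ (i + 1) ω) = ⊤ := by
    refine fun ω => ⟨fun h => ?_, fun h => ?_⟩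
    · have := hle2 ω
      rw [h, top_le_iff, ENNReal.add_eq_top] at this
      exact this.resolve_right ENNReal.ofReal_ne_top
    · have := hle1 ω
      rw [h, top_le_iff, ENNReal.add_eq_top] at this
      exact this.resolve_right ENNReal.ofReal_ne_top
  have hle : ∀ {x : ℕ → ℝ}, φ x ≠ ⊤ → ∀ n, -∑ i ∈ Finset.range n, x i ≤ (φ x).toReal := by
    intro x hx n
    exact (ENNReal.ofReal_le_ofReal_iff ENNReal.toReal_nonneg).1
      ((le_iSup (fun n => ENNReal.ofReal (-∑ i ∈ Finset.range n, x i)) n).trans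
        (ENNReal.ofReal_toReal hx).ge)
  have hge : ∀ {x : ℕ → ℝ} {c : ℝ}, 0 ≤ c → (∀ n, -∑ i ∈ Finset.range n, x i ≤ c) →
      (φ x).toReal ≤ c := fun {x c} hc h =>
    ENNReal.toReal_le_of_le_ofReal hc (iSup_le fun n => ENNReal.ofReal_le_ofReal (h n))
  have hrec : ∀ ω, φ (fun i => ξ i ω) ≠ ⊤ → (φ (fun i => ξ i ω)).toReal =
      max 0 ((φ (fun i => ξ (i + 1) ω)).toReal - ξ 0 ω) := by
    intro ω h
    have h' := mt (htop ω).2 h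
    refine le_antisymm (hge (le_max_left _ _) fun n => ?_)
      (max_le ENNReal.toReal_nonneg (sub_le_iff_le_add.2 (hge ?_ fun n => ?_)))
    · rcases n with _ | n
      · simp
      · rw [hsum]
        exact le_max_of_le_right (by linarith [hle h' n])
    · have := hle h 1
      simp only [Finset.range_one, Finset.sum_singleton] at this
      linarith
    · have := hle h (n + 1)
      rw [hsum] at this
      linarith
  have key := eq_top_of_lindley (f := fun ω => φ fun i => ξ i ω)
    (f' := fun ω => φ fun i => ξ (i + 1) ω) (hφm.comp hmξ) (hφm.comp hmξ') (hm 0) hint hmean hnd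
    (hind0.comp measurable_id hφm) (hlaw.comp hφm) htop hrec
  filter_upwards [key] with ω hω ⟨c, hc⟩
  refine absurd hω (ne_top_of_le_ne_top (ENNReal.ofReal_ne_top (r := -c)) (iSup_le fun n => ?_))
  exact ENNReal.ofReal_le_ofReal (neg_le_neg (hc (mem_range_self n)))

end SkipFree

/-! ### The random walk at integer times. -/

namespace SkipFree

variable {Ω : Type*} {mΩ : MeasurableSpace Ω} {μ : Measure Ω} {ℱ : Filtration ℝ≥0 mΩ}
  {X : ℝ≥0 → Ω → ℝ} {ν : Measure ℝ} {h : ℝ}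

namespace IsSkipFreeLevyChain

section Discrete

variable [IsProbabilityMeasure μ] (hX : IsSkipFreeLevyChain μ ℱ X ν h)
include hX

/-- Peel off the largest index `a`: all earlier increments are known at time `a`. -/
lemma iIndepFun_increment : iIndepFun (fun (i : ℕ) ω => X (i + 1) ω - X i ω) μ := by
  have hL := hX.compoundPoisson.levy
  rw [iIndepFun_iff_measure_inter_preimage_eq_mul]
  intro S
  induction S using Finset.induction_on_max with
  | empty => simp
  | insert a s has ih =>
    intro B hB
    have hmem : ∀ i ∈ s, MeasurableSet (B i) := fun i hi => hB i (Finset.mem_insert_of_mem hi)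
    have ha : a ∉ s := fun h => lt_irrefl _ (has a h)
    rw [Finset.prod_insert ha, ← ih hmem, Finset.set_biInter_insert, inter_comm, mul_comm]
    refine (Indep_iff _ _ μ).1 (hL.indep_increments a (a + 1) (by simp)) _ _ ?_
      ⟨B a, hB a (Finset.mem_insert_self a s), rfl⟩
    refine Finset.measurableSet_biInter s fun i hi => ?_
    have hia : (i : ℝ≥0) + 1 ≤ a := by exact_mod_cast has i hi
    have hm : ∀ t : ℝ≥0, t ≤ a → Measurable[ℱ a] (X t) := fun t ht =>
      (hL.adapted t).mono (ℱ.mono ht) le_rfl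
    exact ((hm _ hia).sub (hm _ ((le_add_of_nonneg_right zero_le_one).trans hia))) (hmem i hi)

omit [IsProbabilityMeasure μ] in
lemma identDistrib_increment (i : ℕ) :
    IdentDistrib (fun ω => X (i + 1) ω - X i ω) (X 1) μ μ := by
  simpa using hX.compoundPoisson.levy.stationary_increments (i : ℝ≥0) (i + 1) (by simp)

lemma integral_exp_one {β : ℝ} (hβ : 0 ≤ β) :
    Integrable (fun ω => Real.exp (β * X 1 ω)) μ ∧
      ∫ ω, Real.exp (β * X 1 ω) ∂μ = Real.exp (laplaceExponent ν β) := by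
  have hm : Measurable fun ω => Real.exp (β * X 1 ω) :=
    ((hX.compoundPoisson.levy.measurable 1).const_mul β).exp
  have h1 : ∫⁻ ω, ENNReal.ofReal (Real.exp (β * X 1 ω)) ∂μ =
      ENNReal.ofReal (Real.exp (laplaceExponent ν β)) := by
    have h2 := hX.lintegral_exp_increment (zero_le_one (α := ℝ≥0)) hβ
    rw [NNReal.coe_one, NNReal.coe_zero, sub_zero, one_mul] at h2
    rw [← h2]
    refine lintegral_congr_ae ?_
    filter_upwards [hX.compoundPoisson.levy.start] with ω hω
    rw [hω, sub_zero]
  refine ⟨⟨hm.aestronglyMeasurable, ?_⟩, ?_⟩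
  · rw [hasFiniteIntegral_iff_ofReal (.of_forall fun ω => (Real.exp_pos _).le), h1]
    exact ENNReal.ofReal_lt_top
  · rw [integral_eq_lintegral_of_nonneg_ae (.of_forall fun ω => (Real.exp_pos _).le)
      hm.aestronglyMeasurable, h1, ENNReal.toReal_ofReal (Real.exp_pos _).le]

/-- Otherwise e^{ψ(β)} = 1 for all β ≥ 0, against ψ(β) → ∞. -/
lemma not_ae_eq_zero : ¬ X 1 =ᵐ[μ] 0 := by
  intro h0
  obtain ⟨β, hβ, hpos⟩ := ((eventually_ge_atTop 0).and
    (hX.skipFreeJumps.tendsto_laplaceExponent.eventually_gt_atTop 0)).exists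
  have h1 : ∫ ω, Real.exp (β * X 1 ω) ∂μ = 1 := by
    rw [integral_congr_ae (g := fun _ => 1)]
    · simp
    · filter_upwards [h0] with ω hω
      simp [hω]
  rw [(hX.integral_exp_one hβ).2, Real.exp_eq_one_iff] at h1
  exact hpos.ne' h1

/-- The mean of `X_1` is the right derivative of `ψ` at `0`. -/
lemma integral_one {d : ℝ} (hd : Tendsto (fun β : ℝ =>
    (laplaceExponent ν β - laplaceExponent ν 0) / β) (𝓝[>] 0) (𝓝 d)) :
    Integrable (X 1) μ ∧ ∫ ω, X 1 ω ∂μ = d := by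
  have hm := hX.compoundPoisson.levy.measurable 1
  have := Measure.isProbabilityMeasure_map (μ := μ) hm.aemeasurable
  have he : ∀ β : ℝ, Measurable fun x : ℝ => Real.exp (β * x) := fun β => by fun_prop
  have h1 := integral_eq_of_tendsto_laplace (ρ := μ.map (X 1)) (d := d) (fun β hβ => by
    rw [integrable_map_measure (he β).aestronglyMeasurable hm.aemeasurable]
    exact (hX.integral_exp_one hβ).1) (by
    have h2 : HasDerivWithinAt (laplaceExponent ν) d (Ioi 0) 0 := by
      rw [hasDerivWithinAt_iff_tendsto_slope' self_notMem_Ioi]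
      refine hd.congr fun β => ?_
      simp [slope_def_field]
    -- The moment generating function of X_1 is e^{ψ}, which has the same right derivative at 0 as ψ
    -- because ψ(0) = 0.
    have h3 := (hasDerivWithinAt_iff_tendsto_slope' self_notMem_Ioi).1 h2.exp
    rw [SkipFreeJumps.laplaceExponent_zero, Real.exp_zero, one_mul] at h3
    refine h3.congr' ?_
    filter_upwards [self_mem_nhdsWithin] with β hβ
    rw [integral_map hm.aemeasurable (he β).aestronglyMeasurable,
      (hX.integral_exp_one (le_of_lt hβ)).2]
    simp [slope_def_field, SkipFreeJumps.laplaceExponent_zero])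
  rw [integral_map hm.aemeasurable (f := fun x => x) measurable_id.aestronglyMeasurable] at h1
  exact ⟨(integrable_map_measure measurable_id.aestronglyMeasurable hm.aemeasurable).1 h1.1, h1.2⟩

end Discrete

end IsSkipFreeLevyChain
end SkipFree

/-! ### Long-term behaviour. -/

namespace SkipFree

variable {Ω : Type*} {mΩ : MeasurableSpace Ω} {μ : Measure Ω} {ℱ : Filtration ℝ≥0 mΩ}
  {X : ℝ≥0 → Ω → ℝ} {ν : Measure ℝ} {h : ℝ}

namespace IsSkipFreeLevyChain

section LongTerm

variable [IsProbabilityMeasure μ] (hX : IsSkipFreeLevyChain μ ℱ X ν h)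
include hX

/-- After a visit to `C` at a grid time, the process rests there up to the next integer time with
probability at least `e^{-ν(ℝ)}`. -/
lemma measure_iUnion_grid_le {C : Set ℝ} (hC : MeasurableSet C) (n m : ℕ) :
    ENNReal.ofReal (Real.exp (-ν.real univ)) *
      μ (⋃ i : ℕ, {ω | (n : ℝ≥0) ≤ i / 2 ^ m ∧ X (i / 2 ^ m) ω ∈ C}) ≤
      μ {ω | ∃ j : ℕ, n ≤ j ∧ X j ω ∈ C} := by
  have hL := hX.compoundPoisson.levy
  set τ : ℕ → ℝ≥0 := fun i => i / 2 ^ m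
  have hτ : Monotone τ := fun i j hij => by
    simp only [τ]
    gcongr
  set f : ℕ → Set Ω := fun i => {ω | (n : ℝ≥0) ≤ τ i ∧ X (τ i) ω ∈ C} with hf
  have hfm : ∀ i j, j ≤ i → MeasurableSet[ℱ (τ i)] (f j) := fun i j hij => by
    have h1 := ((hL.adapted (τ j)).mono (ℱ.mono (hτ hij)) le_rfl) hC
    exact (MeasurableSet.const _).inter h1
  -- The disjointed events decompose by the first grid visit, each decided at the time of that
  -- visit.
  have hAm : ∀ i, MeasurableSet[ℱ (τ i)] (disjointed f i) := fun i => by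
    rw [disjointed_eq_inter_compl]
    exact (hfm i i le_rfl).inter
      (MeasurableSet.iInter fun j => MeasurableSet.iInter fun hj => (hfm i j hj.le).compl)
  -- No net change until the next integer, a span below 1: this is independent of the past and has
  -- probability at least e^{-ν(ℝ)}.
  set Z : ℕ → Set Ω := fun i => {ω | X ⌈τ i⌉₊ ω - X (τ i) ω = 0} with hZ
  have hZm : ∀ i, MeasurableSet (Z i) := fun i =>
    ((hL.measurable _).sub (hL.measurable _)) (measurableSet_singleton 0)
  have hAZ : ∀ i, ENNReal.ofReal (Real.exp (-ν.real univ)) * μ (disjointed f i) ≤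
      μ (disjointed f i ∩ Z i) := fun i => by
    have hle : τ i ≤ (⌈τ i⌉₊ : ℝ≥0) := Nat.le_ceil _
    rw [(Indep_iff _ _ μ).1 (hL.indep_increments (τ i) ⌈τ i⌉₊ hle) _ (Z i) (hAm i)
      ⟨{0}, measurableSet_singleton 0, rfl⟩, mul_comm]
    refine mul_le_mul_right ?_ _
    refine le_trans (ENNReal.ofReal_le_ofReal (Real.exp_le_exp.2 ?_))
      (hX.le_measure_increment_eq_zero hle)
    have h1 : ((⌈τ i⌉₊ : ℝ≥0) : ℝ) < τ i + 1 := by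
      exact_mod_cast Nat.ceil_lt_add_one (zero_le (a := τ i))
    nlinarith [measureReal_nonneg (μ := ν) (s := univ)]
  have hsub : (⋃ i, disjointed f i ∩ Z i) ⊆ {ω | ∃ j : ℕ, n ≤ j ∧ X j ω ∈ C} := by
    refine iUnion_subset fun i ω hω => ?_
    obtain ⟨h1, h2⟩ := disjointed_subset f i hω.1
    have h3 : X ⌈τ i⌉₊ ω = X (τ i) ω := sub_eq_zero.1 hω.2
    exact ⟨⌈τ i⌉₊, by exact_mod_cast h1.trans (Nat.le_ceil _), h3 ▸ h2⟩
  refine le_trans ?_ (measure_mono hsub)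
  rw [← iUnion_disjointed, measure_iUnion (disjoint_disjointed f) fun i => ℱ.le _ _ (hAm i),
    measure_iUnion (fun i j hij => (disjoint_disjointed f hij).mono inter_subset_left
      inter_subset_left) fun i => (ℱ.le _ _ (hAm i)).inter (hZm i), ← ENNReal.tsum_mul_left]
  exact ENNReal.tsum_le_tsum hAZ

variable (hg : ∀ ω, GoodPath h (fun t => X t ω))
include hg

/-- Dyadic grids increase, and since paths are locally constant to the right any visit is seen on a
fine enough grid; continuity from below finishes. -/
lemma measure_exists_ge_le {C : Set ℝ} (hC : MeasurableSet C) (n : ℕ) :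
    ENNReal.ofReal (Real.exp (-ν.real univ)) * μ {ω | ∃ t : ℝ≥0, n ≤ t ∧ X t ω ∈ C} ≤
      μ {ω | ∃ j : ℕ, n ≤ j ∧ X j ω ∈ C} := by
  set E : ℕ → Set Ω := fun m => ⋃ i : ℕ, {ω | (n : ℝ≥0) ≤ i / 2 ^ m ∧ X (i / 2 ^ m) ω ∈ C}
  have hE : Monotone E := monotone_nat_of_le_succ fun m => by
    refine iUnion_subset fun i ω hω => mem_iUnion.2 ⟨2 * i, ?_⟩
    have h1 : ((2 * i : ℕ) : ℝ≥0) / 2 ^ (m + 1) = i / 2 ^ m := by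
      push_cast
      rw [pow_succ', mul_div_mul_left _ _ two_ne_zero]
    rwa [mem_ofPred_eq, h1]
  have hsub : {ω | ∃ t : ℝ≥0, n ≤ t ∧ X t ω ∈ C} ⊆ ⋃ m, E m := by
    rintro ω ⟨t, hnt, ht⟩
    obtain ⟨m, hm⟩ := ((tendsto_gridCeil t).eventually
      ((hg ω).eventually_eq hX.step_pos t)).exists
    refine mem_iUnion.2 ⟨m, mem_iUnion.2 ⟨⌈t * 2 ^ m⌉₊, hnt.trans (le_gridCeil m t), ?_⟩⟩
    exact hm ▸ ht
  refine (mul_le_mul_right (measure_mono hsub) _).trans ?_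
  rw [hE.measure_iUnion, ENNReal.mul_iSup]
  exact iSup_le fun m => hX.measure_iUnion_grid_le hC n m

/-- A set that is eventually avoided along integer times is eventually avoided. -/
lemma ae_eventually_notMem {C : Set ℝ} (hC : MeasurableSet C)
    (hev : ∀ᵐ ω ∂μ, ∀ᶠ j : ℕ in atTop, X j ω ∉ C) :
    ∀ᵐ ω ∂μ, ∀ᶠ t in atTop, X t ω ∉ C := by
  have hL := hX.compoundPoisson.levy
  set c := ENNReal.ofReal (Real.exp (-ν.real univ))
  set F : ℕ → Set Ω := fun n => {ω | ∃ j : ℕ, n ≤ j ∧ X j ω ∈ C} with hF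
  have hFm : ∀ n, MeasurableSet (F n) := fun n => by
    have h1 : F n = ⋃ j : ℕ, ⋃ _ : n ≤ j, X j ⁻¹' C := by
      ext ω
      simp [hF]
    rw [h1]
    exact .iUnion fun j => .iUnion fun _ => hL.measurable j hC
  have hFa : Antitone F := fun n m hnm ω ⟨j, hj, hjC⟩ => ⟨j, hnm.trans hj, hjC⟩
  have hF0 : μ (⋂ n, F n) = 0 := by
    refine measure_mono_null (fun ω hω => ?_) (ae_iff.1 hev)
    rw [mem_ofPred_eq, eventually_atTop]
    rintro ⟨n, hn⟩
    obtain ⟨j, hj, hjC⟩ := mem_iInter.1 hω n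
    exact hn j hj hjC
  have hlim := tendsto_measure_iInter_atTop (μ := μ) (fun n => (hFm n).nullMeasurableSet) hFa
    ⟨0, measure_ne_top _ _⟩
  rw [hF0] at hlim
  -- The right side tends to 0, so visits at arbitrarily late real times have probability zero.
  have hle : ∀ n, c * μ {ω | ∃ᶠ t in atTop, X t ω ∈ C} ≤ μ (F n) := fun n => by
    refine le_trans (mul_le_mul_right (measure_mono fun ω hω => ?_) _)
      (hX.measure_exists_ge_le hg hC n)
    obtain ⟨t, ht, htC⟩ := frequently_atTop.1 hω n
    exact ⟨t, ht, htC⟩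
  have h0 := le_antisymm (ge_of_tendsto' hlim hle) (zero_le (a := c * _))
  rw [mul_eq_zero] at h0
  have h1 := h0.resolve_left (ENNReal.ofReal_pos.2 (Real.exp_pos _)).ne'
  rw [ae_iff]
  simpa only [not_eventually, not_not] using h1

lemma driftsToPosInfty_of_nat (hn : ∀ᵐ ω ∂μ, Tendsto (fun n : ℕ => X n ω) atTop atTop) :
    DriftsToPosInfty μ X := by
  have h1 : ∀ᵐ ω ∂μ, ∀ M : ℕ, ∀ᶠ t in atTop, X t ω ∉ Iio (M : ℝ) := by
    refine ae_all_iff.2 fun M => hX.ae_eventually_notMem hg measurableSet_Iio ?_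
    filter_upwards [hn] with ω hω
    filter_upwards [hω.eventually_ge_atTop (M : ℝ)] with n hn
    exact not_lt.2 hn
  filter_upwards [h1] with ω hω
  refine tendsto_atTop.2 fun b => ?_
  filter_upwards [hω ⌈b⌉₊] with t ht
  exact (Nat.le_ceil b).trans (not_lt.1 ht)

lemma driftsToNegInfty_of_nat (hn : ∀ᵐ ω ∂μ, Tendsto (fun n : ℕ => X n ω) atTop atBot) :
    DriftsToNegInfty μ X := by
  have h1 : ∀ᵐ ω ∂μ, ∀ M : ℕ, ∀ᶠ t in atTop, X t ω ∉ Ioi (-(M : ℝ)) := by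
    refine ae_all_iff.2 fun M => hX.ae_eventually_notMem hg measurableSet_Ioi ?_
    filter_upwards [hn] with ω hω
    filter_upwards [hω.eventually_le_atBot (-(M : ℝ))] with n hn
    exact not_lt.2 hn
  filter_upwards [h1] with ω hω
  refine tendsto_atBot.2 fun b => ?_
  filter_upwards [hω ⌈-b⌉₊] with t ht
  have := Nat.le_ceil (-b)
  linarith [not_lt.1 (mem_Ioi.not.1 ht)]

/-- The expectations of e^{βX_n} form a geometric series of ratio e^{ψ(β)} < 1, so almost surely
e^{βX_n} → 0. No mean of X_1 is needed. -/
lemma driftsToNegInfty {β : ℝ} (hβ : 0 < β) (hψ : laplaceExponent ν β < 0) :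
    DriftsToNegInfty μ X := by
  refine hX.driftsToNegInfty_of_nat hg ?_
  have hm : ∀ n : ℕ, Measurable fun ω => ENNReal.ofReal (Real.exp (β * X n ω)) := fun n =>
    ((hX.compoundPoisson.levy.measurable n).const_mul β).exp.ennreal_ofReal
  have hE : ∀ n : ℕ, ∫⁻ ω, ENNReal.ofReal (Real.exp (β * X n ω)) ∂μ =
      ENNReal.ofReal (Real.exp (laplaceExponent ν β)) ^ n := fun n => by
    have h1 := hX.lintegral_exp_increment (zero_le (a := (n : ℝ≥0))) hβ.le
    simp only [(hg _).start, sub_zero, NNReal.coe_zero, NNReal.coe_natCast] at h1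
    rw [h1, ← ENNReal.ofReal_pow (Real.exp_pos _).le, ← Real.exp_nat_mul]
  have hsum : ∫⁻ ω, ∑' n : ℕ, ENNReal.ofReal (Real.exp (β * X n ω)) ∂μ ≠ ⊤ := by
    rw [lintegral_tsum fun n => (hm n).aemeasurable]
    simp only [hE]
    rw [ENNReal.tsum_geometric, Ne, ENNReal.inv_eq_top, tsub_eq_zero_iff_le, not_le]
    rw [ENNReal.ofReal_lt_one]
    exact Real.exp_lt_one_iff.2 hψ
  filter_upwards [ae_lt_top (Measurable.tsum hm) hsum] with ω hω
  have h0 := ENNReal.tendsto_atTop_zero_of_tsum_ne_top hω.ne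
  refine tendsto_atBot.2 fun b => ?_
  filter_upwards [h0.eventually_lt_const (ENNReal.ofReal_pos.2 (Real.exp_pos (β * b)))] with n hn
  rw [ENNReal.ofReal_lt_ofReal_iff (Real.exp_pos _), Real.exp_lt_exp] at hn
  exact (lt_of_mul_lt_mul_left hn hβ.le).le

lemma driftsToPosInfty {d : ℝ} (hd0 : 0 < d) (hd : Tendsto (fun β : ℝ =>
    (laplaceExponent ν β - laplaceExponent ν 0) / β) (𝓝[>] 0) (𝓝 d)) :
    DriftsToPosInfty μ X := by
  refine hX.driftsToPosInfty_of_nat hg ?_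
  obtain ⟨hint, hmean⟩ := hX.integral_one hd
  have hid := hX.identDistrib_increment
  have h0 := strong_law_ae_real (fun (i : ℕ) ω => X (i + 1) ω - X i ω)
    ((hid 0).integrable_iff.2 hint)
    (fun i j hij => hX.iIndepFun_increment.indepFun hij) (fun i => (hid i).trans (hid 0).symm)
  rw [(hid 0).integral_eq, hmean] at h0
  filter_upwards [h0] with ω hω
  refine (hω.pos_mul_atTop hd0 tendsto_natCast_atTop_atTop).congr' ?_
  filter_upwards [eventually_ne_atTop 0] with n hn
  rw [div_mul_cancel₀ _ (Nat.cast_ne_zero.2 hn)]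
  have := Finset.sum_range_sub (fun i : ℕ => X i ω) n
  simpa [(hg ω).start] using this

/-- The integer-time walk and its negative are both centred and nondegenerate, hence unbounded
below. Integer times alone already force the extreme limsup and liminf. -/
lemma oscillates (hd : Tendsto (fun β : ℝ =>
    (laplaceExponent ν β - laplaceExponent ν 0) / β) (𝓝[>] 0) (𝓝 0)) :
    Oscillates μ X := by
  obtain ⟨hint, hmean⟩ := hX.integral_one hd
  have hid := hX.identDistrib_increment
  have hm : ∀ i : ℕ, Measurable fun ω => X (i + 1) ω - X i ω := fun i =>
    (hX.compoundPoisson.levy.measurable _).sub (hX.compoundPoisson.levy.measurable _)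
  have hξ0 : (fun ω => X ((0 : ℕ) + 1) ω - X (0 : ℕ) ω) = X 1 := by
    ext ω
    simp [(hg ω).start]
  have hsum : ∀ ω (n : ℕ), ∑ i ∈ Finset.range n, (X (i + 1) ω - X i ω) = X n ω := fun ω n => by
    have := Finset.sum_range_sub (fun i : ℕ => X i ω) n
    simpa [(hg ω).start] using this
  have h1 := ae_not_bddBelow_sum hm hX.iIndepFun_increment
    (fun i => (hid i).trans (hid 0).symm) (by rwa [hξ0]) (by rwa [hξ0])
    (by rw [hξ0]; exact hX.not_ae_eq_zero)
  have h2 := ae_not_bddBelow_sum (ξ := fun (i : ℕ) ω => -(X (i + 1) ω - X i ω))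
    (fun i => (hm i).neg) (hX.iIndepFun_increment.comp (fun _ x => -x) fun _ => measurable_neg)
    (fun i => ((hid i).trans (hid 0).symm).comp measurable_neg)
    (by have := hint.neg; rw [← hξ0] at this; exact this)
    (by rw [integral_neg, hξ0, hmean, neg_zero])
    (fun h => hX.not_ae_eq_zero (by
      filter_upwards [h] with ω hω
      rw [← hξ0]
      simpa [sub_eq_zero, eq_comm] using hω))
  simp only [Finset.sum_neg_distrib, hsum] at h1 h2
  filter_upwards [h1, h2] with ω hω1 hω2
  constructor
  · refine eq_top_iff.2 (EReal.ge_of_forall_gt_iff_ge.1 fun b _ => ?_)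
    refine le_limsup_of_frequently_le ?_
    refine (tendsto_natCast_atTop_atTop (R := ℝ≥0)).frequently (fun hev => hω2 ?_)
    refine IsBoundedUnder.bddBelow_range ⟨-b, eventually_map.2 ?_⟩
    filter_upwards [hev] with n hn
    have h3 : ¬ b ≤ X n ω := fun h => hn (EReal.coe_le_coe_iff.2 h)
    linarith [not_le.1 h3]
  · refine eq_bot_iff.2 (EReal.le_of_forall_lt_iff_le.1 fun b _ => ?_)
    refine liminf_le_of_frequently_le ?_
    refine (tendsto_natCast_atTop_atTop (R := ℝ≥0)).frequently (fun hev => hω1 ?_)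
    refine IsBoundedUnder.bddBelow_range ⟨b, eventually_map.2 ?_⟩
    filter_upwards [hev] with n hn
    have h3 : ¬ X n ω ≤ b := fun h => hn (EReal.coe_le_coe_iff.2 h)
    exact (not_le.1 h3).le

end LongTerm

end IsSkipFreeLevyChain
end SkipFree

/-! ### Transfer between indistinguishable processes, and conclusion. -/

namespace SkipFree

variable {Ω : Type*} {mΩ : MeasurableSpace Ω} {μ : Measure Ω} {ℱ : Filtration ℝ≥0 mΩ}
  {X : ℝ≥0 → Ω → ℝ} {ν : Measure ℝ} {h : ℝ}

lemma HasGeometricLaw.congr {Y Y' : Ω → EReal} {a : ℝ} (hY : HasGeometricLaw μ Y a)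
    (heq : Y' =ᵐ[μ] Y) : HasGeometricLaw μ Y' a := by
  obtain ⟨q, hq, hqa, hlaw⟩ := hY
  exact ⟨q, hq, hqa, hlaw.congr heq⟩

lemma IsKilledRandomWalk.congr {S S' : ℕ → Ω → ℝ≥0∞} {F : Measure ℝ≥0∞} {G : Measure ℕ∞}
    (hS : IsKilledRandomWalk μ S F G) (heq : ∀ᵐ ω ∂μ, ∀ n, S' n ω = S n ω) :
    IsKilledRandomWalk μ S' F G :=
  HasLaw.congr hS (heq.mono fun _ hω => funext hω)

lemma HasStationaryIndepIncrementsUpToExplosion.congr {S S' : ℕ → Ω → ℝ≥0∞}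
    {F : Measure ℝ≥0∞} (hS : HasStationaryIndepIncrementsUpToExplosion μ S F)
    (heq : ∀ᵐ ω ∂μ, ∀ n, S' n ω = S n ω) :
    HasStationaryIndepIncrementsUpToExplosion μ S' F := by
  intro n
  have hset : {ω | (n : ℕ∞) < explosionTime (fun m => S' m ω)} =ᵐ[μ]
      {ω | (n : ℕ∞) < explosionTime (fun m => S m ω)} := by
    refine eventuallyEq_set.2 ?_
    filter_upwards [heq] with ω hω
    simp only [hω]
  have hcond : μ[|{ω | (n : ℕ∞) < explosionTime (fun m => S' m ω)}] =
      μ[|{ω | (n : ℕ∞) < explosionTime (fun m => S m ω)}] := by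
    rw [ProbabilityTheory.cond, ProbabilityTheory.cond, measure_congr hset,
      Measure.restrict_congr_set hset]
  rw [hcond]
  refine (hS n).congr ?_
  filter_upwards [cond_absolutelyContinuous.ae_le heq] with ω hω
  simp only [hω]

/-- Drift to `+∞`, oscillation and drift to `-∞` are mutually exclusive, so three implications
from a trichotomy give equivalences. -/
lemma longTerm_iff [IsProbabilityMeasure μ] {d : EReal} (hpos : 0 < d → DriftsToPosInfty μ X)
    (hzero : d = 0 → Oscillates μ X) (hneg : d < 0 → DriftsToNegInfty μ X) :
    (DriftsToPosInfty μ X ↔ 0 < d) ∧ (Oscillates μ X ↔ d = 0) ∧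
      (DriftsToNegInfty μ X ↔ d < 0) := by
  have hpz : DriftsToPosInfty μ X → ¬ Oscillates μ X := fun h1 h2 => by
    obtain ⟨ω, hω, hω'⟩ := (h1.and h2).exists
    have := (EReal.tendsto_coe_nhds_top_iff.2 hω).liminf_eq
    exact bot_ne_top (hω'.2.symm.trans this)
  have hnz : DriftsToNegInfty μ X → ¬ Oscillates μ X := fun h1 h2 => by
    obtain ⟨ω, hω, hω'⟩ := (h1.and h2).exists
    have := (EReal.tendsto_coe_nhds_bot_iff.2 hω).limsup_eq
    exact bot_ne_top (this.symm.trans hω'.1)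
  have hpn : DriftsToPosInfty μ X → ¬ DriftsToNegInfty μ X := fun h1 h2 => by
    obtain ⟨ω, hω, hω'⟩ := (h1.and h2).exists
    exact hω.not_tendsto (disjoint_atBot_atTop.symm) hω'
  rcases lt_trichotomy d 0 with hd | hd | hd
  · have h := hneg hd
    exact ⟨⟨fun h' => absurd h (hpn h'), fun h' => absurd h' hd.not_gt⟩,
      ⟨fun h' => absurd h' (hnz h), fun h' => absurd h' hd.ne⟩, fun _ => hd, fun _ => h⟩
  · have h := hzero hd
    exact ⟨⟨fun h' => absurd h (hpz h'), fun h' => absurd h' hd.not_gt⟩,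
      ⟨fun _ => hd, fun _ => h⟩, fun h' => absurd h (hnz h'), fun h' => absurd hd h'.ne⟩
  · have h := hpos hd
    exact ⟨⟨fun _ => hd, fun _ => h⟩, ⟨fun h' => absurd h' (hpz h), fun h' => absurd h' hd.ne'⟩,
      fun h' => absurd h' (hpn h), fun h' => absurd h' hd.not_gt⟩

end SkipFree

theorem mainTheorem9 {Ω : Type*} {mΩ : MeasurableSpace Ω} (μ : Measure Ω) [IsProbabilityMeasure μ]
    (ℱ : Filtration ℝ≥0 mΩ) (X : ℝ≥0 → Ω → ℝ) (ν : Measure ℝ) (h : ℝ)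
    (hX : SkipFree.IsSkipFreeLevyChain μ ℱ X ν h) :
    -- `Φ` is well defined
    (IsGreatest {β : ℝ | 0 ≤ β ∧ SkipFree.laplaceExponent ν β = 0} (SkipFree.laplaceInverse ν 0) ∧
      BijOn (SkipFree.laplaceExponent ν) (Ici (SkipFree.laplaceInverse ν 0)) (Ici 0) ∧
      InvOn (SkipFree.laplaceInverse ν) (SkipFree.laplaceExponent ν)
        (Ici (SkipFree.laplaceInverse ν 0)) (Ici 0)) ∧
    -- the supremum at an independent exponential time
    (∀ p : ℝ, 0 < p → ∀ e : Ω → ℝ, HasLaw e (expMeasure p) μ →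
      IndepFun (fun ω t => X t ω) e μ →
      SkipFree.HasGeometricLaw μ
        (fun ω => SkipFree.runningSup X (e ω).toNNReal ω / (h : EReal))
        (Real.exp (-(SkipFree.laplaceInverse ν p * h)))) ∧
    -- long-term behaviour, where `d` is the right derivative of `ψ` at `0`
    (∃ d : EReal, d < ⊤ ∧
      Tendsto (fun β : ℝ => (((SkipFree.laplaceExponent ν β - SkipFree.laplaceExponent ν 0) / β
        : ℝ) : EReal)) (𝓝[>] 0) (𝓝 d) ∧
      (SkipFree.DriftsToPosInfty μ X ↔ 0 < d) ∧
      (SkipFree.Oscillates μ X ↔ d = 0) ∧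
      (SkipFree.DriftsToNegInfty μ X ↔ d < 0) ∧
      (d < 0 → SkipFree.HasGeometricLaw μ (fun ω => SkipFree.overallSup X ω / (h : EReal))
        (Real.exp (-(SkipFree.laplaceInverse ν 0 * h))))) ∧
    -- the passage times `T_{nh}`
    ((∀ᵐ ω ∂μ, SkipFree.passageTime X 0 ω = 0) ∧
      (∀ᵐ ω ∂μ, ∀ n : ℕ, SkipFree.passageTime X (n * h) ω < ⊤ →
        SkipFree.passageTime X (n * h) ω < SkipFree.passageTime X ((n + 1) * h) ω) ∧
      ∃ (F : Measure ℝ≥0∞) (G : Measure ℕ∞), IsProbabilityMeasure F ∧ F (Ioo 0 ⊤)ᶜ = 0 ∧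
        SkipFree.IsGeometricKillingLaw G (Real.exp (-(SkipFree.laplaceInverse ν 0 * h))) ∧
        HasLaw (fun ω => SkipFree.explosionTime
          (fun n => SkipFree.passageTime X (n * h) ω)) G μ ∧
        SkipFree.HasStationaryIndepIncrementsUpToExplosion μ
          (fun n => SkipFree.passageTime X (n * h)) F ∧
        SkipFree.IsKilledRandomWalk μ (fun n => SkipFree.passageTime X (n * h)) F G) := by
  have hν := hX.skipFreeJumps
  have hh := hX.step_pos
  -- All quantities in the statement depend on the path only, so they agree almost surely for the
  -- two processes; the filtration plays no role in the conclusions.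
  obtain ⟨ℱ', X', hX', hg, heq⟩ := hX.exists_regular
  have hpass : ∀ᵐ ω ∂μ, ∀ x : ℝ, SkipFree.passageTime X x ω = SkipFree.passageTime X' x ω := by
    filter_upwards [heq] with ω hω x
    simp only [SkipFree.passageTime, hω]
  have hlevel : ∀ᵐ ω ∂μ, ∀ n : ℕ, SkipFree.passageTime X (n * h) ω =
      SkipFree.levelTime X' h n ω := hpass.mono fun ω hω n => hω _
  refine ⟨?_, fun p hp e he hind => ?_, ?_, ?_, ?_, ?_⟩
  · rw [hν.laplaceInverse_zero]
    exact ⟨hν.isGreatest_largestRoot, hν.bijOn_laplaceExponent, hν.invOn_laplaceInverse⟩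
  · have hpath : (fun ω t => X t ω) =ᵐ[μ] fun ω t => X' t ω := heq.mono fun ω hω => funext hω
    refine (hX'.hasGeometricLaw_runningSup hg hp he
      (hind.congr hpath EventuallyEq.rfl)).congr ?_
    filter_upwards [heq] with ω hω
    simp only [SkipFree.runningSup, hω]
  · obtain ⟨d, hd, hlim, hneg⟩ := hν.exists_rightDeriv
    -- Only for `d < 0` can the derivative be infinite, and that case does not go through the mean.
    have hreal : 0 ≤ d → Tendsto (fun β : ℝ => (SkipFree.laplaceExponent ν β -
        SkipFree.laplaceExponent ν 0) / β) (𝓝[>] 0) (𝓝 d.toReal) := fun h0 => by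
      rwa [← EReal.tendsto_coe,
        EReal.coe_toReal hd.ne (ne_bot_of_le_ne_bot EReal.zero_ne_bot h0)]
    have hlong := SkipFree.longTerm_iff (μ := μ) (X := X) (d := d)
      (fun h0 => by
        have h1 := hX'.driftsToPosInfty hg (EReal.toReal_pos h0 hd.ne) (hreal h0.le)
        filter_upwards [h1, heq] with ω hω hωe
        simpa only [hωe] using hω)
      (fun h0 => by
        have h1 := hX'.oscillates hg (by simpa [h0] using hreal h0.ge)
        filter_upwards [h1, heq] with ω hω hωe
        simpa only [hωe] using hω)
      (fun h0 => by
        obtain ⟨β, hβ, hψ⟩ := hneg h0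
        have h1 := hX'.driftsToNegInfty hg hβ hψ
        filter_upwards [h1, heq] with ω hω hωe
        simpa only [hωe] using hω)
    refine ⟨d, hd, hlim, hlong.1, hlong.2.1, hlong.2.2, fun h0 => ?_⟩
    obtain ⟨β, hβ, hψ⟩ := hneg h0
    -- A negative value of ψ at some β > 0 forces a root to its right.
    have hΦ : 0 < SkipFree.laplaceInverse ν 0 := by
      rw [hν.laplaceInverse_zero]
      exact hβ.trans_le (hν.le_largestRoot hβ.le hψ.le)
    refine (hX'.hasGeometricLaw_overallSup hg hΦ).congr ?_
    filter_upwards [heq] with ω hω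
    simp only [SkipFree.overallSup, hω]
  · filter_upwards [hpass] with ω hω
    rw [hω, (hg ω).passageTime_zero]
  · filter_upwards [hpass] with ω hω n hn
    rw [hω] at hn ⊢
    rw [hω]
    exact (hg ω).passageTime_lt hh hn
  · refine ⟨SkipFree.stepLaw μ X' h,
      μ.map fun ω => SkipFree.explosionTime (fun n => SkipFree.levelTime X' h n ω),
      hX'.isProbabilityMeasure_stepLaw hg, hX'.stepLaw_compl_Ioo hg,
      hX'.isGeometricKillingLaw_map_explosionTime hg, ?_,
      (hX'.hasStationaryIndepIncrements hg).congr hlevel,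
      (hX'.isKilledRandomWalk hg).congr hlevel⟩
    refine HasLaw.congr ⟨(hX'.measurable_explosionTime hg).aemeasurable, rfl⟩ ?_
    filter_upwards [hlevel] with ω hω
    simp only [hω]
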